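/- **Setting.** Let $H$ be a complex Hilbert space, $(e^{-tA})_{t\ge 0}$ a bounded $C_0$ semigroup on $H$ with generator $-A$, and $B:\mathbb C\to H$, $C:H\to\mathbb C$ bounded linear maps. Suppose that the linear system $(-A,B,C)$ is $(2,2)$-admissible, that is, that $$\Xi_0 f=\int_0^\infty e^{-sA}Bf(s)\,ds,\qquad \Theta_0 f=\int_0^\infty e^{-sA^\dagger}C^\dagger f(s)\,ds$$ define Hilbert–Schmidt operators $L^2(0,\infty)\to H$. Put $\phi(x)=Ce^{-xA}B$, $\phi_{(x)}(y)=\phi(2x+y)$, and let $\Gamma_x=\Gamma_{\phi_{(x)}}$ be the Hankel operator $\Gamma_x f(s)=\int_0^\infty \phi(2x+s+t)f(t)\,dt$ on $L^2(0,\infty)$. **Theorem.** For every $x>0$ the operator $\Gamma_x$ is bounded and trace class, so the Fredholm determinants $\det(I\pm\mu\Gamma_x)$ and $\det(I-\mu^2\Gamma_x^2)$ exist for all $\mu\in\mathbb C$. Put $X_\mu=\{x>0:\det(I-\mu^2\Gamma_x^2)\neq 0\}$. (i) There is $\delta>0$ such that $X_\mu=(0,\infty)$ whenever $|\mu|<\delta$;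 for every $\mu\in\mathbb C$, $X_\mu$ contains a half-line $(x_0,\infty)$ with $x_0>0$. For every $\mu\in\mathbb C$ (in particular for $|\mu|<\delta$) there are $W,V$, continuous on $\{(x,y):x\in X_\mu,\ x\le y\}$, such that $$T(x,y)=\begin{bmatrix}W(x,y)&V(x,y)\\ V(x,y)&W(x,y)\end{bmatrix},\qquad \Phi(x)=\begin{bmatrix}0&\phi(x)\\ \phi(x)&0\end{bmatrix}$$ satisfy the Gelfand–Levitan equation $$T(x,y)+\Phi(x+y)+\mu\int_x^\infty T(x,z)\Phi(z+y)\,dz=0\qquad(x\in X_\mu,\ x\le y),$$ with absolutely convergent integrals, and, if $\mu\ne0$, for all $x\in X_\mu$ the determinants $\det(I\pm\mu\Gamma_x)$ are non-zero, the derivatives below exist, and $$W(x,x)=\frac1{2\mu}\frac{d}{dx}\log\det(I-\mu^2\Gamma_x^2),\qquad V(x,x)=\frac1{2\mu}\frac{d}{dx}\log\frac{\det(I+\mu\Gamma_x)}{\det(I-\mu\Gamma_x)},$$ $$\frac1{2\mu}\frac{d}{dx}W(x,x)=-V(x,x)^2,$$ where $\frac{d}{dx}\log f$ means $f'/f$.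 (ii) If $\phi$ is real-valued on $(0,\infty)$, then for each $x>0$ there are finitely or countably many complex numbers $z_j(x)$, such that all the numbers $\pm z_j(x)$ are mutually distinct and, for every $\mu\in\mathbb C$ with $\det(I-\mu\Gamma_x)\ne0$, all $1-\mu z_j(x)$ are non-zero and (with unconditional convergence) $$\frac{\det(I+\mu\Gamma_x)}{\det(I-\mu\Gamma_x)}=\prod_j\frac{1+\mu z_j(x)}{1-\mu z_j(x)}.$$ (iii) Let $\mu=\frac12$, let $V,W$ be the corresponding functions in (i), $v(x)=V(x,x)$, $w(x)=W(x,x)$, $\tau_0(x)=\det(I-\frac12\Gamma_x)$ and $\tau_1(x)=\det(I+\frac12\Gamma_x)$. Then $u=-2(\log\tau_0)''$ is the Miura transform of $v$ on $X_{1/2}$, in the following sense. For every $x\in X_{1/2}$ the function $v+2(\log\tau_0)'$ is differentiable at $x$ with derivative $-v(x)^2$ (so that $u=v'+v^2$ holds in integrated form). The function $(\log\tau_0)'$ is differentiable at $x\in X_{1/2}$ if and only if $v$ is, and at every such $x$, $\tau_0$ and $\tau_1$ are twice differentiable, $v=(\log(\tau_1/\tau_0))'$ and $w=(\log(\tau_0\tau_1))'$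 near $x$, and at $x$ $$\tau_0''\tau_1-2\tau_0'\tau_1'+\tau_0\tau_1''=0,\qquad u=-2(\log\tau_0)''=v'+v^2.$$ -/

import Mathlib

open Set Filter Topology MeasureTheory

noncomputable section

namespace TauLinearSystem

/-! ### Operators on Hilbert space -/

section Operators

universe u v

variable {E : Type u} [NormedAddCommGroup E] [InnerProductSpace ℂ E]
variable {F : Type v} [NormedAddCommGroup F] [InnerProductSpace ℂ F]

/-- Hilbert-Schmidt operators: `∑ ‖T bᵢ‖² < ∞` for an orthonormal basis `b` (the sum does not depend
on the choice of the basis). -/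
def IsHilbertSchmidt (T : E →L[ℂ] F) : Prop :=
  ∃ (ι : Type u) (b : HilbertBasis ι ℂ E), Summable fun i => ‖T (b i)‖ ^ 2

/-- Trace class operators on a Hilbert space, as nuclear operators:
`T = ∑ₙ ⟨fₙ, ·⟩ gₙ` with `∑ₙ ‖fₙ‖ ‖gₙ‖ < ∞`. -/
def IsTraceClass (T : E →L[ℂ] E) : Prop :=
  ∃ f g : ℕ → E, (Summable fun n => ‖f n‖ * ‖g n‖) ∧
    ∀ ξ, HasSum (fun n => inner ℂ (f n) ξ • g n) (T ξ)

open Classical in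
/-- `d` is the Fredholm determinant `det (I + T)`: in every orthonormal basis, the determinants of
the finite sections `I + (⟨bᵢ, T bⱼ⟩)_{i, j ∈ s}` converge to `d`. -/
def HasFredholmDet (T : E →L[ℂ] E) (d : ℂ) : Prop :=
  ∀ (ι : Type u) (b : HilbertBasis ι ℂ E),
    Tendsto
      (fun s : Finset ι => Matrix.det
        ((1 : Matrix s s ℂ) + Matrix.of fun i j : s => inner ℂ (b i) (T (b j))))
      atTop (𝓝 d)

/-- The Fredholm determinant `det (I + T)`; meaningful when `HasFredholmDet T d` for some `d`,
in particular when `T` is trace class. -/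
def fredholmDet (T : E →L[ℂ] E) : ℂ :=
  Classical.epsilon (HasFredholmDet T)

end Operators

/-! ### Hankel operators -/

/-- `L²((0, ∞); E)`. -/
abbrev L2 (E : Type*) [NormedAddCommGroup E] : Type _ :=
  Lp E 2 (volume.restrict (Ioi (0 : ℝ)))

/-- `G` is the Hankel integral operator on `L²(0, ∞)` with symbol `ψ`, i.e.
`G f (s) = ∫₀^∞ ψ(s + t) f(t) dt`, the integral being absolutely convergent. -/
def IsHankelOperator (ψ : ℝ → ℂ) (G : L2 ℂ →L[ℂ] L2 ℂ) : Prop :=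
  ∀ f : L2 ℂ, ∀ᵐ s ∂(volume.restrict (Ioi (0 : ℝ))),
    IntegrableOn (fun t => ψ (s + t) * f t) (Ioi 0) ∧
      G f s = ∫ t in Ioi (0 : ℝ), ψ (s + t) * f t

/-- `τ(x; μ) = det (I + μ Γ_x)` for a family of operators `Γ_x`. -/
def tau (Γ : ℝ → (L2 ℂ →L[ℂ] L2 ℂ)) (μ : ℂ) (x : ℝ) : ℂ :=
  fredholmDet (μ • Γ x)

/-- `det (I - μ² Γ_x²)` for a family of operators `Γ_x`. -/
def tauSq (Γ : ℝ → (L2 ℂ →L[ℂ] L2 ℂ)) (μ : ℂ) (x : ℝ) : ℂ :=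
  fredholmDet ((-μ ^ 2) • (Γ x ∘L Γ x))

/-! ### Linear systems -/

section Systems

variable {H : Type*} [NormedAddCommGroup H] [InnerProductSpace ℂ H]

/-- `S` restricted to `[0, ∞)` is a `C₀` semigroup of bounded operators. -/
structure IsC0Semigroup (S : ℝ → H →L[ℂ] H) : Prop where
  zero : S 0 = 1
  add : ∀ s t, 0 ≤ s → 0 ≤ t → S (s + t) = S s * S t
  continuousOn : ∀ ξ, ContinuousOn (fun t => S t ξ) (Ici 0)

/-- `G` is the infinitesimal generator of `S`: its domain consists of those `ξ` for which
`lim_{t → 0+} (S t ξ - ξ) / t` exists, and `G ξ` is this limit. -/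
structure IsGenerator (G : H →ₗ.[ℂ] H) (S : ℝ → H →L[ℂ] H) : Prop where
  mem_domain : ∀ ξ, ξ ∈ G.domain ↔
    ∃ η, Tendsto (fun t : ℝ => ((t⁻¹ : ℝ) : ℂ) • (S t ξ - ξ)) (𝓝[>] 0) (𝓝 η)
  tendsto : ∀ ξ : G.domain,
    Tendsto (fun t : ℝ => ((t⁻¹ : ℝ) : ℂ) • (S t (ξ : H) - (ξ : H))) (𝓝[>] 0) (𝓝 (G ξ))

/-- A linear system `(-A, B, C)` with state space `H` and input and output space `H₀`: `-A`
generates a bounded `C₀` semigroup `(expNeg t)_{t ≥ 0} = (e^{-tA})_{t ≥ 0}` on `H`, and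
`B : H₀ → H`, `C : H → H₀` are bounded. Values of `expNeg` at negative times are irrelevant. -/
structure LinearSystem (H : Type*) [NormedAddCommGroup H] [InnerProductSpace ℂ H]
    (H₀ : Type*) [NormedAddCommGroup H₀] [InnerProductSpace ℂ H₀] where
  A : H →ₗ.[ℂ] H
  B : H₀ →L[ℂ] H
  C : H →L[ℂ] H₀
  expNeg : ℝ → H →L[ℂ] H
  isC0Semigroup : IsC0Semigroup expNeg
  isGenerator : IsGenerator (-A) expNeg
  bounded : ∃ M : ℝ, ∀ t, 0 ≤ t → ‖expNeg t‖ ≤ M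

variable {H₀ : Type*} [NormedAddCommGroup H₀] [InnerProductSpace ℂ H₀]

/-- The operator `Ξ f = ∫₀^∞ e^{-sA} B f(s) ds`. -/
def LinearSystem.IsControllabilityOperator (L : LinearSystem H H₀) (Ξ : L2 H₀ →L[ℂ] H) : Prop :=
  ∀ f : L2 H₀, IntegrableOn (fun s => L.expNeg s (L.B (f s))) (Ioi 0) ∧
    Ξ f = ∫ s in Ioi (0 : ℝ), L.expNeg s (L.B (f s))

/-- The operator `Θ f = ∫₀^∞ (e^{-sA})† C† f(s) ds`. -/
def LinearSystem.IsObservabilityOperator [CompleteSpace H] [CompleteSpace H₀]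
    (L : LinearSystem H H₀) (Θ : L2 H₀ →L[ℂ] H) : Prop :=
  ∀ f : L2 H₀,
    IntegrableOn (fun s => ContinuousLinearMap.adjoint (L.expNeg s)
      (ContinuousLinearMap.adjoint L.C (f s))) (Ioi 0) ∧
    Θ f = ∫ s in Ioi (0 : ℝ), ContinuousLinearMap.adjoint (L.expNeg s)
      (ContinuousLinearMap.adjoint L.C (f s))

/-- `(2,2)`-admissibility: the observability and controllability operators are bounded and
Hilbert-Schmidt from `L²((0, ∞); H₀)` to `H`. -/
def LinearSystem.IsTwoTwoAdmissible [CompleteSpace H] [CompleteSpace H₀]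
    (L : LinearSystem H H₀) : Prop :=
  (∃ Θ : L2 H₀ →L[ℂ] H, L.IsObservabilityOperator Θ ∧ IsHilbertSchmidt Θ) ∧
    ∃ Ξ : L2 H₀ →L[ℂ] H, L.IsControllabilityOperator Ξ ∧ IsHilbertSchmidt Ξ

/-- The scattering function `φ(x) = C e^{-xA} B` of a system with input and output space `ℂ`. -/
def LinearSystem.phi (L : LinearSystem H ℂ) (x : ℝ) : ℂ :=
  L.C (L.expNeg x (L.B 1))

end Systems

/-! ### The Gelfand-Levitan equation and the Miura transform -/

/-- For `x ∈ X` and `x ≤ y`, the matrix kernel `T` satisfies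
`T(x, y) + Φ(x + y) + μ ∫_x^∞ T(x, z) Φ(z + y) dz = 0`, with absolutely convergent integrals; moreover
`T` is continuous there, so that its values on the diagonal are the limits from `x < y`. -/
structure SolvesGelfandLevitan {n : Type*} [Fintype n] (μ : ℂ) (Φ : ℝ → Matrix n n ℂ)
    (X : Set ℝ) (T : ℝ → ℝ → Matrix n n ℂ) : Prop where
  continuousOn : ContinuousOn (fun p : ℝ × ℝ => T p.1 p.2) {p | p.1 ∈ X ∧ p.1 ≤ p.2}
  integrableOn : ∀ x ∈ X, ∀ y, x ≤ y → ∀ i j,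
    IntegrableOn (fun z => (T x z * Φ (z + y)) i j) (Ioi x)
  equation : ∀ x ∈ X, ∀ y, x ≤ y → ∀ i j,
    T x y i j + Φ (x + y) i j + μ * ∫ z in Ioi x, (T x z * Φ (z + y)) i j = 0

/-- At the point `x`, `u` is the Miura transform of `v` through `τ₀` and `τ₁`:
`v = (log (τ₁ / τ₀))'` and `w = (log (τ₀ τ₁))'` near `x`, `u = -2 (log τ₀)''` at `x`, and
`τ₀'' τ₁ - 2 τ₀' τ₁' + τ₀ τ₁'' = 0` at `x`, where `τ₀`, `τ₁` are non-zero and twice differentiable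
at `x`. -/
structure IsMiuraTransformAt (τ₀ τ₁ v w u : ℝ → ℂ) (x : ℝ) : Prop where
  ne_zero : τ₀ x ≠ 0 ∧ τ₁ x ≠ 0
  differentiable : ∀ᶠ s in 𝓝 x, DifferentiableAt ℝ τ₀ s ∧ DifferentiableAt ℝ τ₁ s
  differentiable_deriv : DifferentiableAt ℝ (deriv τ₀) x ∧ DifferentiableAt ℝ (deriv τ₁) x
  v_eq : ∀ᶠ s in 𝓝 x, v s = logDeriv (fun r => τ₁ r / τ₀ r) s
  w_eq : ∀ᶠ s in 𝓝 x, w s = logDeriv (fun r => τ₀ r * τ₁ r) s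
  u_eq : u x = -2 * deriv (logDeriv τ₀) x
  bilinear : deriv (deriv τ₀) x * τ₁ x - 2 * (deriv τ₀ x * deriv τ₁ x)
    + τ₀ x * deriv (deriv τ₁) x = 0

end TauLinearSystem

end

/-! Everything is transported from the Hankel operator on `L²(0,∞)` to the state space. With `S_x`
the left shift, `Γ_x = (Θ S_x†)† (Ξ S_x†)` is a product of two Hilbert-Schmidt operators, hence
trace class. Since `det(1 + XY) = det(1 + YX)`, it has the same determinants as `R_x = ∫_x^∞ e^{-tA}
B C e^{-tA} dt = Ξ 1_{(x,∞)} Θ†` on `H`. The determinants themselves come from a basis-free series: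
for `T = ∑ ⟨fₙ, ·⟩ gₙ`, `det(1 + T)` is the sum of all finite minors `det ⟨fᵢ, gⱼ⟩`. Hadamard's
inequality makes it absolutely convergent and justifies every passage to the limit.

Let `k_μ(x,y) = C e^{-xA} (1 + μ R_x)⁻¹ e^{-yA} B`. Applying `C e^{-xA} (1 + μ R_x)⁻¹` to `(1 + μ
R_x) e^{-yA} B` gives the scalar integral equation of `k_μ`. The Gelfand-Levitan equation splits
into the scalar equations for `V ± W`, solved by `V + W = -k_μ` and `V - W = -k_{-μ}`.

The logarithmic derivative of `det(1 + μ R_x)` is `-μ k_μ(x,x)`: multiplicativity gives `det(1 + μ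
R_y) / det(1 + μ R_x)` as the determinant of a perturbation of `1` of trace norm `O(y - x)`, and
`det = 1 + tr + O(‖·‖₁²)` leaves only a trace (`norm_tau_sub_le`).

The identity `W' = -2μ V²` is delicate, because `e^{-xA} B` need not lie in the domain of `A`, so
`k_μ(x,x)` itself need not be differentiable. The law `e^{-hA} R_x e^{-hA} = R_{x+h}` turns
`k_{±μ}(x+h,x+h)` into expressions in `P = e^{-2hA}` and `R_x`. In the difference of the two signs
an algebraic identity (`ring_resolvent_identity`) removes all terms in `P - 1` and leaves `R_x - P
R_x P = R_x - R_{x+2h}`, which has a strong derivative. The Miura statement is then algebra: at `μ =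
1/2`, `V + 2 (log τ₀)' = W`.

For the product formula, real `φ` makes `Γ_x` self-adjoint, and `Γ_x U = U† Γ_x` for the isometry
`U` that is the cogenerator of the right shifts. Its defect has dimension at most one, which forces
the multiplicities of `z` and `-z` to differ by at most one. In `∏ (1 + μλ)/(1 - μλ)` over the
eigenvalues the factors of `z` and `-z` are mutually inverse, so exactly one factor survives for
each pair of unequal multiplicities. -/

noncomputable section

namespace TauLinearSystem

/-! ### Determinants of finite matrices -/

section Matrices

open Matrix
open scoped ComplexOrder

variable {n : Type*} [Fintype n] [DecidableEq n]

/-- The determinant of a positive semidefinite matrix whose trace is at most its size is at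
most `1`. -/
theorem re_det_le_one_of_posSemidef {A : Matrix n n ℂ} (hA : A.PosSemidef)
    (htr : A.trace.re ≤ Fintype.card n) : A.det.re ≤ 1 := by
  classical
  rcases isEmpty_or_nonempty n with hn | hn
  · simp
  have hH := hA.isHermitian
  have h0 : ∀ i, 0 ≤ hH.eigenvalues i := hA.eigenvalues_nonneg
  have hdet : A.det.re = ∏ i, hH.eigenvalues i := by
    rw [hH.det_eq_prod_eigenvalues, ← Complex.ofReal_re (∏ i, hH.eigenvalues i)]
    push_cast
    rfl
  have htr' : A.trace.re = ∑ i, hH.eigenvalues i := by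
    rw [hH.trace_eq_sum_eigenvalues, ← Complex.ofReal_re (∑ i, hH.eigenvalues i)]
    push_cast
    rfl
  have hN : (0 : ℝ) < Fintype.card n := by exact_mod_cast Fintype.card_pos
  have h := Real.geom_mean_le_arith_mean Finset.univ (fun _ : n => (1 : ℝ)) hH.eigenvalues
    (fun _ _ => zero_le_one) (by simpa using hN) (fun i _ => h0 i)
  simp only [Real.rpow_one, Finset.sum_const, Finset.card_univ, nsmul_eq_mul, mul_one, one_mul] at h
  rw [← hdet, ← htr'] at h
  have h1 : A.det.re ^ ((Fintype.card n : ℝ)⁻¹) ≤ 1 :=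
    h.trans ((div_le_one hN).2 htr)
  have hd0 : 0 ≤ A.det.re := by rw [hdet]; exact Finset.prod_nonneg fun i _ => h0 i
  by_contra hc
  push Not at hc
  exact absurd h1 (not_le.2 (Real.one_lt_rpow hc (inv_pos.2 hN)))

/-- **Hadamard's inequality**. -/
theorem norm_det_le_prod (M : Matrix n n ℂ) (r : n → ℝ) (hr : ∀ i, 0 ≤ r i)
    (hM : ∀ i, ∑ j, ‖M i j‖ ^ 2 ≤ r i ^ 2) : ‖M.det‖ ≤ ∏ i, r i := by
  by_cases h0 : ∃ i, r i = 0
  · obtain ⟨i, hi⟩ := h0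
    have : ∀ j, M i j = 0 := fun j => by
      have h1 := (Finset.single_le_sum (f := fun j => ‖M i j‖ ^ 2) (fun _ _ => by positivity)
        (Finset.mem_univ j)).trans (hM i)
      rw [hi] at h1
      have : ‖M i j‖ ^ 2 = 0 := le_antisymm (by simpa using h1) (by positivity)
      simpa using this
    rw [det_eq_zero_of_row_eq_zero i this, norm_zero]
    exact Finset.prod_nonneg fun i _ => hr i
  push Not at h0
  have hpos : ∀ i, 0 < r i := fun i => (hr i).lt_of_ne (h0 i).symm
  -- Rows are rescaled to norm at most one. Then `N Nᴴ` is positive semidefinite with trace at most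
  -- the size of the matrix, so the arithmetic-geometric mean inequality bounds `|det N|²` by `1`.
  set D : Matrix n n ℂ := diagonal fun i => ((r i)⁻¹ : ℂ) with hD
  set N := D * M with hN
  have hent : ∀ i j, N i j = (r i : ℂ)⁻¹ * M i j := fun i j => by simp [hN, hD, diagonal_mul]
  have hps : (N * Nᴴ).PosSemidef := posSemidef_self_mul_conjTranspose N
  have htr : (N * Nᴴ).trace.re ≤ Fintype.card n := by
    have h1 : ∀ i, ((N * Nᴴ) i i).re ≤ 1 := fun i => by
      have : (N * Nᴴ) i i = ((∑ j, ‖N i j‖ ^ 2 : ℝ) : ℂ) := by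
        simp [mul_apply, conjTranspose_apply, Complex.mul_conj, Complex.normSq_eq_norm_sq]
      rw [this, Complex.ofReal_re]
      simp_rw [hent, norm_mul, mul_pow, ← Finset.mul_sum]
      rw [norm_inv, Complex.norm_real, Real.norm_of_nonneg (hr i), inv_pow,
        inv_mul_le_iff₀ (by have := hpos i; positivity), mul_one]
      exact hM i
    calc (N * Nᴴ).trace.re = ∑ i, ((N * Nᴴ) i i).re := by simp [trace]
      _ ≤ ∑ _i : n, (1 : ℝ) := Finset.sum_le_sum fun i _ => h1 i
      _ = Fintype.card n := by simp
  have hle := re_det_le_one_of_posSemidef hps htr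
  rw [det_mul, det_conjTranspose] at hle
  have h2 : (N.det * star N.det).re = ‖N.det‖ ^ 2 := by
    simp only [RCLike.star_def]
    rw [Complex.mul_conj, Complex.ofReal_re, Complex.normSq_eq_norm_sq]
  rw [h2] at hle
  have h3 : ‖N.det‖ ≤ 1 := by
    exact le_of_sq_le_sq (by simpa using hle : ‖N.det‖ ^ 2 ≤ 1 ^ 2) zero_le_one
  rw [hN, det_mul, hD, det_diagonal, norm_mul, norm_prod] at h3
  have h4 : ∏ i, ‖((r i : ℂ))⁻¹‖ = (∏ i, r i)⁻¹ := by
    rw [← Finset.prod_inv_distrib]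
    exact Finset.prod_congr rfl fun i _ => by
      rw [norm_inv, Complex.norm_real, Real.norm_of_nonneg (hr i)]
  rw [h4, inv_mul_le_iff₀ (Finset.prod_pos fun i _ => hpos i), mul_one] at h3
  exact h3

/-- `det (1 + M)` is the sum of all principal minors of `M`. -/
theorem det_one_add_eq_sum_minors {R : Type*} [CommRing R] (M : Matrix n n R) :
    (1 + M).det = ∑ s : Finset n, (M.submatrix (Subtype.val : s → n) Subtype.val).det := by
  rw [add_comm]
  have h := (detRowAlternating (n := n) (R := R)).map_add_univ M (1 : Matrix n n R)
  refine h.trans (Finset.sum_congr rfl fun s _ => ?_)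
  exact det_piecewise_one_eq_submatrix_det M s

variable {E : Type*} [NormedAddCommGroup E] [InnerProductSpace ℂ E]

/-- Hadamard's inequality for mixed Gram determinants. -/
theorem norm_det_inner_le (f g : n → E) :
    ‖(Matrix.of fun i j => inner ℂ (f i) (g j)).det‖ ≤ ∏ i, (‖f i‖ * ‖g i‖) := by
  classical
  -- An orthonormal basis of the span of `g` has exactly as many vectors as `n`, so the mixed Gram
  -- matrix factors into two square matrices. Bessel bounds their rows, and Hadamard applies to
  -- each. If `g` is dependent, the determinant vanishes.
  by_cases hg : LinearIndependent ℂ g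
  · set V := Submodule.span ℂ (Set.range g)
    have hfin : Module.finrank ℂ V = Fintype.card n := finrank_span_eq_card hg
    have : FiniteDimensional ℂ V := FiniteDimensional.span_of_finite ℂ (Set.finite_range g)
    let e₀ := stdOrthonormalBasis ℂ V
    let e : OrthonormalBasis n ℂ V :=
      e₀.reindex ((finCongr hfin).trans (Fintype.equivFin n).symm)
    have hon : Orthonormal ℂ fun k => (e k : E) := e.orthonormal.comp_linearIsometry V.subtypeₗᵢ
    have hmul : (Matrix.of fun i j => inner ℂ (f i) (g j)) =
        (Matrix.of fun i k => inner ℂ (f i) (e k : E)) *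
          (Matrix.of fun j k => inner ℂ (e k : E) (g j))ᵀ := by
      ext i j
      have hgj : g j ∈ V := Submodule.subset_span ⟨j, rfl⟩
      have h1 := e.sum_repr' ⟨g j, hgj⟩
      have h2 : g j = ∑ k, inner ℂ (e k : E) (g j) • (e k : E) := by
        have := congrArg (Subtype.val) h1
        simpa using this.symm
      conv_lhs => rw [Matrix.of_apply, h2, inner_sum]
      simp [mul_apply, inner_smul_right, mul_comm]
    rw [hmul, det_mul, norm_mul, det_transpose, Finset.prod_mul_distrib]
    refine mul_le_mul (norm_det_le_prod _ _ (fun _ => norm_nonneg _) fun i => ?_)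
      (norm_det_le_prod _ _ (fun _ => norm_nonneg _) fun i => ?_) (norm_nonneg _)
      (Finset.prod_nonneg fun _ _ => norm_nonneg _)
    · simp only [of_apply, norm_inner_symm (f i)]
      exact hon.sum_inner_products_le (s := Finset.univ) (f i)
    · exact hon.sum_inner_products_le (s := Finset.univ) (g i)
  · obtain ⟨c, hc, i, hi⟩ := Fintype.not_linearIndependent_iff.1 hg
    have : (Matrix.of fun i j => inner ℂ (f i) (g j)).det = 0 := by
      refine exists_mulVec_eq_zero_iff.1 ⟨c, fun h => hi (congrFun h i), ?_⟩
      ext k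
      have : inner ℂ (f k) (∑ j, c j • g j) = 0 := by rw [hc, inner_zero_right]
      rw [inner_sum] at this
      simpa [mulVec, dotProduct, inner_smul_right, mul_comm] using this
    rw [this, norm_zero]
    positivity

end Matrices


/-! ### The Fredholm series -/

section FredholmSeries

variable {E : Type*} [NormedAddCommGroup E] [InnerProductSpace ℂ E] {κ κ' ι : Type*}

open Classical in
/-- The principal minor of the infinite matrix `⟨fᵢ, gⱼ⟩` with index set `s`. -/
def gramMinor (f g : κ → E) (s : Finset κ) : ℂ :=
  (Matrix.of fun i j : s => inner ℂ (f i) (g j)).det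

/-- The sum of all principal minors of the infinite matrix `⟨fᵢ, gⱼ⟩`. -/
def fredholmSeries (f g : κ → E) : ℂ := ∑' s : Finset κ, gramMinor f g s

theorem norm_gramMinor_le (f g : κ → E) (s : Finset κ) :
    ‖gramMinor f g s‖ ≤ ∏ i ∈ s, (‖f i‖ * ‖g i‖) := by
  classical
  refine (norm_det_inner_le _ _).trans_eq ?_
  exact Finset.prod_coe_sort s fun i => ‖f i‖ * ‖g i‖

theorem summable_prod_of_nonneg_summable {a : κ → ℝ} (h0 : ∀ n, 0 ≤ a n) (ha : Summable a) :
    Summable fun s : Finset κ => ∏ i ∈ s, a i :=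
  summable_finsetProd_of_summable_nonneg h0 ha

theorem summable_gramMinor {f g : κ → E} (h : Summable fun n => ‖f n‖ * ‖g n‖) :
    Summable (gramMinor f g) :=
  Summable.of_norm_bounded (summable_prod_of_nonneg_summable (fun _ => by positivity) h)
    (norm_gramMinor_le f g)

theorem hasSum_fredholmSeries {f g : κ → E} (h : Summable fun n => ‖f n‖ * ‖g n‖) :
    HasSum (gramMinor f g) (fredholmSeries f g) :=
  (summable_gramMinor h).hasSum

/-- Dominated convergence for Fredholm series. -/
theorem tendsto_fredholmSeries {α : Type*} {l : Filter α} {F G : α → κ → E} {f g : κ → E}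
    {a : κ → ℝ} (h0 : ∀ n, 0 ≤ a n) (ha : Summable a) (hb : ∀ x n, ‖F x n‖ * ‖G x n‖ ≤ a n)
    (hF : ∀ n, Tendsto (fun x => F x n) l (𝓝 (f n)))
    (hG : ∀ n, Tendsto (fun x => G x n) l (𝓝 (g n))) :
    Tendsto (fun x => fredholmSeries (F x) (G x)) l (𝓝 (fredholmSeries f g)) := by
  classical
  refine tendsto_tsum_of_dominated_convergence (summable_prod_of_nonneg_summable h0 ha)
    (fun s => ?_) (Eventually.of_forall fun x s => (norm_gramMinor_le _ _ s).trans ?_)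
  · simp only [gramMinor]
    refine Tendsto.comp (Continuous.matrix_det continuous_id).continuousAt ?_
    refine tendsto_pi_nhds.2 fun i => tendsto_pi_nhds.2 fun j => ?_
    exact (hF i).inner (hG j)
  · exact Finset.prod_le_prod (fun _ _ => by positivity) fun i _ => hb x i

theorem hasSum_ite_card_eq_one {M : Type*} [AddCommMonoid M] [TopologicalSpace M]
    {φ : Finset κ → M} {c : M} (h : HasSum (fun n => φ {n}) c) :
    HasSum (fun s : Finset κ => if s.card = 1 then φ s else 0) c := by
  refine (Function.Injective.hasSum_iff (Finset.singleton_injective (α := κ)) fun s hs => ?_).1 ?_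
  · rw [if_neg]
    intro h1
    obtain ⟨n, rfl⟩ := Finset.card_eq_one.1 h1
    exact hs ⟨n, rfl⟩
  · simpa [Function.comp_def] using h

/-- The partial sum over the subsets of a finite `t` is exactly `∏ (1 + aᵢ)` over `t`, and `1 + aᵢ ≤
exp aᵢ`. -/
theorem tsum_prod_le_exp {a : κ → ℝ} (h0 : ∀ n, 0 ≤ a n) (ha : Summable a) :
    ∑' s : Finset κ, ∏ i ∈ s, a i ≤ Real.exp (∑' n, a n) := by
  have h := (summable_prod_of_nonneg_summable h0 ha).hasSum.comp tendsto_finset_powerset_atTop_atTop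
  refine le_of_tendsto h (Eventually.of_forall fun t => ?_)
  have : ∑ s ∈ t.powerset, ∏ i ∈ s, a i = ∏ i ∈ t, (1 + a i) := (Finset.prod_one_add t).symm
  simp only [Function.comp_def]
  rw [this]
  calc ∏ i ∈ t, (1 + a i) ≤ ∏ i ∈ t, Real.exp (a i) :=
        Finset.prod_le_prod (fun i _ => by have := h0 i; positivity) fun i _ => by
          rw [add_comm]; exact Real.add_one_le_exp _
    _ = Real.exp (∑ i ∈ t, a i) := (Real.exp_sum _ _).symm
    _ ≤ _ := Real.exp_le_exp.2 (ha.sum_le_tsum t fun i _ => h0 i)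

/-- `det (1 + T) = 1 + tr T + O(‖T‖₁²)`. -/
theorem norm_fredholmSeries_sub_le {f g : κ → E} {A : ℝ} (h : Summable fun n => ‖f n‖ * ‖g n‖)
    (hA : ∑' n, ‖f n‖ * ‖g n‖ ≤ A) (hA1 : A ≤ 1) :
    ‖fredholmSeries f g - 1 - ∑' n, inner ℂ (f n) (g n)‖ ≤ A ^ 2 := by
  classical
  set a : κ → ℝ := fun n => ‖f n‖ * ‖g n‖ with ha
  have h0 : ∀ n, 0 ≤ a n := fun n => by positivity
  have htr : Summable fun n => inner ℂ (f n) (g n) :=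
    Summable.of_norm_bounded h fun n => norm_inner_le_norm _ _
  have hone : ∀ {M : Type} [AddCommMonoid M] [TopologicalSpace M] (c : M),
      HasSum (fun s : Finset κ => if s = ∅ then c else 0) c := fun c => by
    simpa using hasSum_ite_eq (∅ : Finset κ) c
  -- Removing the empty set and the singletons leaves the minors of size at least two. The same
  -- truncation of the scalar series `∑ ∏ aᵢ` dominates them and is at most `exp a - 1 - a` with `a
  -- = ∑ aₙ`.
  have h1 : HasSum (fun s : Finset κ => gramMinor f g s - (if s = ∅ then 1 else 0) -
      (if s.card = 1 then gramMinor f g s else 0))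
      (fredholmSeries f g - 1 - ∑' n, inner ℂ (f n) (g n)) := by
    refine ((hasSum_fredholmSeries h).sub (hone 1)).sub (hasSum_ite_card_eq_one ?_)
    have hsing : ∀ n, gramMinor f g {n} = inner ℂ (f n) (g n) := fun n => by
      have hn : ((default : ({n} : Finset κ)) : κ) = n :=
        Finset.mem_singleton.1 (default : ({n} : Finset κ)).2
      simp only [gramMinor, Matrix.det_unique, Matrix.of_apply]
      rw [hn]
    simpa only [hsing] using htr.hasSum
  have h2 : HasSum (fun s : Finset κ => (∏ i ∈ s, a i) - (if s = ∅ then 1 else 0) -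
      (if s.card = 1 then ∏ i ∈ s, a i else 0))
      ((∑' s : Finset κ, ∏ i ∈ s, a i) - 1 - ∑' n, a n) := by
    refine ((summable_prod_of_nonneg_summable h0 h).hasSum.sub (hone 1)).sub
      (hasSum_ite_card_eq_one ?_)
    simpa using h.hasSum
  have h3 : ‖fredholmSeries f g - 1 - ∑' n, inner ℂ (f n) (g n)‖ ≤
      (∑' s : Finset κ, ∏ i ∈ s, a i) - 1 - ∑' n, a n := by
    refine h1.norm_le_of_bounded h2 fun s => ?_
    by_cases hs : s = ∅
    · subst hs
      simp [gramMinor]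
    · by_cases hs1 : s.card = 1
      · simp [hs, hs1]
      · simpa [hs, hs1] using norm_gramMinor_le f g s
  have hs0 : 0 ≤ ∑' n, a n := tsum_nonneg h0
  -- The bound `|exp a - 1 - a| ≤ a²` needs `|a| ≤ 1`; this is what `A ≤ 1` is for.
  have h4 := Real.abs_exp_sub_one_sub_id_le (x := ∑' n, a n)
    (by rw [abs_of_nonneg hs0]; exact hA.trans hA1)
  have h5 := tsum_prod_le_exp h0 h
  have h6 := le_abs_self (Real.exp (∑' n, a n) - 1 - ∑' n, a n)
  have h7 : (∑' n, a n) ^ 2 ≤ A ^ 2 := pow_le_pow_left₀ hs0 hA 2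
  linarith

end FredholmSeries

/-! ### Nuclear representations -/

section Nuclear

variable {E : Type*} [NormedAddCommGroup E] [InnerProductSpace ℂ E] {κ κ' ι : Type*}

/-- `T = ∑ₙ ⟨fₙ, ·⟩ gₙ` with `∑ₙ ‖fₙ‖ ‖gₙ‖ < ∞`. -/
structure IsNuclearRep (T : E →L[ℂ] E) (f g : κ → E) : Prop where
  summable : Summable fun n => ‖f n‖ * ‖g n‖
  hasSum : ∀ ξ, HasSum (fun n => inner ℂ (f n) ξ • g n) (T ξ)

namespace IsNuclearRep

variable {S T : E →L[ℂ] E} {f g : κ → E} {f' g' : κ' → E}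

theorem comp_left (h : IsNuclearRep T f g) (X : E →L[ℂ] E) :
    IsNuclearRep (X * T) f fun n => X (g n) where
  summable := Summable.of_nonneg_of_le (fun _ => by positivity) (fun n => by
      calc ‖f n‖ * ‖X (g n)‖ ≤ ‖f n‖ * (‖X‖ * ‖g n‖) := by gcongr; exact X.le_opNorm _
        _ = ‖X‖ * (‖f n‖ * ‖g n‖) := by ring) (h.summable.mul_left ‖X‖)
  hasSum ξ := by simpa using (h.hasSum ξ).mapL X

theorem comp_right [CompleteSpace E] (h : IsNuclearRep T f g) (X : E →L[ℂ] E) :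
    IsNuclearRep (T * X) (fun n => ContinuousLinearMap.adjoint X (f n)) g where
  summable := Summable.of_nonneg_of_le (fun _ => by positivity) (fun n => by
      calc ‖ContinuousLinearMap.adjoint X (f n)‖ * ‖g n‖ ≤ ‖X‖ * ‖f n‖ * ‖g n‖ := by
            gcongr
            rw [← LinearIsometryEquiv.norm_map ContinuousLinearMap.adjoint X]
            exact ContinuousLinearMap.le_opNorm _ _
        _ = ‖X‖ * (‖f n‖ * ‖g n‖) := by ring) (h.summable.mul_left ‖X‖)
  hasSum ξ := by
    simpa [ContinuousLinearMap.adjoint_inner_left] using h.hasSum (X ξ)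

theorem smul (h : IsNuclearRep T f g) (c : ℂ) : IsNuclearRep (c • T) f fun n => c • g n := by
  simpa using h.comp_left (c • 1)

theorem add (h : IsNuclearRep S f g) (h' : IsNuclearRep T f' g') :
    IsNuclearRep (S + T) (Sum.elim f f') (Sum.elim g g') where
  summable := by
    refine Summable.sum _ ?_ ?_
    · exact h.summable
    · exact h'.summable
  hasSum ξ := by
    refine HasSum.sum ?_ ?_
    · simpa [Function.comp_def] using h.hasSum ξ
    · simpa [Function.comp_def] using h'.hasSum ξ

/-- `IsTraceClass` asks for sequences. The terms with `‖fₙ‖ ‖gₙ‖ ≠ 0` are countably many; they are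
injected into `ℕ` and padded with zeros. -/
theorem isTraceClass (h : IsNuclearRep T f g) : IsTraceClass T := by
  classical
  set S := Function.support fun n => ‖f n‖ * ‖g n‖
  have hS : S.Countable := h.summable.countable_support
  have : Countable S := hS.to_subtype
  obtain ⟨e, he⟩ := exists_injective_nat S
  refine ⟨Function.extend e (fun n => f n) 0, Function.extend e (fun n => g n) 0, ?_, fun ξ => ?_⟩
  · have h1 : Summable fun n : S => ‖f n‖ * ‖g n‖ := h.summable.subtype S
    refine (Function.Injective.summable_iff he fun n hn => ?_).1 ?_
    · rw [Function.extend_apply' _ _ _ (by simpa using hn)]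
      simp
    · simpa [Function.comp_def, he.extend_apply] using h1
  · refine (Function.Injective.hasSum_iff he fun n hn => ?_).1 ?_
    · rw [Function.extend_apply' _ _ _ (by simpa using hn)]
      simp
    · simp only [Function.comp_def, he.extend_apply]
      refine (hasSum_subtype_iff_of_support_subset (s := S)
        (f := fun n => inner ℂ (f n) ξ • g n) fun n hn => ?_).2 (h.hasSum ξ)
      simp only [Function.mem_support, ne_eq, S, mul_eq_zero, norm_eq_zero, not_or] at hn ⊢
      exact ⟨fun h0 => hn (by simp [h0]), fun h0 => hn (by simp [h0])⟩

theorem norm_le (h : IsNuclearRep T f g) : ‖T‖ ≤ ∑' n, ‖f n‖ * ‖g n‖ := by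
  refine ContinuousLinearMap.opNorm_le_bound _ (tsum_nonneg fun _ => by positivity) fun ξ => ?_
  rw [← tsum_mul_right]
  refine (h.hasSum ξ).norm_le_of_bounded (h.summable.mul_right ‖ξ‖).hasSum fun n => ?_
  rw [norm_smul]
  calc ‖inner ℂ (f n) ξ‖ * ‖g n‖ ≤ ‖f n‖ * ‖ξ‖ * ‖g n‖ := by
        gcongr; exact norm_inner_le_norm _ _
    _ = _ := by ring

/-- The nuclear sum converges in operator norm, so `T` is a norm limit of operators of finite rank.
-/
theorem isCompactOperator [CompleteSpace E] (h : IsNuclearRep T f g) : IsCompactOperator T := by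
  have hfin : ∀ s : Finset κ, IsCompactOperator
      (∑ n ∈ s, (innerSL ℂ (f n)).smulRight (g n) : E →L[ℂ] E) := fun s => by
    classical
    induction s using Finset.induction_on with
    | empty => simpa using (isCompactOperator_zero : IsCompactOperator (0 : E → E))
    | insert a s ha ih =>
      rw [Finset.sum_insert ha]
      refine IsCompactOperator.add ?_ ih
      have h1 : IsCompactOperator ((innerSL ℂ (f a)) : E → ℂ) :=
        ((isCompactOperator_id_iff_finiteDimensional (𝕜 := ℂ) (E := ℂ)).2 inferInstance).comp_clm
          (innerSL ℂ (f a))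
      exact h1.clm_comp (ContinuousLinearMap.toSpanSingleton ℂ (g a))
  refine isCompactOperator_of_tendsto (l := atTop) ?_ (Eventually.of_forall hfin)
  have hnorm : ∀ n, ‖(innerSL ℂ (f n)).smulRight (g n)‖ ≤ ‖f n‖ * ‖g n‖ := fun n => by
    rw [ContinuousLinearMap.norm_smulRight_apply, innerSL_apply_norm]
  have hs : Summable fun n => (innerSL ℂ (f n)).smulRight (g n) :=
    Summable.of_norm_bounded h.summable hnorm
  have : T = ∑' n, (innerSL ℂ (f n)).smulRight (g n) := by
    ext ξ
    refine (h.hasSum ξ).unique ?_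
    simpa using hs.hasSum.mapL (ContinuousLinearMap.apply ℂ E ξ)
  rw [this]
  exact hs.hasSum

end IsNuclearRep

end Nuclear


/-! ### Finite sections and Fredholm determinants -/

section Sections

universe u

variable {E : Type u} [NormedAddCommGroup E] [InnerProductSpace ℂ E] {κ κ' ι : Type*}

/-- The orthogonal projection onto the span of finitely many basis vectors. -/
def sectionProj (b : HilbertBasis ι ℂ E) (s : Finset ι) : E →L[ℂ] E :=
  ∑ i ∈ s, (innerSL ℂ (b i)).smulRight (b i)

theorem sectionProj_apply (b : HilbertBasis ι ℂ E) (s : Finset ι) (ξ : E) :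
    sectionProj b s ξ = ∑ i ∈ s, inner ℂ (b i) ξ • b i := by
  simp [sectionProj]

theorem inner_sectionProj_right (b : HilbertBasis ι ℂ E) (s : Finset ι) (ξ η : E) :
    inner ℂ ξ (sectionProj b s η) = ∑ i ∈ s, inner ℂ ξ (b i) * inner ℂ (b i) η := by
  simp [sectionProj_apply, mul_comm]

theorem norm_sectionProj_apply_le (b : HilbertBasis ι ℂ E) (s : Finset ι) (ξ : E) :
    ‖sectionProj b s ξ‖ ≤ ‖ξ‖ := by
  refine le_of_sq_le_sq ?_ (norm_nonneg _)
  have h1 := b.orthonormal.sum_inner_products_le (s := s) ξ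
  rw [sectionProj_apply]
  have h2 := b.orthonormal.inner_sum (fun i => inner ℂ (b i) ξ) (fun i => inner ℂ (b i) ξ) s
  rw [inner_self_eq_norm_sq_to_K] at h2
  have h3 : ((‖∑ i ∈ s, inner ℂ (b i) ξ • b i‖ ^ 2 : ℝ) : ℂ) =
      ((∑ i ∈ s, ‖inner ℂ (b i) ξ‖ ^ 2 : ℝ) : ℂ) := by
    push_cast
    refine h2.trans (Finset.sum_congr rfl fun i _ => ?_)
    rw [Complex.conj_mul']
  rw [Complex.ofReal_injective h3]
  exact h1

theorem tendsto_sectionProj (b : HilbertBasis ι ℂ E) (ξ : E) :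
    Tendsto (fun s => sectionProj b s ξ) atTop (𝓝 ξ) := by
  have := b.hasSum_repr ξ
  simp only [b.repr_apply_apply] at this
  simpa only [sectionProj_apply, HasSum, SummationFilter.unconditional_filter] using this

/-- The matrix of the finite section of `T` in the basis `b`. -/
def sectionMatrix (b : HilbertBasis ι ℂ E) (s : Finset ι) (T : E →L[ℂ] E) : Matrix s s ℂ :=
  Matrix.of fun i j : s => inner ℂ (b i) (T (b j))

open Classical in
/-- The determinant of the finite section of `1 + T` in the basis `b`. -/
def sectionDet (b : HilbertBasis ι ℂ E) (s : Finset ι) (T : E →L[ℂ] E) : ℂ :=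
  (1 + sectionMatrix b s T).det

theorem sectionDet_eq (b : HilbertBasis ι ℂ E) (s : Finset ι) (T : E →L[ℂ] E) [DecidableEq s] :
    sectionDet b s T = (1 + sectionMatrix b s T).det := by
  rw [sectionDet]
  congr!

/-- This makes the partial sums of a Fredholm series genuine determinants of size `t`, to which
`det(1 + MN) = det(1 + NM)` can be applied. -/
theorem sum_gramMinor_powerset (f g : κ → E) (t : Finset κ) [DecidableEq t] :
    ∑ s ∈ t.powerset, gramMinor f g s =
      ((1 : Matrix t t ℂ) + Matrix.of fun i j : t => inner ℂ (f i) (g j)).det := by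
  classical
  rw [det_one_add_eq_sum_minors]
  symm
  refine Finset.sum_bij (fun s _ => s.map (Function.Embedding.subtype _)) ?_ ?_ ?_ ?_
  · intro s _
    rw [Finset.mem_powerset]
    exact Finset.map_subtype_subset s
  · intro s _ s' _ h
    exact Finset.map_injective _ h
  · intro s hs
    rw [Finset.mem_powerset] at hs
    exact ⟨s.subtype (· ∈ t), Finset.mem_univ _, Finset.subtype_map_of_mem hs⟩
  · intro s _
    rw [gramMinor]
    let e : s ≃ (s.map (Function.Embedding.subtype (· ∈ t)) : Finset κ) :=
      { toFun := fun i => ⟨i.1.1, Finset.mem_map_of_mem _ i.2⟩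
        invFun := fun j => ⟨⟨j.1, Finset.map_subtype_subset s j.2⟩, by
          obtain ⟨i, hi, hij⟩ := Finset.mem_map.1 j.2
          have : (⟨j.1, Finset.map_subtype_subset s j.2⟩ : t) = i := Subtype.ext hij.symm
          rwa [this]⟩
        left_inv := fun i => rfl
        right_inv := fun j => rfl }
    rw [← Matrix.det_submatrix_equiv_self e]
    rfl

/-- The finite sections of a nuclear operator as Fredholm series. -/
theorem sectionDet_eq_fredholmSeries {T : E →L[ℂ] E} {f g : κ → E} (h : IsNuclearRep T f g)
    (b : HilbertBasis ι ℂ E) (s : Finset ι) :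
    sectionDet b s T = fredholmSeries f fun n => sectionProj b s (g n) := by
  classical
  have hsum : Summable fun n => ‖f n‖ * ‖sectionProj b s (g n)‖ :=
    Summable.of_nonneg_of_le (fun _ => by positivity) (fun n => by
      gcongr; exact norm_sectionProj_apply_le b s _) h.summable
  have h1 := (hasSum_fredholmSeries hsum).comp tendsto_finset_powerset_atTop_atTop
  -- The nuclear sum is truncated to a finite `t`. The `s × s` section then factors through `t`, and
  -- exchanging the two factors gives the `t × t` determinant, a partial sum of the series.
  have h2 : Tendsto (fun t : Finset κ => (1 + (Matrix.of fun i j : s =>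
      ∑ n ∈ t, inner ℂ (b i) (g n) * inner ℂ (f n) (b j))).det) atTop (𝓝 (sectionDet b s T)) := by
    refine (Continuous.matrix_det continuous_id).continuousAt.tendsto.comp ?_
    refine tendsto_const_nhds.add ?_
    refine tendsto_pi_nhds.2 fun i => tendsto_pi_nhds.2 fun j => ?_
    have := (h.hasSum (b j)).mapL (innerSL ℂ (b i))
    simpa [HasSum, inner_smul_right, mul_comm, sectionMatrix] using this
  refine tendsto_nhds_unique (h2.congr fun t => ?_) h1
  simp only [Function.comp_def]
  rw [sum_gramMinor_powerset]
  have e1 : (Matrix.of fun i j : s => ∑ n ∈ t, inner ℂ (b i) (g n) * inner ℂ (f n) (b j)) =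
      (Matrix.of fun (i : s) (n : t) => inner ℂ (b i) (g n)) *
        (Matrix.of fun (n : t) (j : s) => inner ℂ (f n) (b j)) := by
    ext i j
    simp only [Matrix.of_apply, Matrix.mul_apply]
    exact (Finset.sum_coe_sort t fun n => inner ℂ (b i) (g n) * inner ℂ (f n) (b j)).symm
  have e2 : (Matrix.of fun m n : t => inner ℂ (f m) (sectionProj b s (g n))) =
      (Matrix.of fun (n : t) (j : s) => inner ℂ (f n) (b j)) *
        (Matrix.of fun (i : s) (n : t) => inner ℂ (b i) (g n)) := by
    ext m n
    simp only [Matrix.of_apply, Matrix.mul_apply, inner_sectionProj_right]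
    exact (Finset.sum_coe_sort s fun i => inner ℂ (f m) (b i) * inner ℂ (b i) (g n)).symm
  rw [e1, e2, Matrix.det_one_add_mul_comm]

/-- Projections are contractions, so dominated convergence applies with the bound `‖fₙ‖ ‖gₙ‖`. The
limit mentions no basis, which is why the determinant does not depend on one. -/
theorem IsNuclearRep.tendsto_sectionDet {T : E →L[ℂ] E} {f g : κ → E} (h : IsNuclearRep T f g)
    (b : HilbertBasis ι ℂ E) :
    Tendsto (fun s => sectionDet b s T) atTop (𝓝 (fredholmSeries f g)) := by
  simp only [sectionDet_eq_fredholmSeries h]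
  exact tendsto_fredholmSeries (fun _ => by positivity) h.summable
    (fun s n => by gcongr; exact norm_sectionProj_apply_le b s _)
    (fun n => tendsto_const_nhds) fun n => tendsto_sectionProj b _

theorem IsNuclearRep.hasFredholmDet {T : E →L[ℂ] E} {f g : κ → E} (h : IsNuclearRep T f g) :
    HasFredholmDet T (fredholmSeries f g) :=
  fun _ b => h.tendsto_sectionDet b

variable [CompleteSpace E]

theorem HasFredholmDet.unique {T : E →L[ℂ] E} {d d' : ℂ} (h : HasFredholmDet T d)
    (h' : HasFredholmDet T d') : d = d' := by
  obtain ⟨w, b, -⟩ := exists_hilbertBasis ℂ E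
  exact tendsto_nhds_unique (h w b) (h' w b)

theorem HasFredholmDet.fredholmDet_eq {T : E →L[ℂ] E} {d : ℂ} (h : HasFredholmDet T d) :
    fredholmDet T = d :=
  (Classical.epsilon_spec (p := HasFredholmDet T) ⟨d, h⟩).unique h

theorem IsNuclearRep.fredholmDet_eq {T : E →L[ℂ] E} {f g : κ → E} (h : IsNuclearRep T f g) :
    fredholmDet T = fredholmSeries f g :=
  h.hasFredholmDet.fredholmDet_eq

theorem IsNuclearRep.hasFredholmDet_fredholmDet {T : E →L[ℂ] E} {f g : κ → E}
    (h : IsNuclearRep T f g) : HasFredholmDet T (fredholmDet T) := by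
  rw [h.fredholmDet_eq]
  exact h.hasFredholmDet

/-- Multiplicativity of the Fredholm determinant. -/
theorem IsNuclearRep.fredholmDet_mul {A B : E →L[ℂ] E} {f g : κ → E} {f' g' : κ' → E}
    (hA : IsNuclearRep A f g) (hB : IsNuclearRep B f' g') :
    fredholmDet (A + B + A * B) = fredholmDet A * fredholmDet B := by
  classical
  obtain ⟨w, b, -⟩ := exists_hilbertBasis ℂ E
  -- With the projection inserted between `A` and `B`, the finite section of the product is the
  -- product of the finite sections, so multiplicativity is exact for each `s`. The Fredholm series
  -- then allows removing the projection in the limit.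
  have hC : ∀ s, IsNuclearRep (A + B + A * (sectionProj b s * B))
      (Sum.elim (Sum.elim f f') fun n => ContinuousLinearMap.adjoint (sectionProj b s * B) (f n))
      (Sum.elim (Sum.elim g g') g) := fun s => (hA.add hB).add (hA.comp_right _)
  have hD : IsNuclearRep (A + B + A * B)
      (Sum.elim (Sum.elim f f') fun n => ContinuousLinearMap.adjoint B (f n))
      (Sum.elim (Sum.elim g g') g) := (hA.add hB).add (hA.comp_right _)
  have hadj : ∀ s (ξ : E), ContinuousLinearMap.adjoint (sectionProj b s * B) ξ =
      ContinuousLinearMap.adjoint B (sectionProj b s ξ) := fun s ξ => by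
    refine ext_inner_right ℂ fun η => ?_
    rw [ContinuousLinearMap.adjoint_inner_left, ContinuousLinearMap.adjoint_inner_left,
      mul_apply_eq_comp, inner_sectionProj_right, ← inner_conj_symm,
      inner_sectionProj_right, map_sum]
    simp [mul_comm]
  have hdet : ∀ s, sectionDet b s (A + B + A * (sectionProj b s * B)) =
      sectionDet b s A * sectionDet b s B := fun s => by
    rw [sectionDet_eq, sectionDet_eq, sectionDet_eq, ← Matrix.det_mul]
    congr 1
    have h1 : sectionMatrix b s (A + B + A * (sectionProj b s * B)) =
        sectionMatrix b s A + sectionMatrix b s B + sectionMatrix b s A * sectionMatrix b s B := by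
      ext i j
      simp only [sectionMatrix, Matrix.of_apply, Matrix.add_apply, Matrix.mul_apply,
        add_apply, mul_apply_eq_comp, sectionProj_apply, map_sum,
        map_smul, inner_add_right, inner_sum, inner_smul_right]
      congr 1
      rw [← Finset.sum_coe_sort s]
      exact Finset.sum_congr rfl fun k _ => mul_comm _ _
    rw [h1]
    simp only [add_mul, mul_add, one_mul, mul_one]
    abel
  have hlim : Tendsto (fun s => sectionDet b s (A + B + A * (sectionProj b s * B))) atTop
      (𝓝 (fredholmDet (A + B + A * B))) := by
    rw [hD.fredholmDet_eq]
    simp only [fun s => sectionDet_eq_fredholmSeries (hC s) b s]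
    refine tendsto_fredholmSeries
      (a := Sum.elim (Sum.elim (fun n => ‖f n‖ * ‖g n‖) fun n => ‖f' n‖ * ‖g' n‖)
        fun n => ‖B‖ * (‖f n‖ * ‖g n‖)) ?_ ?_ ?_ ?_ ?_
    · rintro ((n | n) | n) <;> simp only [Sum.elim_inl, Sum.elim_inr] <;> positivity
    · exact Summable.sum _ (Summable.sum _ hA.summable hB.summable) (hA.summable.mul_left _)
    · have hP := fun s ξ => norm_sectionProj_apply_le b s ξ
      rintro s ((n | n) | n) <;> simp only [Sum.elim_inl, Sum.elim_inr]
      · gcongr; exact hP s _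
      · gcongr; exact hP s _
      · rw [hadj, ← mul_assoc]
        gcongr
        · refine (ContinuousLinearMap.le_opNorm _ _).trans ?_
          rw [LinearIsometryEquiv.norm_map]
          gcongr; exact hP s _
        · exact hP s _
    · rintro ((n | n) | n) <;> simp only [Sum.elim_inl, Sum.elim_inr]
      · exact tendsto_const_nhds
      · exact tendsto_const_nhds
      · simp only [hadj]
        exact ((ContinuousLinearMap.adjoint B).continuous.tendsto _).comp (tendsto_sectionProj b _)
    · exact fun n => tendsto_sectionProj b _
  simp only [hdet] at hlim
  refine tendsto_nhds_unique hlim ?_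
  exact (hA.hasFredholmDet_fredholmDet w b).mul (hB.hasFredholmDet_fredholmDet w b)

/-- If the Fredholm determinant of `1 + T` does not vanish, then `1 + T` is invertible. -/
theorem IsNuclearRep.isUnit_of_fredholmDet_ne_zero {T : E →L[ℂ] E} {f g : κ → E}
    (h : IsNuclearRep T f g) (h0 : fredholmDet T ≠ 0) : IsUnit (1 + T) := by
  classical
  -- A unit eigenvector for `-1` is made a member of an orthonormal basis. Every large enough
  -- section of `1 + T` then has a zero column, so the determinant would vanish.
  have hinj : ∀ v, T v = -v → v = 0 := fun v hv => by
    by_contra hv0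
    apply h0
    set e : E := ((‖v‖⁻¹ : ℝ) : ℂ) • v with he
    have hTe : T e = -e := by rw [he, map_smul, hv, smul_neg]
    have hne : ‖e‖ = 1 := by
      rw [he, norm_smul, Complex.norm_real, norm_inv, norm_norm,
        inv_mul_cancel₀ (norm_ne_zero_iff.2 hv0)]
    have hon : Orthonormal ℂ ((↑) : ({e} : Set E) → E) := by
      refine ⟨fun x => ?_, fun x y hxy => absurd (Subsingleton.elim x y) hxy⟩
      rw [Set.mem_singleton_iff.1 x.2, hne]
    obtain ⟨w, b, hw, hb⟩ := hon.exists_hilbertBasis_extension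
    have hew : e ∈ w := hw rfl
    refine tendsto_nhds_unique (h.hasFredholmDet_fredholmDet w b) ?_
    refine tendsto_const_nhds.congr' ?_
    filter_upwards [eventually_ge_atTop ({⟨e, hew⟩} : Finset w)] with s hs
    have hes : (⟨e, hew⟩ : w) ∈ s := hs (Finset.mem_singleton_self _)
    change 0 = sectionDet b s T
    rw [sectionDet_eq]
    symm
    refine Matrix.det_eq_zero_of_column_eq_zero ⟨_, hes⟩ fun i => ?_
    have hbe : b ⟨e, hew⟩ = e := by rw [hb]
    simp only [sectionMatrix, Matrix.add_apply, Matrix.of_apply]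
    rw [hbe, hTe, inner_neg_right]
    have := orthonormal_iff_ite.1 b.orthonormal i ⟨e, hew⟩
    rw [hbe] at this
    rw [this, Matrix.one_apply]
    simp [Subtype.ext_iff]
  have hne : ¬ Module.End.HasEigenvalue (T : Module.End ℂ E) (-1) := fun hev => by
    obtain ⟨v, hv⟩ := hev.exists_hasEigenvector
    exact hv.2 (hinj v (by simpa using hv.apply_eq_smul))
  -- Fredholm alternative: for a compact operator, `-1` is an eigenvalue or a point of the resolvent
  -- set.
  have hres := (h.isCompactOperator.hasEigenvalue_or_mem_resolventSet
    (neg_ne_zero.2 one_ne_zero)).resolve_left hne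
  have := (spectrum.mem_resolventSet_iff.1 hres).neg
  rw [map_neg, map_one] at this
  convert this using 1
  abel

end Sections


/-! ### Hilbert-Schmidt operators -/

section HilbertSchmidt

universe u v

theorem summable_mul_of_summable_sq {κ : Type*} {a b : κ → ℝ} (ha : Summable fun n => a n ^ 2)
    (hb : Summable fun n => b n ^ 2) (h0 : ∀ n, 0 ≤ a n) (h0' : ∀ n, 0 ≤ b n) :
    Summable fun n => a n * b n :=
  Summable.of_nonneg_of_le (fun n => mul_nonneg (h0 n) (h0' n))
    (fun n => by nlinarith [sq_nonneg (a n - b n), sq_nonneg (a n), sq_nonneg (b n)]) (ha.add hb)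

theorem tsum_mul_le_of_tsum_sq_le {κ : Type*} {a b : κ → ℝ} {A B : ℝ}
    (ha : Summable fun n => a n ^ 2) (hb : Summable fun n => b n ^ 2) (h0 : ∀ n, 0 ≤ a n)
    (h0' : ∀ n, 0 ≤ b n) (hA0 : 0 ≤ A) (hB0 : 0 ≤ B) (hA : ∑' n, a n ^ 2 ≤ A ^ 2)
    (hB : ∑' n, b n ^ 2 ≤ B ^ 2) : ∑' n, a n * b n ≤ A * B := by
  refine (summable_mul_of_summable_sq ha hb h0 h0').tsum_le_of_sum_le fun s => ?_
  refine le_of_sq_le_sq ?_ (mul_nonneg hA0 hB0)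
  calc (∑ n ∈ s, a n * b n) ^ 2 ≤ (∑ n ∈ s, a n ^ 2) * ∑ n ∈ s, b n ^ 2 :=
        Finset.sum_mul_sq_le_sq_mul_sq s a b
    _ ≤ A ^ 2 * B ^ 2 := by
        gcongr
        · exact (ha.sum_le_tsum s fun _ _ => sq_nonneg _).trans hA
        · exact (hb.sum_le_tsum s fun _ _ => sq_nonneg _).trans hB
    _ = (A * B) ^ 2 := by ring

variable {E : Type u} [NormedAddCommGroup E] [InnerProductSpace ℂ E]
variable {F : Type v} [NormedAddCommGroup F] [InnerProductSpace ℂ F] {ι κ : Type*}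

theorem hasSum_norm_inner_sq (b : HilbertBasis ι ℂ E) (ξ : E) :
    HasSum (fun i => ‖inner ℂ (b i) ξ‖ ^ 2) (‖ξ‖ ^ 2) := by
  have h := b.hasSum_inner_mul_inner ξ ξ
  rw [inner_self_eq_norm_sq_to_K] at h
  have h2 := Complex.hasSum_re h
  simp only [← inner_conj_symm ξ (b _), Complex.conj_mul'] at h2
  exact_mod_cast h2

variable [CompleteSpace E] [CompleteSpace F]

/-- Both sums are the double sum of `|⟨hⱼ, T bᵢ⟩|²`, by Parseval in either order. Going to the
adjoint and back also frees the Hilbert-Schmidt condition from its basis. -/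
theorem summable_norm_adjoint_sq (T : E →L[ℂ] F) (b : HilbertBasis ι ℂ E)
    (h : HilbertBasis κ ℂ F) (hs : Summable fun i => ‖T (b i)‖ ^ 2) :
    Summable fun j => ‖ContinuousLinearMap.adjoint T (h j)‖ ^ 2 := by
  have h1 : Summable fun p : ι × κ => ‖inner ℂ (h p.2) (T (b p.1))‖ ^ 2 := by
    refine (summable_prod_of_nonneg fun _ => by positivity).2
      ⟨fun i => (hasSum_norm_inner_sq h (T (b i))).summable, ?_⟩
    simpa only [(hasSum_norm_inner_sq h (T (b _))).tsum_eq] using hs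
  have h2 := ((summable_prod_of_nonneg (fun _ => by positivity)).1 h1.prod_symm).2
  refine h2.congr fun j => ?_
  rw [← (hasSum_norm_inner_sq b (ContinuousLinearMap.adjoint T (h j))).tsum_eq]
  refine tsum_congr fun i => ?_
  simp only [Prod.swap]
  rw [ContinuousLinearMap.adjoint_inner_right, norm_inner_symm]

theorem tsum_norm_adjoint_sq (T : E →L[ℂ] F) (b : HilbertBasis ι ℂ E)
    (h : HilbertBasis κ ℂ F) (hs : Summable fun i => ‖T (b i)‖ ^ 2) :
    ∑' j, ‖ContinuousLinearMap.adjoint T (h j)‖ ^ 2 = ∑' i, ‖T (b i)‖ ^ 2 := by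
  have h1 : Summable fun p : ι × κ => ‖inner ℂ (h p.2) (T (b p.1))‖ ^ 2 := by
    refine (summable_prod_of_nonneg fun _ => by positivity).2
      ⟨fun i => (hasSum_norm_inner_sq h (T (b i))).summable, ?_⟩
    simpa only [(hasSum_norm_inner_sq h (T (b _))).tsum_eq] using hs
  calc ∑' j, ‖ContinuousLinearMap.adjoint T (h j)‖ ^ 2
      = ∑' j, ∑' i, ‖inner ℂ (h j) (T (b i))‖ ^ 2 := tsum_congr fun j => by
        rw [← (hasSum_norm_inner_sq b (ContinuousLinearMap.adjoint T (h j))).tsum_eq]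
        refine tsum_congr fun i => ?_
        rw [ContinuousLinearMap.adjoint_inner_right, norm_inner_symm]
    _ = ∑' i, ∑' j, ‖inner ℂ (h j) (T (b i))‖ ^ 2 :=
        Summable.tsum_comm (f := fun i j => ‖inner ℂ (h j) (T (b i))‖ ^ 2) h1
    _ = ∑' i, ‖T (b i)‖ ^ 2 := tsum_congr fun i => (hasSum_norm_inner_sq h (T (b i))).tsum_eq

theorem IsHilbertSchmidt.summable_adjoint {T : E →L[ℂ] F} (hT : IsHilbertSchmidt T)
    (h : HilbertBasis κ ℂ F) : Summable fun j => ‖ContinuousLinearMap.adjoint T (h j)‖ ^ 2 := by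
  obtain ⟨ι, b, hb⟩ := hT
  exact summable_norm_adjoint_sq T b h hb

theorem IsHilbertSchmidt.summable {T : E →L[ℂ] F} (hT : IsHilbertSchmidt T)
    (b : HilbertBasis ι ℂ E) : Summable fun i => ‖T (b i)‖ ^ 2 := by
  obtain ⟨w, h, -⟩ := exists_hilbertBasis ℂ F
  simpa using summable_norm_adjoint_sq (ContinuousLinearMap.adjoint T) h b (hT.summable_adjoint h)

theorem IsHilbertSchmidt.comp_right {T : E →L[ℂ] F} (hT : IsHilbertSchmidt T) (X : E →L[ℂ] E) :
    IsHilbertSchmidt (T ∘L X) := by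
  obtain ⟨w, b, -⟩ := exists_hilbertBasis ℂ E
  obtain ⟨w', h, -⟩ := exists_hilbertBasis ℂ F
  refine ⟨w, b, ?_⟩
  have h1 : Summable fun j => ‖ContinuousLinearMap.adjoint (T ∘L X) (h j)‖ ^ 2 := by
    refine Summable.of_nonneg_of_le (fun _ => by positivity) (fun j => ?_)
      ((hT.summable_adjoint h).mul_left (‖X‖ ^ 2))
    rw [ContinuousLinearMap.adjoint_comp, ContinuousLinearMap.comp_apply, ← mul_pow]
    gcongr
    refine (ContinuousLinearMap.le_opNorm _ _).trans ?_
    rw [LinearIsometryEquiv.norm_map]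
  simpa using summable_norm_adjoint_sq (ContinuousLinearMap.adjoint (T ∘L X)) h b h1

/-- The product of two Hilbert-Schmidt operators is nuclear. -/
theorem isNuclearRep_comp_adjoint {X Y : E →L[ℂ] F} (e : HilbertBasis ι ℂ E)
    (hX : Summable fun i => ‖X (e i)‖ ^ 2) (hY : Summable fun i => ‖Y (e i)‖ ^ 2) :
    IsNuclearRep (X ∘L ContinuousLinearMap.adjoint Y) (fun i => Y (e i)) fun i => X (e i) where
  summable := summable_mul_of_summable_sq hY hX (fun _ => norm_nonneg _) fun _ => norm_nonneg _
  hasSum ξ := by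
    have := (e.hasSum_repr (ContinuousLinearMap.adjoint Y ξ)).mapL X
    simpa [e.repr_apply_apply, ContinuousLinearMap.adjoint_inner_right] using this

theorem isNuclearRep_adjoint_comp {X Y : E →L[ℂ] F} (h : HilbertBasis κ ℂ F)
    (hX : IsHilbertSchmidt X) (hY : IsHilbertSchmidt Y) :
    IsNuclearRep (ContinuousLinearMap.adjoint Y ∘L X)
      (fun i => ContinuousLinearMap.adjoint X (h i))
      fun i => ContinuousLinearMap.adjoint Y (h i) := by
  simpa using isNuclearRep_comp_adjoint h (hY.summable_adjoint h) (hX.summable_adjoint h)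

/-- Partial sums of this series over the subsets of `s` are the finite sections of `Y† X` in the
basis `e`. The series is also the Fredholm series of `X Y†`, which gives `det(1 + X Y†) = det(1 + Y†
X)`. -/
theorem fredholmSeries_eq_fredholmDet_adjoint_comp {X Y : E →L[ℂ] F} (e : HilbertBasis ι ℂ E)
    (hX : IsHilbertSchmidt X) (hY : IsHilbertSchmidt Y) :
    fredholmSeries (fun i => Y (e i)) (fun i => X (e i)) =
      fredholmDet (ContinuousLinearMap.adjoint Y ∘L X) := by
  classical
  obtain ⟨w, h, -⟩ := exists_hilbertBasis ℂ F
  obtain ⟨w', e', -⟩ := exists_hilbertBasis ℂ E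
  have h1 := (hasSum_fredholmSeries (isNuclearRep_comp_adjoint e (hX.summable e)
    (hY.summable e)).summable).comp tendsto_finset_powerset_atTop_atTop
  refine tendsto_nhds_unique h1 ?_
  have hN := isNuclearRep_adjoint_comp h hX hY
  rw [hN.fredholmDet_eq]
  refine (hN.tendsto_sectionDet e).congr fun s => ?_
  simp only [Function.comp_def]
  rw [sum_gramMinor_powerset, sectionDet_eq]
  congr 2
  ext i j
  simp [sectionMatrix, ContinuousLinearMap.adjoint_inner_right]

theorem fredholmDet_comp_adjoint_comm {X Y : E →L[ℂ] F} (hX : IsHilbertSchmidt X)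
    (hY : IsHilbertSchmidt Y) :
    fredholmDet (X ∘L ContinuousLinearMap.adjoint Y) =
      fredholmDet (ContinuousLinearMap.adjoint Y ∘L X) := by
  obtain ⟨w, e, -⟩ := exists_hilbertBasis ℂ E
  rw [(isNuclearRep_comp_adjoint e (hX.summable e) (hY.summable e)).fredholmDet_eq,
    fredholmSeries_eq_fredholmDet_adjoint_comp e hX hY]

end HilbertSchmidt


/-! ### Shifts on the half-line -/

section HalfLine

local notation "ν" => (volume.restrict (Ioi (0 : ℝ)) : Measure ℝ)

/-- Restriction of functions on the line to the half-line. -/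
def restrictL2 : Lp ℂ 2 (volume : Measure ℝ) →L[ℂ] L2 ℂ :=
  LpToLpRestrictCLM ℝ ℂ ℂ volume 2 (Ioi 0)

theorem restrictL2_ae (f : Lp ℂ 2 (volume : Measure ℝ)) : restrictL2 f =ᵐ[ν] f :=
  LpToLpRestrictCLM_coeFn ℂ (Ioi 0) f

/-- Extension by zero of functions on the half-line to the line. -/
def extendL2 : L2 ℂ →L[ℂ] Lp ℂ 2 (volume : Measure ℝ) := ContinuousLinearMap.adjoint restrictL2

theorem extendL2_ae (f : L2 ℂ) : extendL2 f =ᵐ[volume] (Ioi (0 : ℝ)).indicator f := by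
  have hm : MemLp ((Ioi (0 : ℝ)).indicator f) 2 volume :=
    (memLp_indicator_iff_restrict measurableSet_Ioi).2 (Lp.memLp f)
  have : extendL2 f = hm.toLp _ := by
    refine ext_inner_right ℂ fun G => ?_
    rw [extendL2, ContinuousLinearMap.adjoint_inner_left, L2.inner_def, L2.inner_def]
    have h1 : ∫ a, inner ℂ (f a) (restrictL2 G a) ∂ν = ∫ a in Ioi 0, inner ℂ (f a) (G a) := by
      refine integral_congr_ae ?_
      filter_upwards [restrictL2_ae G] with a ha
      rw [ha]
    have h2 : ∫ a, inner ℂ (hm.toLp _ a) (G a) =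
        ∫ a, (Ioi (0 : ℝ)).indicator (fun a => inner ℂ (f a) (G a)) a := by
      refine integral_congr_ae ?_
      filter_upwards [hm.coeFn_toLp] with a ha
      rw [ha]
      by_cases h : a ∈ Ioi (0 : ℝ) <;> simp [h, -mem_Ioi]
    rw [h1, h2, integral_indicator measurableSet_Ioi]
  rw [this]
  exact hm.coeFn_toLp

/-- Translation of functions on the line. -/
def translate (t : ℝ) : Lp ℂ 2 (volume : Measure ℝ) →ₗᵢ[ℂ] Lp ℂ 2 (volume : Measure ℝ) :=
  Lp.compMeasurePreservingₗᵢ ℂ (fun s => s + t) (measurePreserving_add_right volume t)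

theorem translate_ae (t : ℝ) (f : Lp ℂ 2 (volume : Measure ℝ)) :
    translate t f =ᵐ[volume] fun s => f (s + t) :=
  Lp.coeFn_compMeasurePreserving f (measurePreserving_add_right volume t)

theorem translate_translate_neg (t : ℝ) (f : Lp ℂ 2 (volume : Measure ℝ)) :
    translate t (translate (-t) f) = f := by
  refine Lp.ext ?_
  have h := (measurePreserving_add_right volume t).quasiMeasurePreserving.ae (translate_ae (-t) f)
  filter_upwards [translate_ae t (translate (-t) f), h] with s h1 h2
  rw [h1, h2]
  simp

theorem continuous_translate (f : Lp ℂ 2 (volume : Measure ℝ)) :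
    Continuous fun t => translate t f := by
  let g : C(ℝ, C(ℝ, ℝ)) := (ContinuousMap.mk (fun p : ℝ × ℝ => p.2 + p.1) (by fun_prop)).curry
  exact continuous_const.compMeasurePreservingLp g.continuous
    (fun t => measurePreserving_add_right volume t) (by simp)

/-- The left shift `f ↦ f (· + t)` on the half-line. -/
def leftShift (t : ℝ) : L2 ℂ →L[ℂ] L2 ℂ :=
  restrictL2 ∘L (translate t).toContinuousLinearMap ∘L extendL2

theorem continuous_leftShift (f : L2 ℂ) : Continuous fun t => leftShift t f :=
  restrictL2.continuous.comp (continuous_translate _)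

/-- `leftShift t` is translation on the line between extension by zero and restriction, for `t` of
either sign; so the right shift is the same construction at `-t`, and the adjoint of the left one.
-/
theorem adjoint_leftShift (t : ℝ) :
    ContinuousLinearMap.adjoint (leftShift t) = leftShift (-t) := by
  refine ContinuousLinearMap.ext fun f => ext_inner_right ℂ fun g => ?_
  have h1 : ∀ (f : L2 ℂ) (G : Lp ℂ 2 (volume : Measure ℝ)),
      inner ℂ f (restrictL2 G) = inner ℂ (extendL2 f) G := fun f G => by
    rw [extendL2, ContinuousLinearMap.adjoint_inner_left]
  have h2 : ∀ (g : L2 ℂ) (G : Lp ℂ 2 (volume : Measure ℝ)),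
      inner ℂ (restrictL2 G) g = inner ℂ G (extendL2 g) := fun f G => by
    rw [extendL2, ContinuousLinearMap.adjoint_inner_right]
  rw [ContinuousLinearMap.adjoint_inner_left]
  simp only [leftShift, ContinuousLinearMap.comp_apply, h1, h2,
    LinearIsometry.coe_toContinuousLinearMap]
  rw [← (translate t).inner_map_map (translate (-t) _), translate_translate_neg]

theorem norm_leftShift_apply_le (t : ℝ) (f : L2 ℂ) : ‖leftShift t f‖ ≤ ‖f‖ := by
  have h1 : ∀ G, ‖restrictL2 G‖ ≤ ‖G‖ := fun G => norm_Lp_toLp_restrict_le (Ioi 0) G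
  have h2 : ‖restrictL2‖ ≤ 1 := ContinuousLinearMap.opNorm_le_bound _ zero_le_one
    fun G => by simpa using h1 G
  have h3 : ‖extendL2 f‖ ≤ ‖f‖ := by
    have := (ContinuousLinearMap.adjoint restrictL2).le_opNorm f
    rw [LinearIsometryEquiv.norm_map] at this
    exact this.trans (mul_le_of_le_one_left (norm_nonneg _) h2)
  exact (h1 _).trans (((translate t).norm_map _).trans_le h3)

theorem leftShift_ae_indicator (t : ℝ) (f : L2 ℂ) :
    leftShift t f =ᵐ[ν] fun s => (Ioi (0 : ℝ)).indicator f (s + t) := by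
  have h1 := ae_restrict_of_ae (s := Ioi 0)
    ((measurePreserving_add_right volume t).quasiMeasurePreserving.ae (extendL2_ae f))
  have h2 := ae_restrict_of_ae (s := Ioi 0) (translate_ae t (extendL2 f))
  filter_upwards [h1, h2, restrictL2_ae (translate t (extendL2 f))] with s h1 h2 h3
  rw [← h1, ← h2]
  exact h3

theorem leftShift_ae {t : ℝ} (ht : 0 ≤ t) (f : L2 ℂ) :
    leftShift t f =ᵐ[ν] fun s => f (s + t) := by
  filter_upwards [leftShift_ae_indicator t f, ae_restrict_mem measurableSet_Ioi] with s h hs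
  rw [h, indicator_of_mem]
  exact add_pos_of_pos_of_nonneg hs ht

theorem leftShift_neg_ae {t : ℝ} (f : L2 ℂ) :
    leftShift (-t) f =ᵐ[ν] fun s => (Ioi t).indicator (fun r => f (r - t)) s := by
  filter_upwards [leftShift_ae_indicator (-t) f] with s h
  rw [h]
  by_cases hst : t < s
  · rw [indicator_of_mem (by simpa using hst), indicator_of_mem (by simpa using hst)]; rfl
  · rw [indicator_of_notMem (by simpa using hst), indicator_of_notMem (by simpa using hst)]

/-- Multiplication by the indicator function of `(x, ∞)`. -/
def cutoff (x : ℝ) : L2 ℂ →L[ℂ] L2 ℂ :=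
  ContinuousLinearMap.adjoint (leftShift x) ∘L leftShift x

theorem cutoff_ae {x : ℝ} (hx : 0 ≤ x) (f : L2 ℂ) : cutoff x f =ᵐ[ν] (Ioi x).indicator f := by
  have h0 : cutoff x f = leftShift (-x) (leftShift x f) := by
    rw [cutoff, adjoint_leftShift]; rfl
  have h1 : ∀ᵐ s ∂(volume : Measure ℝ), s - x ∈ Ioi (0 : ℝ) → leftShift x f (s - x) = f s := by
    have h2 := (ae_restrict_iff' measurableSet_Ioi).1 (leftShift_ae hx f)
    have h3 := (measurePreserving_sub_right volume x).quasiMeasurePreserving.ae h2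
    filter_upwards [h3] with s hs hs0
    rw [hs hs0, sub_add_cancel]
  rw [h0]
  filter_upwards [leftShift_neg_ae (t := x) (leftShift x f), ae_restrict_of_ae h1] with s hs h1
  rw [hs]
  by_cases hxs : x < s
  · rw [indicator_of_mem (by simpa using hxs), indicator_of_mem (by simpa using hxs),
      h1 (by simpa using hxs)]
  · rw [indicator_of_notMem (by simpa using hxs), indicator_of_notMem (by simpa using hxs)]

theorem adjoint_cutoff (x : ℝ) : ContinuousLinearMap.adjoint (cutoff x) = cutoff x := by
  rw [cutoff, ContinuousLinearMap.adjoint_comp, ContinuousLinearMap.adjoint_adjoint]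

/-- For `t ≥ 0`, `‖leftShift t f‖² = ⟨f, cutoff t f⟩` is the integral of `|f|²` over `(t, ∞)`, which
tends to zero by dominated convergence. -/
theorem tendsto_leftShift_atTop (f : L2 ℂ) : Tendsto (fun t => leftShift t f) atTop (𝓝 0) := by
  have h1 : ∀ᶠ t in atTop, (∫ s, ‖(Ioi t).indicator f s‖ ^ 2 ∂ν) = ‖leftShift t f‖ ^ 2 := by
    filter_upwards [eventually_ge_atTop 0] with t ht
    have h2 : (inner ℂ f (cutoff t f) : ℂ) = ((‖leftShift t f‖ ^ 2 : ℝ) : ℂ) := by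
      rw [cutoff, ContinuousLinearMap.comp_apply, ContinuousLinearMap.adjoint_inner_right,
        inner_self_eq_norm_sq_to_K]
      norm_cast
    have h3 : (inner ℂ f (cutoff t f) : ℂ) =
        ((∫ s, ‖(Ioi t).indicator f s‖ ^ 2 ∂ν : ℝ) : ℂ) := by
      rw [L2.inner_def, ← integral_complex_ofReal]
      refine integral_congr_ae ?_
      filter_upwards [cutoff_ae ht f] with s hs
      rw [hs]
      by_cases hts : s ∈ Ioi t
      · simp only [indicator_of_mem hts]
        rw [inner_self_eq_norm_sq_to_K]
        norm_cast
      · simp only [indicator_of_notMem hts]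
        simp
    exact Complex.ofReal_injective (h3.symm.trans h2)
  have h2 : Tendsto (fun t => ∫ s, ‖(Ioi t).indicator f s‖ ^ 2 ∂ν) atTop (𝓝 (∫ _s, (0 : ℝ) ∂ν)) := by
    refine tendsto_integral_filter_of_dominated_convergence (fun s => ‖f s‖ ^ 2) ?_ ?_ ?_ ?_
    · refine Eventually.of_forall fun t => ?_
      exact ((Lp.aestronglyMeasurable f).indicator measurableSet_Ioi).norm.pow 2
    · refine Eventually.of_forall fun t => Eventually.of_forall fun s => ?_
      rw [norm_pow, norm_norm]
      gcongr
      exact norm_indicator_le_norm_self _ _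
    · exact (Lp.memLp f).integrable_norm_pow (by norm_num)
    · refine Eventually.of_forall fun s => tendsto_const_nhds.congr' ?_
      filter_upwards [eventually_ge_atTop s] with t ht
      rw [indicator_of_notMem (by simpa using ht)]
      simp
  rw [integral_zero] at h2
  rw [tendsto_zero_iff_norm_tendsto_zero]
  have h3 := (h2.congr' h1).sqrt
  simpa [Real.sqrt_sq] using h3

end HalfLine


/-! ### Integral operators with vector-valued kernels -/

section IntegralOperators

local notation "ν" => (volume.restrict (Ioi (0 : ℝ)) : Measure ℝ)

variable {H : Type*} [NormedAddCommGroup H] [InnerProductSpace ℂ H]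

/-- `Ξ f = ∫₀^∞ f(s) β(s) ds`. -/
def IsIntegralOperator (β : ℝ → H) (Ξ : L2 ℂ →L[ℂ] H) : Prop :=
  ∀ f : L2 ℂ, IntegrableOn (fun s => f s • β s) (Ioi 0) ∧ Ξ f = ∫ s in Ioi (0 : ℝ), f s • β s

theorem setIntegral_Ioi_comp_add {G : Type*} [NormedAddCommGroup G] [NormedSpace ℝ G] (g : ℝ → G)
    (x : ℝ) : ∫ t in Ioi (0 : ℝ), g (t + x) = ∫ t in Ioi x, g t := by
  have h := (measurePreserving_add_right volume x).setIntegral_preimage_emb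
    (measurableEmbedding_addRight x) g (Ioi x)
  rw [← h]
  congr 2
  ext t
  simp

theorem integrableOn_Ioi_comp_add {G : Type*} [NormedAddCommGroup G] {g : ℝ → G} {x : ℝ} :
    IntegrableOn (fun t => g (t + x)) (Ioi (0 : ℝ)) ↔ IntegrableOn g (Ioi x) := by
  have h := (measurePreserving_add_right volume x).integrableOn_comp_preimage
    (measurableEmbedding_addRight x) (f := g) (s := Ioi x)
  rw [← h]
  have : (fun t => t + x) ⁻¹' Ioi x = Ioi 0 := by ext t; simp
  rw [this]
  rfl

variable {β γ : ℝ → H} {Ξ Θ : L2 ℂ →L[ℂ] H}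

theorem IsIntegralOperator.comp_adjoint_leftShift (h : IsIntegralOperator β Ξ) {x : ℝ}
    (hx : 0 ≤ x) : IsIntegralOperator (fun t => β (t + x))
      (Ξ ∘L ContinuousLinearMap.adjoint (leftShift x)) := by
  intro f
  obtain ⟨h1, h2⟩ := h (ContinuousLinearMap.adjoint (leftShift x) f)
  have hae : (fun s => ContinuousLinearMap.adjoint (leftShift x) f s • β s) =ᵐ[ν]
      (Ioi x).indicator fun s => f (s - x) • β s := by
    rw [adjoint_leftShift]
    filter_upwards [leftShift_neg_ae (t := x) f] with s hs
    rw [hs]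
    by_cases hxs : s ∈ Ioi x
    · simp only [indicator_of_mem hxs]
    · simp only [indicator_of_notMem hxs, zero_smul]
  have hset : Ioi 0 ∩ Ioi x = Ioi x := inter_eq_right.2 (Ioi_subset_Ioi hx)
  constructor
  · have h3 : IntegrableOn (fun s => f (s - x) • β s) (Ioi x) := by
      have h4 := h1.congr hae
      rw [integrable_indicator_iff measurableSet_Ioi, IntegrableOn,
        Measure.restrict_restrict measurableSet_Ioi, inter_comm, hset] at h4
      exact h4
    have := integrableOn_Ioi_comp_add.2 h3
    simpa using this
  · rw [ContinuousLinearMap.comp_apply, h2, integral_congr_ae hae,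
      integral_indicator measurableSet_Ioi, Measure.restrict_restrict measurableSet_Ioi, inter_comm,
      hset, ← setIntegral_Ioi_comp_add]
    simp

variable [CompleteSpace H]

theorem IsIntegralOperator.inner_integrableOn (h : IsIntegralOperator β Ξ) (f : L2 ℂ) (ξ : H) :
    IntegrableOn (fun s => inner ℂ ξ (β s) * f s) (Ioi 0) ∧
      inner ℂ ξ (Ξ f) = ∫ s in Ioi (0 : ℝ), inner ℂ ξ (β s) * f s := by
  obtain ⟨h1, h2⟩ := h f
  constructor
  · have := h1.const_inner (𝕜 := ℂ) ξ
    refine this.congr (Eventually.of_forall fun s => ?_)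
    simp only [inner_smul_right, mul_comm]
  · rw [h2, ← integral_inner h1]
    refine integral_congr_ae (Eventually.of_forall fun s => ?_)
    simp only [inner_smul_right, mul_comm]

/-- Only a weak description of the adjoint is available. Testing against indicator functions of sets
of finite measure identifies the integrals of both sides, and these determine a function on a
σ-finite space almost everywhere. -/
theorem IsIntegralOperator.adjoint_ae (h : IsIntegralOperator β Ξ) (ξ : H) :
    ContinuousLinearMap.adjoint Ξ ξ =ᵐ[ν] fun s => inner ℂ (β s) ξ := by
  have key : ∀ s : Set ℝ, ∀ hs : MeasurableSet s, ∀ hνs : ν s ≠ ⊤,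
      IntegrableOn (fun t => inner ℂ (β t) ξ) s ν ∧
      ∫ t in s, ContinuousLinearMap.adjoint Ξ ξ t ∂ν = ∫ t in s, inner ℂ (β t) ξ ∂ν := by
    intro s hs hνs
    obtain ⟨h1, h2⟩ := h.inner_integrableOn (indicatorConstLp 2 hs hνs (1 : ℂ)) ξ
    have hae : (fun t => inner ℂ ξ (β t) * indicatorConstLp 2 hs hνs (1 : ℂ) t) =ᵐ[ν]
        s.indicator fun t => inner ℂ ξ (β t) := by
      filter_upwards [indicatorConstLp_coeFn (p := 2) (hs := hs) (hμs := hνs) (c := (1 : ℂ))]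
        with t ht
      rw [ht]
      by_cases hts : t ∈ s
      · simp [indicator_of_mem hts]
      · simp [indicator_of_notMem hts]
    have h3 : IntegrableOn (fun t => inner ℂ ξ (β t)) s ν :=
      (integrable_indicator_iff hs).1 (h1.congr hae)
    constructor
    · have := Complex.conjCLE.toContinuousLinearMap.integrable_comp h3
      refine this.congr (Eventually.of_forall fun t => ?_)
      simp
    · rw [← L2.inner_indicatorConstLp_one hs hνs, ContinuousLinearMap.adjoint_inner_right,
        ← inner_conj_symm, h2, integral_congr_ae hae, integral_indicator hs, ← integral_conj]
      simp
  refine ae_eq_of_forall_setIntegral_eq_of_sigmaFinite (fun s hs hνs => ?_)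
    (fun s hs hνs => (key s hs hνs.ne).1) fun s hs hνs => (key s hs hνs.ne).2
  have : IsFiniteMeasure (Measure.restrict ν s) := ⟨by simpa using hνs⟩
  exact ((Lp.memLp (ContinuousLinearMap.adjoint Ξ ξ)).restrict s).integrable (by norm_num)

theorem adjoint_comp_ae (hΞ : IsIntegralOperator β Ξ) (hΘ : IsIntegralOperator γ Θ) (f : L2 ℂ) :
    ∀ᵐ s ∂ν, IntegrableOn (fun t => inner ℂ (γ s) (β t) * f t) (Ioi 0) ∧
      (ContinuousLinearMap.adjoint Θ ∘L Ξ) f s =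
        ∫ t in Ioi (0 : ℝ), inner ℂ (γ s) (β t) * f t := by
  filter_upwards [hΘ.adjoint_ae (Ξ f)] with s hs
  obtain ⟨h1, h2⟩ := hΞ.inner_integrableOn f (γ s)
  exact ⟨h1, by rw [← h2, ← hs]; rfl⟩

theorem comp_adjoint_apply (hΞ : IsIntegralOperator β Ξ) (hΘ : IsIntegralOperator γ Θ) (ξ : H) :
    IntegrableOn (fun t => (inner ℂ (γ t) ξ : ℂ) • β t) (Ioi 0) ∧
      (Ξ ∘L ContinuousLinearMap.adjoint Θ) ξ =
        ∫ t in Ioi (0 : ℝ), (inner ℂ (γ t) ξ : ℂ) • β t := by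
  obtain ⟨h1, h2⟩ := hΞ (ContinuousLinearMap.adjoint Θ ξ)
  have hae : (fun t => ContinuousLinearMap.adjoint Θ ξ t • β t) =ᵐ[ν]
      fun t => (inner ℂ (γ t) ξ : ℂ) • β t := by
    filter_upwards [hΘ.adjoint_ae ξ] with t ht
    rw [ht]
  exact ⟨h1.congr hae, h2.trans (integral_congr_ae hae)⟩

theorem norm_sq_L2 (f : L2 ℂ) : ‖f‖ ^ 2 = ∫ s, ‖f s‖ ^ 2 ∂ν := by
  have h : (inner ℂ f f : ℂ) = ((∫ s, ‖f s‖ ^ 2 ∂ν : ℝ) : ℂ) := by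
    rw [L2.inner_def, ← integral_complex_ofReal]
    refine integral_congr_ae (Eventually.of_forall fun s => ?_)
    simp only [inner_self_eq_norm_sq_to_K]
    norm_cast
  rw [inner_self_eq_norm_sq_to_K] at h
  exact Complex.ofReal_injective (by rw [← h]; norm_cast)

/-- The Hilbert-Schmidt norm of an integral operator whose kernel is bounded by `K` on a set `I` of
finite measure and vanishes elsewhere. -/
theorem summable_norm_sq_of_kernel_bounded {ι : Type*} (e : HilbertBasis ι ℂ (L2 ℂ))
    {T : L2 ℂ →L[ℂ] H} {I : Set ℝ} (hI : MeasurableSet I) (hI' : volume I ≠ ⊤) {K : ℝ}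
    (hT : ∀ ξ, ContinuousLinearMap.adjoint T ξ =ᵐ[ν] I.indicator fun s => inner ℂ (β s) ξ)
    (hK : ∀ s ∈ I, ‖β s‖ ≤ K) :
    (Summable fun i => ‖T (e i)‖ ^ 2) ∧ ∑' i, ‖T (e i)‖ ^ 2 ≤ K ^ 2 * volume.real I := by
  obtain ⟨w, h, -⟩ := exists_hilbertBasis ℂ H
  have hfin : ν I ≠ ⊤ := ne_top_of_le_ne_top hI' (Measure.restrict_apply_le _ _)
  -- Bessel's inequality is applied under the integral sign: for almost every `s` in `I` the finite
  -- sum is at most `‖β s‖² ≤ K²`.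
  have hbound : ∀ J : Finset w, ∑ n ∈ J, ‖ContinuousLinearMap.adjoint T (h n)‖ ^ 2 ≤
      K ^ 2 * volume.real I := fun J => by
    simp only [norm_sq_L2]
    rw [← integral_finsetSum J fun n _ => (Lp.memLp _).integrable_norm_pow (by norm_num)]
    calc ∫ s, ∑ n ∈ J, ‖ContinuousLinearMap.adjoint T (h n) s‖ ^ 2 ∂ν
        ≤ ∫ s, I.indicator (fun _ => K ^ 2) s ∂ν := by
          refine integral_mono_ae
            (integrable_finsetSum J fun n _ => (Lp.memLp _).integrable_norm_pow (by norm_num))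
            ((integrable_indicator_iff hI).2 (integrableOn_const hfin)) ?_
          have : ∀ᵐ s ∂ν, ∀ n ∈ J, ContinuousLinearMap.adjoint T (h n) s =
              I.indicator (fun s => inner ℂ (β s) (h n)) s :=
            (ae_ball_iff J.countable_toSet).2 fun n _ => hT (h n)
          filter_upwards [this] with s hs
          by_cases hsI : s ∈ I
          · rw [indicator_of_mem hsI]
            calc ∑ n ∈ J, ‖ContinuousLinearMap.adjoint T (h n) s‖ ^ 2
                = ∑ n ∈ J, ‖inner ℂ (h n) (β s)‖ ^ 2 := Finset.sum_congr rfl fun n hn => by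
                  rw [hs n hn, indicator_of_mem hsI, norm_inner_symm]
              _ ≤ ‖β s‖ ^ 2 := h.orthonormal.sum_inner_products_le (β s)
              _ ≤ K ^ 2 := by gcongr; exact hK s hsI
          · rw [indicator_of_notMem hsI]
            refine (Finset.sum_eq_zero fun n hn => ?_).le
            rw [hs n hn, indicator_of_notMem hsI]
            simp
      _ = K ^ 2 * Measure.real ν I := by
          rw [integral_indicator hI, setIntegral_const, smul_eq_mul, mul_comm]
      _ ≤ K ^ 2 * volume.real I := by
          gcongr
          exact ENNReal.toReal_mono hI' (Measure.restrict_apply_le _ _)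
  have h1 : Summable fun n => ‖ContinuousLinearMap.adjoint T (h n)‖ ^ 2 :=
    summable_of_sum_le (fun _ => by positivity) hbound
  have h2 := summable_norm_adjoint_sq (ContinuousLinearMap.adjoint T) h e h1
  have h3 := tsum_norm_adjoint_sq (ContinuousLinearMap.adjoint T) h e h1
  rw [ContinuousLinearMap.adjoint_adjoint] at h2 h3
  exact ⟨h2, h3.trans_le (h1.tsum_le_of_sum_le hbound)⟩

end IntegralOperators


/-! ### Shifted Hankel operators and tau functions -/

section Tau

universe u v

/-- This is multiplicativity applied to `(1 + μT)(1 - μT) = 1 - μ²T²`. -/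
theorem IsNuclearRep.fredholmDet_neg_sq {E : Type u} [NormedAddCommGroup E]
    [InnerProductSpace ℂ E] [CompleteSpace E] {κ : Type*} {T : E →L[ℂ] E} {f g : κ → E}
    (h : IsNuclearRep T f g) (μ : ℂ) :
    fredholmDet ((-μ ^ 2) • (T ∘L T)) = fredholmDet (μ • T) * fredholmDet ((-μ) • T) := by
  rw [← (h.smul μ).fredholmDet_mul (h.smul (-μ))]
  congr 1
  ext ξ
  simp [mul_apply_eq_comp, smul_smul]
  ring_nf

variable {H : Type v} [NormedAddCommGroup H] [InnerProductSpace ℂ H] [CompleteSpace H]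

/-- The Hankel operator `Γ_x`, as the compression of `Θ† Ξ` by the shift. -/
def shiftHankel (Θ Ξ : L2 ℂ →L[ℂ] H) (x : ℝ) : L2 ℂ →L[ℂ] L2 ℂ :=
  ContinuousLinearMap.adjoint (Θ ∘L ContinuousLinearMap.adjoint (leftShift x)) ∘L
    (Ξ ∘L ContinuousLinearMap.adjoint (leftShift x))

/-- The operator `R_x = ∫_x^∞ e^{-tA} B C e^{-tA} dt`. -/
def gramian (Θ Ξ : L2 ℂ →L[ℂ] H) (x : ℝ) : H →L[ℂ] H :=
  (Ξ ∘L ContinuousLinearMap.adjoint (leftShift x)) ∘L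
    ContinuousLinearMap.adjoint (Θ ∘L ContinuousLinearMap.adjoint (leftShift x))

theorem gramian_eq_cutoff (Θ Ξ : L2 ℂ →L[ℂ] H) (x : ℝ) :
    gramian Θ Ξ x = Ξ ∘L cutoff x ∘L ContinuousLinearMap.adjoint Θ := by
  rw [gramian, ContinuousLinearMap.adjoint_comp, ContinuousLinearMap.adjoint_adjoint, cutoff]
  rfl

variable {Θ Ξ : L2 ℂ →L[ℂ] H}

theorem isNuclearRep_shiftHankel {κ : Type*} (h : HilbertBasis κ ℂ H) (hΘ : IsHilbertSchmidt Θ)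
    (hΞ : IsHilbertSchmidt Ξ) (x : ℝ) :
    IsNuclearRep (shiftHankel Θ Ξ x) (fun n => leftShift x (ContinuousLinearMap.adjoint Ξ (h n)))
      fun n => leftShift x (ContinuousLinearMap.adjoint Θ (h n)) := by
  have := isNuclearRep_adjoint_comp h (hΞ.comp_right (ContinuousLinearMap.adjoint (leftShift x)))
    (hΘ.comp_right (ContinuousLinearMap.adjoint (leftShift x)))
  simpa [ContinuousLinearMap.adjoint_comp, shiftHankel] using this

theorem fredholmDet_gramian (hΘ : IsHilbertSchmidt Θ) (hΞ : IsHilbertSchmidt Ξ) (μ : ℂ) (x : ℝ) :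
    fredholmDet (μ • gramian Θ Ξ x) = tau (shiftHankel Θ Ξ) μ x := by
  have h1 := hΞ.comp_right (μ • ContinuousLinearMap.adjoint (leftShift x))
  have h2 := hΘ.comp_right (ContinuousLinearMap.adjoint (leftShift x))
  have h3 := fredholmDet_comp_adjoint_comm h1 h2
  simpa [tau, gramian, shiftHankel] using h3

theorem tauSq_eq_mul (hΘ : IsHilbertSchmidt Θ) (hΞ : IsHilbertSchmidt Ξ) (μ : ℂ) (x : ℝ) :
    tauSq (shiftHankel Θ Ξ) μ x =
      tau (shiftHankel Θ Ξ) μ x * tau (shiftHankel Θ Ξ) (-μ) x := by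
  obtain ⟨w, h, -⟩ := exists_hilbertBasis ℂ H
  exact (isNuclearRep_shiftHankel h hΘ hΞ x).fredholmDet_neg_sq μ

theorem tau_eq_fredholmSeries {κ : Type*} (h : HilbertBasis κ ℂ H) (hΘ : IsHilbertSchmidt Θ)
    (hΞ : IsHilbertSchmidt Ξ) (μ : ℂ) (x : ℝ) :
    tau (shiftHankel Θ Ξ) μ x =
      fredholmSeries (fun n => leftShift x (ContinuousLinearMap.adjoint Ξ (h n)))
        fun n => μ • leftShift x (ContinuousLinearMap.adjoint Θ (h n)) :=
  ((isNuclearRep_shiftHankel h hΘ hΞ x).smul μ).fredholmDet_eq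

theorem norm_mul_norm_smul_leftShift_le (f g : L2 ℂ) (μ : ℂ) (x : ℝ) :
    ‖leftShift x f‖ * ‖μ • leftShift x g‖ ≤ ‖μ‖ * (‖f‖ * ‖g‖) := by
  rw [norm_smul, mul_left_comm]
  gcongr
  · exact norm_leftShift_apply_le x f
  · exact norm_leftShift_apply_le x g

/-- In the Fredholm series only the vectors are shifted, and the shift is a strongly continuous
family of contractions, so a single summable bound serves all `x`. -/
theorem continuous_tau (hΘ : IsHilbertSchmidt Θ) (hΞ : IsHilbertSchmidt Ξ) (μ : ℂ) :
    Continuous (tau (shiftHankel Θ Ξ) μ) := by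
  obtain ⟨w, h, -⟩ := exists_hilbertBasis ℂ H
  have hs := summable_mul_of_summable_sq (hΞ.summable_adjoint h) (hΘ.summable_adjoint h)
    (fun _ => norm_nonneg _) fun _ => norm_nonneg _
  rw [continuous_iff_continuousAt]
  intro x
  rw [ContinuousAt, tau_eq_fredholmSeries h hΘ hΞ]
  refine Tendsto.congr (fun x => (tau_eq_fredholmSeries h hΘ hΞ μ x).symm) ?_
  exact tendsto_fredholmSeries (fun _ => by positivity) (hs.mul_left ‖μ‖)
    (fun y n => norm_mul_norm_smul_leftShift_le _ _ μ y)
    (fun n => (continuous_leftShift _).tendsto x)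
    fun n => ((continuous_leftShift _).tendsto x).const_smul μ

theorem fredholmSeries_zero {E κ : Type*} [NormedAddCommGroup E] [InnerProductSpace ℂ E] :
    fredholmSeries (fun _ : κ => (0 : E)) (fun _ : κ => (0 : E)) = 1 := by
  have h := norm_fredholmSeries_sub_le (f := fun _ : κ => (0 : E)) (g := fun _ : κ => (0 : E))
    (A := 0) (by simp) (by simp) zero_le_one
  simpa [sub_eq_zero] using h

theorem tendsto_tau_atTop (hΘ : IsHilbertSchmidt Θ) (hΞ : IsHilbertSchmidt Ξ) (μ : ℂ) :
    Tendsto (tau (shiftHankel Θ Ξ) μ) atTop (𝓝 1) := by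
  obtain ⟨w, h, -⟩ := exists_hilbertBasis ℂ H
  have hs := summable_mul_of_summable_sq (hΞ.summable_adjoint h) (hΘ.summable_adjoint h)
    (fun _ => norm_nonneg _) fun _ => norm_nonneg _
  rw [← fredholmSeries_zero (E := L2 ℂ) (κ := w)]
  refine Tendsto.congr (fun x => (tau_eq_fredholmSeries h hΘ hΞ μ x).symm) ?_
  refine tendsto_fredholmSeries (fun _ => by positivity) (hs.mul_left ‖μ‖)
    (fun y n => norm_mul_norm_smul_leftShift_le _ _ μ y)
    (fun n => tendsto_leftShift_atTop _) fun n => ?_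
  simpa using (tendsto_leftShift_atTop (ContinuousLinearMap.adjoint Θ (h n))).const_smul μ

theorem exists_forall_tau_ne_zero (hΘ : IsHilbertSchmidt Θ) (hΞ : IsHilbertSchmidt Ξ) :
    ∃ δ : ℝ, 0 < δ ∧ ∀ μ : ℂ, ‖μ‖ < δ → ∀ x, tau (shiftHankel Θ Ξ) μ x ≠ 0 := by
  obtain ⟨w, h, -⟩ := exists_hilbertBasis ℂ H
  have hs := summable_mul_of_summable_sq (hΞ.summable_adjoint h) (hΘ.summable_adjoint h)
    (fun _ => norm_nonneg _) fun _ => norm_nonneg _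
  set A := ∑' n, ‖ContinuousLinearMap.adjoint Ξ (h n)‖ * ‖ContinuousLinearMap.adjoint Θ (h n)‖
  have hA : 0 ≤ A := tsum_nonneg fun _ => by positivity
  -- With this `δ` the nuclear sum is at most `1/2`, so the determinant differs from `1` by at most
  -- `1/2` from the trace plus `1/4` from the remainder.
  refine ⟨(2 * (A + 1))⁻¹, by positivity, fun μ hμ x => ?_⟩
  have hμA : ‖μ‖ * A ≤ 1 / 2 := by
    have h1 : ‖μ‖ * A ≤ (2 * (A + 1))⁻¹ * A := by gcongr
    have h2 : (2 * (A + 1))⁻¹ * A ≤ 1 / 2 := by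
      rw [inv_mul_le_iff₀ (by positivity)]; linarith
    exact h1.trans h2
  set f := fun n => leftShift x (ContinuousLinearMap.adjoint Ξ (h n))
  set g := fun n => μ • leftShift x (ContinuousLinearMap.adjoint Θ (h n))
  have hle : ∀ n, ‖f n‖ * ‖g n‖ ≤ ‖μ‖ * (‖ContinuousLinearMap.adjoint Ξ (h n)‖ *
      ‖ContinuousLinearMap.adjoint Θ (h n)‖) := fun n => norm_mul_norm_smul_leftShift_le _ _ μ x
  have hsum : Summable fun n => ‖f n‖ * ‖g n‖ :=
    Summable.of_nonneg_of_le (fun _ => by positivity) hle (hs.mul_left ‖μ‖)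
  have htot : ∑' n, ‖f n‖ * ‖g n‖ ≤ ‖μ‖ * A := by
    rw [← tsum_mul_left]
    exact hsum.tsum_le_tsum hle (hs.mul_left _)
  have hmain := norm_fredholmSeries_sub_le hsum htot (hμA.trans (by norm_num))
  have htr : ‖∑' n, inner ℂ (f n) (g n)‖ ≤ ‖μ‖ * A :=
    (tsum_of_norm_bounded hsum.hasSum fun n => norm_inner_le_norm _ _).trans htot
  intro h0
  rw [tau_eq_fredholmSeries h hΘ hΞ] at h0
  change fredholmSeries f g = 0 at h0
  rw [h0] at hmain
  have h1 : (1 : ℝ) ≤ ‖(0 : ℂ) - 1 - ∑' n, inner ℂ (f n) (g n)‖ +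
      ‖∑' n, inner ℂ (f n) (g n)‖ := by
    have := norm_sub_le ((0 : ℂ) - 1 - ∑' n, inner ℂ (f n) (g n)) (-∑' n, inner ℂ (f n) (g n))
    rw [norm_neg] at this
    simpa using this
  have h0' : 0 ≤ ‖μ‖ * A := by positivity
  nlinarith

end Tau


/-! ### The orbits of a linear system -/

section Systems

local notation "ν" => (volume.restrict (Ioi (0 : ℝ)) : Measure ℝ)

variable {H : Type*} [NormedAddCommGroup H] [InnerProductSpace ℂ H]

/-- The orbit `e^{-tA} B`. -/
def LinearSystem.orbit (L : LinearSystem H ℂ) (t : ℝ) : H := L.expNeg t (L.B 1)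

theorem LinearSystem.continuousOn_expNeg (L : LinearSystem H ℂ) (ξ : H) :
    ContinuousOn (fun t => L.expNeg t ξ) (Ici 0) := L.isC0Semigroup.continuousOn ξ

theorem LinearSystem.expNeg_add_apply (L : LinearSystem H ℂ) {s t : ℝ} (hs : 0 ≤ s) (ht : 0 ≤ t)
    (ξ : H) : L.expNeg (s + t) ξ = L.expNeg s (L.expNeg t ξ) := by
  rw [L.isC0Semigroup.add s t hs ht]; rfl

theorem LinearSystem.orbit_add (L : LinearSystem H ℂ) {s t : ℝ} (hs : 0 ≤ s) (ht : 0 ≤ t) :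
    L.orbit (s + t) = L.expNeg s (L.orbit t) := L.expNeg_add_apply hs ht _

theorem LinearSystem.exists_bound (L : LinearSystem H ℂ) :
    ∃ M : ℝ, 0 ≤ M ∧ ∀ t, 0 ≤ t → ‖L.expNeg t‖ ≤ M := by
  obtain ⟨M, hM⟩ := L.bounded
  exact ⟨M, (norm_nonneg _).trans (hM 0 le_rfl), hM⟩

/-- Strong continuity of the semigroup along convergent vectors. -/
theorem LinearSystem.tendsto_expNeg (L : LinearSystem H ℂ) {α : Type*} {l : Filter α} {s : α → ℝ}
    {s₀ : ℝ} {ξ : α → H} {ξ₀ : H} (hs0 : ∀ᶠ a in l, 0 ≤ s a) (hs₀ : 0 ≤ s₀)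
    (hs : Tendsto s l (𝓝 s₀)) (hξ : Tendsto ξ l (𝓝 ξ₀)) :
    Tendsto (fun a => L.expNeg (s a) (ξ a)) l (𝓝 (L.expNeg s₀ ξ₀)) := by
  obtain ⟨M, hM0, hM⟩ := L.exists_bound
  have h1 : Tendsto (fun a => L.expNeg (s a) ξ₀) l (𝓝 (L.expNeg s₀ ξ₀)) :=
    (L.continuousOn_expNeg ξ₀ s₀ hs₀).tendsto.comp (tendsto_nhdsWithin_iff.2 ⟨hs, hs0⟩)
  have h2 : Tendsto (fun a => L.expNeg (s a) (ξ a - ξ₀)) l (𝓝 0) := by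
    have h3 : Tendsto (fun a => M * ‖ξ a - ξ₀‖) l (𝓝 0) := by
      have := (hξ.sub_const ξ₀).norm.const_mul M
      simpa using this
    refine squeeze_zero_norm' ?_ h3
    filter_upwards [hs0] with a ha
    exact (L.expNeg (s a)).le_of_opNorm_le (hM _ ha) _
  have := h2.add h1
  simpa using this

theorem LinearSystem.IsControllabilityOperator.isIntegralOperator {L : LinearSystem H ℂ}
    {Ξ : L2 ℂ →L[ℂ] H} (h : L.IsControllabilityOperator Ξ) : IsIntegralOperator L.orbit Ξ := by
  have h1 : ∀ (f : ℝ → ℂ) s, L.expNeg s (L.B (f s)) = f s • L.orbit s := fun f s => by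
    rw [orbit, ← map_smul, ← map_smul, smul_eq_mul, mul_one]
  intro f
  simpa only [h1] using h f

theorem continuousOn_gramian_integrand (L : LinearSystem H ℂ) (ξ : H) :
    ContinuousOn (fun t => L.C (L.expNeg t ξ) • L.orbit t) (Ici 0) :=
  (L.C.continuous.comp_continuousOn (L.continuousOn_expNeg ξ)).smul (L.continuousOn_expNeg _)

variable [CompleteSpace H]

/-- The orbit `(e^{-tA})† C†`. -/
def LinearSystem.coorbit (L : LinearSystem H ℂ) (t : ℝ) : H :=
  ContinuousLinearMap.adjoint (L.expNeg t) (ContinuousLinearMap.adjoint L.C 1)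

theorem LinearSystem.inner_coorbit (L : LinearSystem H ℂ) (t : ℝ) (ξ : H) :
    inner ℂ (L.coorbit t) ξ = L.C (L.expNeg t ξ) := by
  rw [coorbit, ContinuousLinearMap.adjoint_inner_left, ContinuousLinearMap.adjoint_inner_left]
  simp

theorem LinearSystem.phi_add (L : LinearSystem H ℂ) {s t : ℝ} (hs : 0 ≤ s) (ht : 0 ≤ t) :
    L.phi (s + t) = inner ℂ (L.coorbit s) (L.orbit t) := by
  rw [L.inner_coorbit, phi, L.expNeg_add_apply hs ht]
  rfl

theorem LinearSystem.exists_orbit_bound (L : LinearSystem H ℂ) :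
    ∃ K : ℝ, 0 ≤ K ∧ (∀ t, 0 ≤ t → ‖L.orbit t‖ ≤ K) ∧ ∀ t, 0 ≤ t → ‖L.coorbit t‖ ≤ K := by
  obtain ⟨M, hM0, hM⟩ := L.exists_bound
  refine ⟨max (M * ‖L.B 1‖) (M * ‖ContinuousLinearMap.adjoint L.C 1‖),
    le_max_of_le_left (by positivity), fun t ht => ?_, fun t ht => ?_⟩
  · exact ((L.expNeg t).le_of_opNorm_le (hM t ht) _).trans (le_max_left _ _)
  · refine (ContinuousLinearMap.le_of_opNorm_le _ ?_ _).trans (le_max_right _ _)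
    rw [LinearIsometryEquiv.norm_map]
    exact hM t ht

theorem LinearSystem.IsObservabilityOperator.isIntegralOperator {L : LinearSystem H ℂ}
    {Θ : L2 ℂ →L[ℂ] H} (h : L.IsObservabilityOperator Θ) : IsIntegralOperator L.coorbit Θ := by
  have h1 : ∀ (f : ℝ → ℂ) s, ContinuousLinearMap.adjoint (L.expNeg s)
      (ContinuousLinearMap.adjoint L.C (f s)) = f s • L.coorbit s := fun f s => by
    rw [coorbit, ← map_smul, ← map_smul, smul_eq_mul, mul_one]
  intro f
  simpa only [h1] using h f

variable {L : LinearSystem H ℂ} {Θ Ξ : L2 ℂ →L[ℂ] H}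

theorem isHankelOperator_shiftHankel (hΘ : L.IsObservabilityOperator Θ)
    (hΞ : L.IsControllabilityOperator Ξ) {x : ℝ} (hx : 0 ≤ x) :
    IsHankelOperator (fun y => L.phi (2 * x + y)) (shiftHankel Θ Ξ x) := by
  intro f
  have h := adjoint_comp_ae (hΞ.isIntegralOperator.comp_adjoint_leftShift hx)
    (hΘ.isIntegralOperator.comp_adjoint_leftShift hx) f
  filter_upwards [h, ae_restrict_mem measurableSet_Ioi] with s hs hs0
  have hphi : ∀ t ∈ Ioi (0 : ℝ), inner ℂ (L.coorbit (s + x)) (L.orbit (t + x)) * f t =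
      L.phi (2 * x + (s + t)) * f t := fun t ht => by
    rw [← L.phi_add (add_nonneg (le_of_lt hs0) hx) (add_nonneg (le_of_lt ht) hx)]
    ring_nf
  exact ⟨hs.1.congr_fun hphi measurableSet_Ioi,
    hs.2.trans (setIntegral_congr_fun measurableSet_Ioi hphi)⟩

theorem gramian_apply (hΘ : L.IsObservabilityOperator Θ) (hΞ : L.IsControllabilityOperator Ξ)
    {x : ℝ} (hx : 0 ≤ x) (ξ : H) :
    IntegrableOn (fun t => L.C (L.expNeg t ξ) • L.orbit t) (Ioi x) ∧
      gramian Θ Ξ x ξ = ∫ t in Ioi x, L.C (L.expNeg t ξ) • L.orbit t := by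
  have h := comp_adjoint_apply (hΞ.isIntegralOperator.comp_adjoint_leftShift hx)
    (hΘ.isIntegralOperator.comp_adjoint_leftShift hx) ξ
  simp only [L.inner_coorbit] at h
  exact ⟨integrableOn_Ioi_comp_add.1 h.1,
    h.2.trans (setIntegral_Ioi_comp_add (fun t => L.C (L.expNeg t ξ) • L.orbit t) x)⟩

/-- `e^{-hA} R_x e^{-hA} = R_{x+h}`. -/
theorem expNeg_gramian_expNeg (hΘ : L.IsObservabilityOperator Θ)
    (hΞ : L.IsControllabilityOperator Ξ) {x h : ℝ} (hx : 0 ≤ x) (hh : 0 ≤ h) :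
    L.expNeg h * gramian Θ Ξ x * L.expNeg h = gramian Θ Ξ (x + h) := by
  ext ξ
  obtain ⟨h1, h2⟩ := gramian_apply hΘ hΞ hx (L.expNeg h ξ)
  rw [mul_apply_eq_comp, mul_apply_eq_comp, h2, (gramian_apply hΘ hΞ (add_nonneg hx hh) ξ).2,
    ← ContinuousLinearMap.integral_comp_comm _ h1,
    ← setIntegral_Ioi_comp_add (fun t => L.C (L.expNeg t ξ) • L.orbit t),
    ← setIntegral_Ioi_comp_add (fun t => L.expNeg h (L.C (L.expNeg t (L.expNeg h ξ)) • L.orbit t))]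
  refine setIntegral_congr_fun measurableSet_Ioi fun t ht => ?_
  have ht' : 0 ≤ t + x := add_nonneg (le_of_lt ht) hx
  simp only [map_smul]
  rw [← L.expNeg_add_apply ht' hh, ← L.orbit_add hh ht', add_assoc, add_comm h]
  congr 2
  ring

theorem gramian_sub_apply (hΘ : L.IsObservabilityOperator Θ)
    (hΞ : L.IsControllabilityOperator Ξ) {x y : ℝ} (hx : 0 ≤ x) (hxy : x ≤ y) (ξ : H) :
    (gramian Θ Ξ x - gramian Θ Ξ y) ξ = ∫ t in x..y, L.C (L.expNeg t ξ) • L.orbit t := by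
  obtain ⟨h1, h2⟩ := gramian_apply hΘ hΞ hx ξ
  obtain ⟨h3, h4⟩ := gramian_apply hΘ hΞ (hx.trans hxy) ξ
  rw [sub_apply, h2, h4, intervalIntegral.integral_of_le hxy, sub_eq_iff_eq_add,
    ← Ioc_union_Ioi_eq_Ioi hxy]
  exact setIntegral_union (disjoint_left.2 fun t ht ht' => not_lt.2 ht.2 ht') measurableSet_Ioi
    (h1.mono_set Ioc_subset_Ioi_self) h3

/-- The orbits of `B` and `C†` are bounded by `K`, so `R_x - R_y` is an integral over `(x, y]` with
integrand of norm at most `K²`: `R` is Lipschitz in operator norm, although the semigroup is only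
strongly continuous. -/
theorem continuousOn_gramian (hΘ : L.IsObservabilityOperator Θ)
    (hΞ : L.IsControllabilityOperator Ξ) : ContinuousOn (gramian Θ Ξ) (Ici 0) := by
  obtain ⟨K, hK0, hK1, hK2⟩ := L.exists_orbit_bound
  have key : ∀ x y : ℝ, 0 ≤ x → x ≤ y → ‖gramian Θ Ξ x - gramian Θ Ξ y‖ ≤ K * K * (y - x) := by
    intro x y hx hxy
    refine ContinuousLinearMap.opNorm_le_bound _
      (mul_nonneg (mul_nonneg hK0 hK0) (sub_nonneg.2 hxy)) fun ξ => ?_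
    rw [gramian_sub_apply hΘ hΞ hx hxy]
    refine (intervalIntegral.norm_integral_le_of_norm_le_const (C := K * K * ‖ξ‖)
      fun t ht => ?_).trans_eq ?_
    · rw [uIoc_of_le hxy] at ht
      have ht0 : 0 ≤ t := hx.trans ht.1.le
      rw [norm_smul, ← L.inner_coorbit]
      calc ‖inner ℂ (L.coorbit t) ξ‖ * ‖L.orbit t‖ ≤ (K * ‖ξ‖) * K := by
            gcongr
            · exact (norm_inner_le_norm _ _).trans (by gcongr; exact hK2 t ht0)
            · exact hK1 t ht0
        _ = K * K * ‖ξ‖ := by ring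
    · rw [abs_of_nonneg (sub_nonneg.2 hxy)]; ring
  have key2 : ∀ x y : ℝ, 0 ≤ x → 0 ≤ y → ‖gramian Θ Ξ x - gramian Θ Ξ y‖ ≤ K * K * |x - y| := by
    intro x y hx hy
    rcases le_total x y with h | h
    · rw [abs_sub_comm, abs_of_nonneg (sub_nonneg.2 h)]
      exact key x y hx h
    · rw [norm_sub_rev, abs_of_nonneg (sub_nonneg.2 h)]
      exact key y x hy h
  have : LipschitzOnWith (K * K).toNNReal (gramian Θ Ξ) (Ici 0) :=
    LipschitzOnWith.of_dist_le_mul fun x hx y hy => by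
      rw [dist_eq_norm, Real.dist_eq, Real.coe_toNNReal _ (mul_nonneg hK0 hK0)]
      exact key2 x y hx hy
  exact this.continuousOn

end Systems


/-! ### The derivative of the tau function -/

section Derivative

local notation "ν" => (volume.restrict (Ioi (0 : ℝ)) : Measure ℝ)

variable {H : Type*} [NormedAddCommGroup H] [InnerProductSpace ℂ H] [CompleteSpace H]
  {L : LinearSystem H ℂ} {Θ Ξ : L2 ℂ →L[ℂ] H}

/-- Multiplication by the indicator function of `(x, y]`. -/
def window (x y : ℝ) : L2 ℂ →L[ℂ] L2 ℂ := cutoff x - cutoff y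

theorem window_ae {x y : ℝ} (hx : 0 ≤ x) (hxy : x ≤ y) (f : L2 ℂ) :
    window x y f =ᵐ[ν] (Ioc x y).indicator f := by
  have h0 : window x y f =ᵐ[ν] cutoff x f - cutoff y f := Lp.coeFn_sub _ _
  filter_upwards [h0, cutoff_ae hx f, cutoff_ae (hx.trans hxy) f] with s h0 h1 h2
  rw [h0, Pi.sub_apply, h1, h2]
  by_cases hxs : x < s
  · by_cases hys : s ≤ y
    · simp [indicator, hxs, hys, not_lt.2 hys]
    · simp [indicator, hxs, hys, not_le.1 hys]
  · have : ¬ y < s := fun h => hxs (hxy.trans_lt h)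
    simp [indicator, hxs, this]

theorem adjoint_window (x y : ℝ) : ContinuousLinearMap.adjoint (window x y) = window x y := by
  rw [window, map_sub, adjoint_cutoff, adjoint_cutoff]

theorem window_comp_window {x y : ℝ} (hx : 0 ≤ x) (hxy : x ≤ y) :
    window x y ∘L window x y = window x y := by
  refine ContinuousLinearMap.ext fun f => Lp.ext ?_
  filter_upwards [window_ae hx hxy (window x y f), window_ae hx hxy f] with s h1 h2
  rw [ContinuousLinearMap.comp_apply, h1, h2]
  by_cases hs : s ∈ Ioc x y
  · rw [indicator_of_mem hs, h2]
  · rw [indicator_of_notMem hs, indicator_of_notMem hs]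

theorem adjoint_comp_window_ae {β : ℝ → H} (h : IsIntegralOperator β Ξ) {x y : ℝ} (hx : 0 ≤ x)
    (hxy : x ≤ y) (ξ : H) : ContinuousLinearMap.adjoint (Ξ ∘L window x y) ξ =ᵐ[ν]
      (Ioc x y).indicator fun s => inner ℂ (β s) ξ := by
  rw [ContinuousLinearMap.adjoint_comp, adjoint_window]
  filter_upwards [window_ae hx hxy (ContinuousLinearMap.adjoint Ξ ξ), h.adjoint_ae ξ] with s h1 h2
  rw [ContinuousLinearMap.comp_apply, h1]
  by_cases hs : s ∈ Ioc x y
  · rw [indicator_of_mem hs, indicator_of_mem hs, h2]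
  · rw [indicator_of_notMem hs, indicator_of_notMem hs]

/-- Since `window x y` is an orthogonal projection it can be written twice, which exhibits the
increment as a product of two Hilbert-Schmidt operators, each of norm `O(√(y - x))`. -/
theorem gramian_sub_gramian {x y : ℝ} (hx : 0 ≤ x) (hxy : x ≤ y) :
    gramian Θ Ξ x - gramian Θ Ξ y =
      (Ξ ∘L window x y) ∘L ContinuousLinearMap.adjoint (Θ ∘L window x y) := by
  ext ξ
  have h1 : ∀ f, window x y (window x y f) = window x y f := fun f =>
    DFunLike.congr_fun (window_comp_window hx hxy) f
  rw [sub_apply, gramian_eq_cutoff, gramian_eq_cutoff, ContinuousLinearMap.adjoint_comp,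
    adjoint_window]
  simp only [ContinuousLinearMap.comp_apply]
  rw [h1, window, sub_apply, map_sub]

/-- The operator `(1 + μ R_x)⁻¹`. -/
def gramianInv (Θ Ξ : L2 ℂ →L[ℂ] H) (μ : ℂ) (x : ℝ) : H →L[ℂ] H :=
  Ring.inverse (1 + μ • gramian Θ Ξ x)

theorem exists_isNuclearRep_gramian (hΘ : IsHilbertSchmidt Θ) (hΞ : IsHilbertSchmidt Ξ) (x : ℝ) :
    ∃ (κ : Type) (f g : κ → H), IsNuclearRep (gramian Θ Ξ x) f g := by
  obtain ⟨w, e, -⟩ := exists_hilbertBasis ℂ (L2 ℂ)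
  exact ⟨_, _, _, isNuclearRep_comp_adjoint e ((hΞ.comp_right _).summable e)
    ((hΘ.comp_right _).summable e)⟩

theorem isUnit_of_tau_ne_zero (hΘ : IsHilbertSchmidt Θ) (hΞ : IsHilbertSchmidt Ξ) {μ : ℂ} {x : ℝ}
    (h : tau (shiftHankel Θ Ξ) μ x ≠ 0) : IsUnit (1 + μ • gramian Θ Ξ x) := by
  obtain ⟨κ, f, g, hfg⟩ := exists_isNuclearRep_gramian hΘ hΞ x
  refine (hfg.smul μ).isUnit_of_fredholmDet_ne_zero ?_
  rwa [fredholmDet_gramian hΘ hΞ]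

/-- This is the first-order expansion of the determinant to the right of `x`, with explicit error.
The quadratic term is the remainder `‖·‖₁²`; the term with `ε` comes from freezing the orbit of `B`
at `x` in the trace. Only invertibility at the left endpoint `x` is used. -/
theorem norm_tau_sub_le (hΘ : L.IsObservabilityOperator Θ) (hΞ : L.IsControllabilityOperator Ξ)
    (hΘ' : IsHilbertSchmidt Θ) (hΞ' : IsHilbertSchmidt Ξ) {μ : ℂ} {x y K ε : ℝ} (hx : 0 ≤ x)
    (hxy : x ≤ y) (h0 : tau (shiftHankel Θ Ξ) μ x ≠ 0) (hK0 : 0 ≤ K) (hε0 : 0 ≤ ε)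
    (hK : ∀ t, 0 ≤ t → ‖L.orbit t‖ ≤ K) (hK' : ∀ t, 0 ≤ t → ‖L.coorbit t‖ ≤ K)
    (hε : ∀ t ∈ Ioc x y, ‖L.orbit t - L.orbit x‖ ≤ ε)
    (hA : ‖μ‖ * ‖gramianInv Θ Ξ μ x‖ * K ^ 2 * (y - x) ≤ 1) :
    ‖tau (shiftHankel Θ Ξ) μ y - tau (shiftHankel Θ Ξ) μ x *
        (1 - μ * ∫ t in x..y, L.C (L.expNeg t (gramianInv Θ Ξ μ x (L.orbit x))))‖ ≤
      ‖tau (shiftHankel Θ Ξ) μ x‖ * ((‖μ‖ * ‖gramianInv Θ Ξ μ x‖ * K ^ 2 * (y - x)) ^ 2 +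
        ‖μ‖ * ‖gramianInv Θ Ξ μ x‖ * K * ε * (y - x)) := by
  obtain ⟨w, e, -⟩ := exists_hilbertBasis ℂ (L2 ℂ)
  have hu := isUnit_of_tau_ne_zero hΘ' hΞ' h0
  set Z := gramianInv Θ Ξ μ x with hZ
  set R := gramian Θ Ξ x with hR
  have hZ1 : (1 + μ • R) * Z = 1 := Ring.mul_inverse_cancel _ hu
  set Q := window x y with hQ
  set A := Θ ∘L Q with hAdef
  set B := Ξ ∘L Q with hBdef
  set l := y - x with hl
  have hl0 : 0 ≤ l := sub_nonneg.2 hxy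
  have hvol : volume.real (Ioc x y) = l := by simp [Measure.real, hl, hxy]
  have hvol' : volume (Ioc x y) ≠ ⊤ := by simp
  have hνvol : ν (Ioc x y) ≠ ⊤ := ne_top_of_le_ne_top hvol' (Measure.restrict_apply_le _ _)
  have hpos : ∀ t ∈ Ioc x y, 0 ≤ t := fun t ht => hx.trans ht.1.le
  have hsq : ∀ c : ℝ, c ^ 2 * l = (c * √l) ^ 2 := fun c => by rw [mul_pow, Real.sq_sqrt hl0]
  obtain ⟨hA1, hA2⟩ := summable_norm_sq_of_kernel_bounded (T := A) e measurableSet_Ioc hvol'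
    (fun ξ => adjoint_comp_window_ae hΘ.isIntegralOperator hx hxy ξ)
    fun t ht => hK' t (hpos t ht)
  obtain ⟨hB1, hB2⟩ := summable_norm_sq_of_kernel_bounded (T := B) e measurableSet_Ioc hvol'
    (fun ξ => adjoint_comp_window_ae hΞ.isIntegralOperator hx hxy ξ)
    fun t ht => hK t (hpos t ht)
  set χ : L2 ℂ := indicatorConstLp 2 (measurableSet_Ioc (a := x) (b := y)) hνvol (1 : ℂ) with hχ
  -- The rank-one operator obtained from `B` by freezing its kernel at time `x`; `B - D` has
  -- Hilbert-Schmidt norm at most `ε √l`.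
  set D : L2 ℂ →L[ℂ] H := (innerSL ℂ χ).smulRight (L.orbit x) with hD
  have hDadj : ∀ ξ, ContinuousLinearMap.adjoint D ξ = (inner ℂ (L.orbit x) ξ : ℂ) • χ := fun ξ => by
    refine ext_inner_right ℂ fun f => ?_
    rw [ContinuousLinearMap.adjoint_inner_left, inner_smul_left, inner_conj_symm]
    simp [hD, inner_smul_right, mul_comm]
  obtain ⟨hT1, hT2⟩ := summable_norm_sq_of_kernel_bounded (β := fun t => L.orbit t - L.orbit x)
    (T := B - D) e measurableSet_Ioc hvol' (fun ξ => by
      rw [map_sub, sub_apply, hDadj]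
      have h1 := Lp.coeFn_sub (ContinuousLinearMap.adjoint B ξ) ((inner ℂ (L.orbit x) ξ : ℂ) • χ)
      have h2 := Lp.coeFn_smul (inner ℂ (L.orbit x) ξ : ℂ) χ
      have h3 : χ =ᵐ[ν] (Ioc x y).indicator fun _ => (1 : ℂ) := indicatorConstLp_coeFn
      filter_upwards [h1, h2, h3, adjoint_comp_window_ae hΞ.isIntegralOperator hx hxy ξ]
        with s h1 h2 h3 h4
      rw [h1, Pi.sub_apply, h2, Pi.smul_apply, h3, h4]
      by_cases hs : s ∈ Ioc x y
      · simp only [indicator_of_mem hs]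
        simp
      · simp only [indicator_of_notMem hs]
        simp) hε
  rw [hvol, hsq] at hA2 hB2 hT2
  -- Chosen so that `1 + μ R_y = (1 + μ R_x)(1 + X)`, where `R_x - R_y = B A†` and `Z = (1 + μ
  -- R_x)⁻¹`.
  set X : H →L[ℂ] H := ((-μ) • (Z ∘L B)) ∘L ContinuousLinearMap.adjoint A with hX
  have hZle : ∀ v, ‖(-μ) • Z v‖ ≤ ‖μ‖ * ‖Z‖ * ‖v‖ := fun v => by
    rw [norm_smul, norm_neg, mul_assoc]
    gcongr
    exact Z.le_opNorm v
  have hg1 : Summable fun i => ‖((-μ) • (Z ∘L B)) (e i)‖ ^ 2 := by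
    refine Summable.of_nonneg_of_le (fun _ => by positivity) (fun i => ?_)
      (hB1.mul_left ((‖μ‖ * ‖Z‖) ^ 2))
    rw [← mul_pow]
    gcongr
    exact hZle _
  have hg2 : ∑' i, ‖((-μ) • (Z ∘L B)) (e i)‖ ^ 2 ≤ (‖μ‖ * ‖Z‖ * (K * √l)) ^ 2 := by
    rw [mul_pow _ (K * √l)]
    refine le_trans ?_ (mul_le_mul_of_nonneg_left hB2 (by positivity))
    rw [← tsum_mul_left]
    refine hg1.tsum_le_tsum (fun i => ?_) (hB1.mul_left _)
    rw [← mul_pow]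
    gcongr
    exact hZle _
  have hrep := isNuclearRep_comp_adjoint e hg1 hA1
  have hdet : tau (shiftHankel Θ Ξ) μ y = tau (shiftHankel Θ Ξ) μ x * fredholmDet X := by
    obtain ⟨κ, f, g, hfg⟩ := exists_isNuclearRep_gramian hΘ' hΞ' x
    rw [← fredholmDet_gramian hΘ' hΞ', ← fredholmDet_gramian hΘ' hΞ',
      ← (hfg.smul μ).fredholmDet_mul hrep]
    congr 1
    have h1 : X = (-μ) • (Z * (B ∘L ContinuousLinearMap.adjoint A)) := by
      ext ξ; simp [hX, mul_apply_eq_comp]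
    have h2 := gramian_sub_gramian (Θ := Θ) (Ξ := Ξ) hx hxy
    have h3 : μ • R + X + (μ • R) * X = μ • R + (1 + μ • R) * X := by rw [add_mul, one_mul]; abel
    rw [h3, h1, ← h2, mul_smul_comm, ← mul_assoc, hZ1, one_mul, smul_sub, neg_smul, neg_smul]
    abel
  have hnn : ∀ T : L2 ℂ →L[ℂ] H, ∀ i, 0 ≤ ‖T (e i)‖ := fun _ _ => norm_nonneg _
  have hsum : ∑' i, ‖A (e i)‖ * ‖((-μ) • (Z ∘L B)) (e i)‖ ≤ ‖μ‖ * ‖Z‖ * K ^ 2 * l := by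
    refine (tsum_mul_le_of_tsum_sq_le hA1 hg1 (hnn _) (hnn _) (by positivity) (by positivity)
      hA2 hg2).trans_eq ?_
    rw [show K * √l * (‖μ‖ * ‖Z‖ * (K * √l)) = ‖μ‖ * ‖Z‖ * K ^ 2 * (√l * √l) by ring,
      Real.mul_self_sqrt hl0]
  have hmain := norm_fredholmSeries_sub_le hrep.summable hsum hA
  rw [← hrep.fredholmDet_eq] at hmain
  set η := Z (L.orbit x) with hη
  -- Parseval evaluates the trace of the rank-one part as `⟨χ, A† η⟩`, the integral of the kernel of
  -- `A†` over `(x, y]`.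
  have hJ : HasSum (fun i => inner ℂ (A (e i)) η * inner ℂ χ (e i))
      (∫ t in x..y, L.C (L.expNeg t η)) := by
    have h1 := e.hasSum_inner_mul_inner χ (ContinuousLinearMap.adjoint A η)
    have h2 : inner ℂ χ (ContinuousLinearMap.adjoint A η) = ∫ t in x..y, L.C (L.expNeg t η) := by
      rw [hχ, L2.inner_indicatorConstLp_one, intervalIntegral.integral_of_le hxy,
        Measure.restrict_restrict measurableSet_Ioc,
        inter_eq_left.2 (show Ioc x y ⊆ Ioi 0 from fun t ht => hx.trans_lt ht.1)]
      refine setIntegral_congr_ae measurableSet_Ioc ?_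
      have h3 := (ae_restrict_iff' measurableSet_Ioi).1
        (adjoint_comp_window_ae hΘ.isIntegralOperator hx hxy η)
      filter_upwards [h3] with t ht hts
      rw [ht (hx.trans_lt hts.1), indicator_of_mem hts, L.inner_coorbit]
    rw [h2] at h1
    refine h1.congr_fun fun i => ?_
    rw [ContinuousLinearMap.adjoint_inner_right, mul_comm]
  have hrest : Summable fun i => ‖A (e i)‖ * ‖(B - D) (e i)‖ :=
    summable_mul_of_summable_sq hA1 hT1 (hnn _) (hnn _)
  have hrest' : ∀ i, ‖inner ℂ (A (e i)) ((-μ) • Z ((B - D) (e i)))‖ ≤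
      ‖μ‖ * ‖Z‖ * (‖A (e i)‖ * ‖(B - D) (e i)‖) := fun i => by
    refine (norm_inner_le_norm _ _).trans ?_
    calc _ ≤ ‖A (e i)‖ * (‖μ‖ * ‖Z‖ * ‖(B - D) (e i)‖) := by gcongr; exact hZle _
      _ = _ := by ring
  have htr : ‖∑' i, inner ℂ (A (e i)) (((-μ) • (Z ∘L B)) (e i)) +
      μ * ∫ t in x..y, L.C (L.expNeg t η)‖ ≤ ‖μ‖ * ‖Z‖ * K * ε * l := by
    have h1 : ∀ i, inner ℂ (A (e i)) (((-μ) • (Z ∘L B)) (e i)) =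
        inner ℂ (A (e i)) ((-μ) • Z ((B - D) (e i))) +
          (-μ) * (inner ℂ (A (e i)) η * inner ℂ χ (e i)) := fun i => by
      simp [hD, inner_smul_right, inner_sub_right, hη]
      ring
    have h2 : Summable fun i => inner ℂ (A (e i)) ((-μ) • Z ((B - D) (e i))) :=
      Summable.of_norm_bounded (hrest.mul_left _) hrest'
    have h3 := (h2.hasSum.add (hJ.mul_left (-μ))).tsum_eq
    simp only [← h1] at h3
    rw [h3]
    have h4 : ‖∑' i, inner ℂ (A (e i)) ((-μ) • Z ((B - D) (e i)))‖ ≤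
        ‖μ‖ * ‖Z‖ * ∑' i, ‖A (e i)‖ * ‖(B - D) (e i)‖ := by
      rw [← tsum_mul_left]
      exact tsum_of_norm_bounded (hrest.mul_left _).hasSum hrest'
    have h5 := tsum_mul_le_of_tsum_sq_le hA1 hT1 (hnn _) (hnn _) (by positivity) (by positivity)
      hA2 hT2
    rw [show K * √l * (ε * √l) = K * ε * (√l * √l) by ring, Real.mul_self_sqrt hl0] at h5
    rw [neg_mul, neg_add_cancel_right]
    calc _ ≤ _ := h4
      _ ≤ ‖μ‖ * ‖Z‖ * (K * ε * l) := by gcongr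
      _ = _ := by ring
  rw [hdet, ← mul_sub, norm_mul]
  gcongr
  calc ‖fredholmDet X - (1 - μ * ∫ t in x..y, L.C (L.expNeg t η))‖
      = ‖(fredholmDet X - 1 - ∑' i, inner ℂ (A (e i)) (((-μ) • (Z ∘L B)) (e i))) +
        (∑' i, inner ℂ (A (e i)) (((-μ) • (Z ∘L B)) (e i)) +
          μ * ∫ t in x..y, L.C (L.expNeg t η))‖ := by congr 1; ring
    _ ≤ _ := norm_add_le_of_le hmain htr

end Derivative


/-! ### One-sided derivatives -/

/-- A continuous function with a continuous right derivative is differentiable. -/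
theorem hasDerivAt_of_hasDerivWithinAt_Ici {f g : ℝ → ℂ} {U : Set ℝ} (hU : IsOpen U)
    (hf : ContinuousOn f U) (hg : ContinuousOn g U)
    (hd : ∀ x ∈ U, HasDerivWithinAt f (g x) (Ici x) x) {x : ℝ} (hx : x ∈ U) :
    HasDerivAt f (g x) x := by
  obtain ⟨ε, hε, hball⟩ := Metric.isOpen_iff.1 hU x hx
  set a := x - ε / 2 with ha
  set b := x + ε / 2 with hb
  have hsub : Icc a b ⊆ U := fun y hy => hball <| by
    rw [Metric.mem_ball, Real.dist_eq, abs_lt]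
    constructor <;> linarith [hy.1, hy.2]
  -- A primitive of `g` has the same right derivative as `f` and the same value at `a`, hence equals
  -- `f` on the interval; the primitive is differentiable from both sides.
  have hF : ∀ y ∈ Icc a b, HasDerivAt (fun y => f a + ∫ t in a..y, g t) (g y) y := fun y hy => by
    refine HasDerivAt.const_add _ ?_
    have hsub' : uIcc a y ⊆ U := by
      rw [uIcc_of_le hy.1]
      exact (Icc_subset_Icc_right hy.2).trans hsub
    exact intervalIntegral.integral_hasDerivAt_right (hg.mono hsub').intervalIntegrable
      (hg.stronglyMeasurableAtFilter hU y (hsub hy)) (hg.continuousAt (hU.mem_nhds (hsub hy)))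
  have heq := eq_of_has_deriv_right_eq (a := a) (b := b) (fun y hy => hd y (hsub ⟨hy.1, hy.2.le⟩))
    (fun y hy => (hF y ⟨hy.1, hy.2.le⟩).hasDerivWithinAt) (hf.mono hsub)
    (fun y hy => (hF y hy).continuousAt.continuousWithinAt) (by simp)
  refine (hF x ⟨by linarith, by linarith⟩).congr_of_eventuallyEq ?_
  filter_upwards [Icc_mem_nhds (show a < x by linarith) (show x < b by linarith)] with y hy
  exact heq y hy

/-! ### The Green kernel and the logarithmic derivative of the tau function -/

section GreenKernel

variable {H : Type*} [NormedAddCommGroup H] [InnerProductSpace ℂ H] [CompleteSpace H]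
  {L : LinearSystem H ℂ} {Θ Ξ : L2 ℂ →L[ℂ] H}

/-- The kernel `C e^{-xA} (1 + μ R_x)⁻¹ e^{-yA} B`. -/
def greenKernel (L : LinearSystem H ℂ) (Θ Ξ : L2 ℂ →L[ℂ] H) (μ : ℂ) (x y : ℝ) : ℂ :=
  L.C (L.expNeg x (gramianInv Θ Ξ μ x (L.orbit y)))

theorem continuousWithinAt_gramianInv (hΘ : L.IsObservabilityOperator Θ)
    (hΞ : L.IsControllabilityOperator Ξ) (hΘ' : IsHilbertSchmidt Θ) (hΞ' : IsHilbertSchmidt Ξ)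
    {μ : ℂ} {x : ℝ} (hx : 0 ≤ x) (h0 : tau (shiftHankel Θ Ξ) μ x ≠ 0) :
    ContinuousWithinAt (gramianInv Θ Ξ μ) (Ici 0) x := by
  obtain ⟨u, hu⟩ := isUnit_of_tau_ne_zero hΘ' hΞ' h0
  have h1 : ContinuousAt Ring.inverse (1 + μ • gramian Θ Ξ x) := by
    rw [← hu]; exact NormedRing.inverse_continuousAt u
  exact ContinuousAt.comp_continuousWithinAt (f := fun y => 1 + μ • gramian Θ Ξ y) h1
    (continuousWithinAt_const.add ((continuousOn_gramian hΘ hΞ x hx).const_smul μ))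

/-- The resolvent is continuous in operator norm, while the semigroup is strongly continuous and
uniformly bounded; together these suffice for joint continuity of the composed expression. -/
theorem continuousOn_greenKernel (hΘ : L.IsObservabilityOperator Θ)
    (hΞ : L.IsControllabilityOperator Ξ) (hΘ' : IsHilbertSchmidt Θ) (hΞ' : IsHilbertSchmidt Ξ)
    (μ : ℂ) : ContinuousOn (fun p : ℝ × ℝ => greenKernel L Θ Ξ μ p.1 p.2)
      {p | (0 < p.1 ∧ tau (shiftHankel Θ Ξ) μ p.1 ≠ 0) ∧ p.1 ≤ p.2} := by
  rintro ⟨x, y⟩ ⟨⟨hx, h0⟩, hxy⟩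
  simp only at hx h0 hxy
  set S := {p : ℝ × ℝ | (0 < p.1 ∧ tau (shiftHankel Θ Ξ) μ p.1 ≠ 0) ∧ p.1 ≤ p.2}
  have hfst : Tendsto (fun p : ℝ × ℝ => p.1) (𝓝[S] (x, y)) (𝓝 x) :=
    continuous_fst.continuousWithinAt
  have hsnd : Tendsto (fun p : ℝ × ℝ => p.2) (𝓝[S] (x, y)) (𝓝 y) :=
    continuous_snd.continuousWithinAt
  have hp1 : ∀ᶠ p in 𝓝[S] (x, y), (0 : ℝ) ≤ p.1 :=
    eventually_mem_nhdsWithin.mono fun p hp => hp.1.1.le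
  have hp2 : ∀ᶠ p in 𝓝[S] (x, y), (0 : ℝ) ≤ p.2 :=
    eventually_mem_nhdsWithin.mono fun p hp => hp.1.1.le.trans hp.2
  have h1 : Tendsto (fun p : ℝ × ℝ => L.orbit p.2) (𝓝[S] (x, y)) (𝓝 (L.orbit y)) :=
    L.tendsto_expNeg hp2 (hx.le.trans hxy) hsnd tendsto_const_nhds
  have h2 : Tendsto (fun p : ℝ × ℝ => gramianInv Θ Ξ μ p.1) (𝓝[S] (x, y))
      (𝓝 (gramianInv Θ Ξ μ x)) :=
    (continuousWithinAt_gramianInv hΘ hΞ hΘ' hΞ' hx.le h0).tendsto.comp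
      (tendsto_nhdsWithin_iff.2 ⟨hfst, hp1⟩)
  exact (L.C.continuous.tendsto _).comp (L.tendsto_expNeg hp1 hx.le hfst ((isBoundedBilinearMap_apply.continuous.tendsto
    (gramianInv Θ Ξ μ x, L.orbit y)).comp (h2.prodMk_nhds h1)))

/-- The integral equation of the Green kernel. -/
theorem greenKernel_equation (hΘ : L.IsObservabilityOperator Θ)
    (hΞ : L.IsControllabilityOperator Ξ) (hΘ' : IsHilbertSchmidt Θ) (hΞ' : IsHilbertSchmidt Ξ)
    {μ : ℂ} {x y : ℝ} (hx : 0 < x) (h0 : tau (shiftHankel Θ Ξ) μ x ≠ 0) (hxy : x ≤ y) :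
    IntegrableOn (fun z => greenKernel L Θ Ξ μ x z * L.phi (z + y)) (Ioi x) ∧
      greenKernel L Θ Ξ μ x y + μ * ∫ z in Ioi x, greenKernel L Θ Ξ μ x z * L.phi (z + y) =
        L.phi (x + y) := by
  have hu := isUnit_of_tau_ne_zero hΘ' hΞ' h0
  obtain ⟨h1, h2⟩ := gramian_apply hΘ hΞ hx.le (L.orbit y)
  -- The scalar equation is this functional applied to `(1 + μ R_x) e^{-yA} B`: it passes under the
  -- vector integral for `R_x`, and the resolvent cancels `1 + μ R_x`.
  set ℓ : H →L[ℂ] ℂ := L.C ∘L L.expNeg x ∘L gramianInv Θ Ξ μ x with hℓ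
  have hy : 0 ≤ y := hx.le.trans hxy
  have hint : ∀ z ∈ Ioi x, ℓ (L.C (L.expNeg z (L.orbit y)) • L.orbit z) =
      greenKernel L Θ Ξ μ x z * L.phi (z + y) := fun z hz => by
    rw [map_smul, smul_eq_mul, mul_comm, L.phi_add (hx.le.trans (le_of_lt hz)) hy, L.inner_coorbit]
    rfl
  refine ⟨(ℓ.integrable_comp h1).congr ?_, ?_⟩
  · exact (ae_restrict_iff' measurableSet_Ioi).2 (Eventually.of_forall hint)
  · rw [← setIntegral_congr_fun measurableSet_Ioi hint, ContinuousLinearMap.integral_comp_comm _ h1,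
      ← h2]
    have h3 : greenKernel L Θ Ξ μ x y = ℓ (L.orbit y) := rfl
    have h4 : gramianInv Θ Ξ μ x * (1 + μ • gramian Θ Ξ x) = 1 := Ring.inverse_mul_cancel _ hu
    have h5 : gramianInv Θ Ξ μ x (L.orbit y + μ • gramian Θ Ξ x (L.orbit y)) = L.orbit y :=
      DFunLike.congr_fun h4 (L.orbit y)
    rw [h3, ← smul_eq_mul, ← map_smul, ← map_add, hℓ, ContinuousLinearMap.comp_apply,
      ContinuousLinearMap.comp_apply, h5, L.phi_add hx.le hy, L.inner_coorbit]

theorem isOpen_setOf_tau_ne_zero (hΘ' : IsHilbertSchmidt Θ) (hΞ' : IsHilbertSchmidt Ξ) (μ : ℂ) :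
    IsOpen {x : ℝ | 0 < x ∧ tau (shiftHankel Θ Ξ) μ x ≠ 0} :=
  isOpen_Ioi.inter (isOpen_ne_fun (continuous_tau hΘ' hΞ' μ) continuous_const)

theorem continuousOn_greenKernel_diag (hΘ : L.IsObservabilityOperator Θ)
    (hΞ : L.IsControllabilityOperator Ξ) (hΘ' : IsHilbertSchmidt Θ) (hΞ' : IsHilbertSchmidt Ξ)
    (μ : ℂ) : ContinuousOn (fun x => greenKernel L Θ Ξ μ x x)
      {x : ℝ | 0 < x ∧ tau (shiftHankel Θ Ξ) μ x ≠ 0} :=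
  (continuousOn_greenKernel hΘ hΞ hΘ' hΞ' μ).comp
    (f := fun x : ℝ => (x, x)) (by fun_prop) fun x hx => ⟨hx, le_rfl⟩

theorem hasDerivWithinAt_tau (hΘ : L.IsObservabilityOperator Θ)
    (hΞ : L.IsControllabilityOperator Ξ) (hΘ' : IsHilbertSchmidt Θ) (hΞ' : IsHilbertSchmidt Ξ)
    {μ : ℂ} {x : ℝ} (hx : 0 < x) (h0 : tau (shiftHankel Θ Ξ) μ x ≠ 0) :
    HasDerivWithinAt (tau (shiftHankel Θ Ξ) μ)
      (tau (shiftHankel Θ Ξ) μ x * (-(μ * greenKernel L Θ Ξ μ x x))) (Ici x) x := by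
  obtain ⟨K, hK0, hK1, hK2⟩ := L.exists_orbit_bound
  set τ := tau (shiftHankel Θ Ξ) μ with hτ
  set η := gramianInv Θ Ξ μ x (L.orbit x)
  set c := ‖μ‖ * ‖gramianInv Θ Ξ μ x‖ with hc
  have hc0 : 0 ≤ c := by positivity
  have hcont : ContinuousOn (fun t => L.C (L.expNeg t η)) (Ici 0) :=
    L.C.continuous.comp_continuousOn (L.continuousOn_expNeg η)
  have hG : HasDerivAt (fun y => τ x * (1 - μ * ∫ t in x..y, L.C (L.expNeg t η)))
      (τ x * (-(μ * greenKernel L Θ Ξ μ x x))) x := by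
    refine HasDerivAt.const_mul _ (HasDerivAt.const_sub _ (HasDerivAt.const_mul _ ?_))
    refine intervalIntegral.integral_hasDerivAt_right (by simp)
      ((hcont.mono Ioi_subset_Ici_self).stronglyMeasurableAtFilter isOpen_Ioi x hx)
      (hcont.continuousAt (Ici_mem_nhds hx))
  -- The determinant is compared with an explicit function of `y`, differentiable by the fundamental
  -- theorem of calculus; the error is `o(y - x)`.
  have hE : HasDerivWithinAt (fun y => τ y - τ x * (1 - μ * ∫ t in x..y, L.C (L.expNeg t η))) 0
      (Ici x) x := by
    rw [hasDerivWithinAt_iff_isLittleO]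
    refine Asymptotics.isLittleO_iff.2 fun r hr => ?_
    -- Makes the linear error term at most `r/2 · (y - x)`; the `+ 1` keeps the denominator
    -- positive. The quadratic term takes the other half of `r`.
    set ε := r / (2 * (‖τ x‖ * c * K + 1)) with hε
    have hε0 : 0 < ε := by positivity
    have horb : ∀ᶠ y in 𝓝[Ici x] x, ∀ t ∈ Ioc x y, ‖L.orbit t - L.orbit x‖ ≤ ε := by
      have h1 : ContinuousAt L.orbit x :=
        (L.continuousOn_expNeg (L.B 1)).continuousAt (Ici_mem_nhds hx)
      obtain ⟨d, hd, hd'⟩ := Metric.continuousAt_iff.1 h1 ε hε0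
      filter_upwards [mem_nhdsWithin_of_mem_nhds (Metric.ball_mem_nhds x hd)] with y hy t ht
      rw [← dist_eq_norm]
      refine (hd' ?_).le
      rw [Metric.mem_ball, Real.dist_eq] at hy
      rw [Real.dist_eq, abs_of_pos (sub_pos.2 ht.1)]
      exact (sub_le_sub_right ht.2 x).trans_lt ((le_abs_self _).trans_lt hy)
    have hlim : Tendsto (fun y => y - x) (𝓝[Ici x] x) (𝓝 0) := by
      have h : Continuous fun y : ℝ => y - x := by fun_prop
      have := h.continuousWithinAt (s := Ici x) (x := x)
      simpa [ContinuousWithinAt] using this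
    have hA : ∀ᶠ y in 𝓝[Ici x] x, c * K ^ 2 * (y - x) ≤ 1 := by
      have := hlim.const_mul (c * K ^ 2)
      rw [mul_zero] at this
      exact this.eventually_le_const zero_lt_one
    have hA2 : ∀ᶠ y in 𝓝[Ici x] x, ‖τ x‖ * (c * K ^ 2) ^ 2 * (y - x) ≤ r / 2 := by
      have := hlim.const_mul (‖τ x‖ * (c * K ^ 2) ^ 2)
      rw [mul_zero] at this
      exact this.eventually_le_const (half_pos hr)
    filter_upwards [horb, hA, hA2, self_mem_nhdsWithin] with y h1 h2 h3 hxy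
    have hl : 0 ≤ y - x := sub_nonneg.2 hxy
    have hmain := norm_tau_sub_le hΘ hΞ hΘ' hΞ' hx.le hxy h0 hK0 hε0.le hK1 hK2 h1 h2
    have h5 : ‖τ x‖ * c * K * ε ≤ r / 2 := by
      have h6 : 0 ≤ ‖τ x‖ * c * K := by positivity
      rw [hε, mul_div_assoc', div_le_div_iff₀ (by positivity) (by norm_num)]
      nlinarith
    simp only [smul_zero, sub_zero, intervalIntegral.integral_same, mul_zero, mul_one, sub_self]
    rw [Real.norm_of_nonneg hl]
    refine hmain.trans ?_
    calc ‖τ x‖ * ((c * K ^ 2 * (y - x)) ^ 2 + c * K * ε * (y - x))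
        = (‖τ x‖ * (c * K ^ 2) ^ 2 * (y - x)) * (y - x) + (‖τ x‖ * c * K * ε) * (y - x) := by ring
      _ ≤ r / 2 * (y - x) + r / 2 * (y - x) := by gcongr
      _ = r * (y - x) := by ring
  have := hE.add hG.hasDerivWithinAt
  rw [zero_add] at this
  exact this.congr_of_eventuallyEq (Eventually.of_forall fun y => by simp) (by simp)

theorem hasDerivAt_tau (hΘ : L.IsObservabilityOperator Θ)
    (hΞ : L.IsControllabilityOperator Ξ) (hΘ' : IsHilbertSchmidt Θ) (hΞ' : IsHilbertSchmidt Ξ)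
    {μ : ℂ} {x : ℝ} (hx : 0 < x) (h0 : tau (shiftHankel Θ Ξ) μ x ≠ 0) :
    HasDerivAt (tau (shiftHankel Θ Ξ) μ)
      (tau (shiftHankel Θ Ξ) μ x * (-(μ * greenKernel L Θ Ξ μ x x))) x := by
  have hc := continuous_tau hΘ' hΞ' μ
  exact hasDerivAt_of_hasDerivWithinAt_Ici (isOpen_setOf_tau_ne_zero hΘ' hΞ' μ) hc.continuousOn
    (g := fun x => tau (shiftHankel Θ Ξ) μ x * (-(μ * greenKernel L Θ Ξ μ x x)))
    (hc.continuousOn.mul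
      (continuousOn_const.mul (continuousOn_greenKernel_diag hΘ hΞ hΘ' hΞ' μ)).neg)
    (fun y hy => hasDerivWithinAt_tau hΘ hΞ hΘ' hΞ' hy.1 hy.2) ⟨hx, h0⟩

end GreenKernel


/-! ### The derivative of the diagonal of the Green kernels -/

/-- The left side is the change of `(1 - Pa)⁻¹ P - (1 + Pa)⁻¹ P` from its value at `P = 1`. The
point is that the right side has no factor `P - 1`, whose difference quotients may diverge; it
depends on `P` only through bounded resolvents and `a - PaP`. -/
theorem ring_resolvent_identity {A : Type*} [Ring A] {a P Zp Zm Yp Ym : A}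
    (hZp : (1 + a) * Zp = 1) (hZm : (1 - a) * Zm = 1)
    (hYp : (1 + P * a) * Yp = 1) (hYp' : Yp * (1 + P * a) = 1)
    (hYm : (1 - P * a) * Ym = 1) (hYm' : Ym * (1 - P * a) = 1) :
    Ym * P - Yp * P - Zm + Zp = -(Yp * Ym * ((a - P * a * P) * (Zm + Zp))) := by
  have e1 : a * Zp = 1 - Zp := by rw [← hZp]; noncomm_ring
  have e2 : a * Zm = Zm - 1 := by rw [← hZm]; noncomm_ring
  -- The factors `1 - Pa` and `1 + Pa` commute, so multiplying by their product clears both inverses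
  -- containing `P`; the rest is reduction with `a Zp = 1 - Zp` and `a Zm = Zm - 1`.
  have key : (1 - P * a) * (1 + P * a) * (Ym * P - Yp * P - Zm + Zp) =
      -((a - P * a * P) * (Zm + Zp)) := by
    have c1 : (1 - P * a) * (1 + P * a) * Ym = 1 + P * a := by
      have : (1 - P * a) * (1 + P * a) = (1 + P * a) * (1 - P * a) := by noncomm_ring
      rw [this, mul_assoc, hYm, mul_one]
    have c2 : (1 - P * a) * (1 + P * a) * Yp = 1 - P * a := by rw [mul_assoc, hYp, mul_one]
    have c3 : (1 - P * a) * (1 + P * a) * Zm = Zm - P * a * P * (Zm - 1) := by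
      rw [← e2]; noncomm_ring
    have c4 : (1 - P * a) * (1 + P * a) * Zp = Zp - P * a * P * (1 - Zp) := by
      rw [← e1]; noncomm_ring
    have c5 : a * (Zm + Zp) = Zm - Zp := by rw [mul_add, e1, e2]; abel
    rw [mul_add, mul_sub, mul_sub, ← mul_assoc, ← mul_assoc, c1, c2, c3, c4, sub_mul a (P * a * P),
      c5]
    noncomm_ring
  have h1 : Yp * Ym * ((1 - P * a) * (1 + P * a)) = 1 := by
    rw [mul_assoc, ← mul_assoc Ym, hYm', one_mul, hYp']
  rw [← mul_neg, ← key, ← mul_assoc, h1, one_mul]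

section Nuclear

variable {E κ : Type*} [NormedAddCommGroup E] [InnerProductSpace ℂ E]

/-- Multiplication by a nuclear operator upgrades bounded strong convergence to norm convergence.
This makes `(1 + e^{-2hA} μ R_x)⁻¹` converge in norm as `h → 0+`. -/
theorem IsNuclearRep.tendsto_mul_left {T : E →L[ℂ] E} {f g : κ → E} (h : IsNuclearRep T f g)
    {α : Type*} {l : Filter α} {P : α → E →L[ℂ] E} {M : ℝ} (hM : ∀ᶠ a in l, ‖P a‖ ≤ M)
    (hP : ∀ ξ, Tendsto (fun a => P a ξ) l (𝓝 ξ)) : Tendsto (fun a => P a * T) l (𝓝 T) := by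
  rw [tendsto_iff_norm_sub_tendsto_zero]
  have h1 : Tendsto (fun a => ∑' n, ‖f n‖ * ‖(P a - 1) (g n)‖) l (𝓝 (∑' _ : κ, 0)) := by
    refine tendsto_tsum_of_dominated_convergence (h.summable.mul_left (M + 1)) (fun n => ?_) ?_
    · have := ((hP (g n)).sub_const (g n)).norm.const_mul ‖f n‖
      simpa using this
    · filter_upwards [hM] with a ha n
      rw [Real.norm_of_nonneg (by positivity), mul_left_comm]
      gcongr
      refine ContinuousLinearMap.le_of_opNorm_le _ ?_ _
      refine (norm_sub_le _ _).trans (add_le_add ha ?_)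
      exact ContinuousLinearMap.norm_id_le
  rw [tsum_zero] at h1
  refine squeeze_zero (fun _ => norm_nonneg _) (fun a => ?_) h1
  have h2 : P a * T - T = (P a - 1) * T := by rw [sub_mul, one_mul]
  rw [h2]
  exact (h.comp_left _).norm_le

end Nuclear

section GreenKernel

variable {H : Type*} [NormedAddCommGroup H] [InnerProductSpace ℂ H] [CompleteSpace H]
  {L : LinearSystem H ℂ} {Θ Ξ : L2 ℂ →L[ℂ] H}

theorem tendsto_slope_gramian (hΘ : L.IsObservabilityOperator Θ)
    (hΞ : L.IsControllabilityOperator Ξ) {x : ℝ} (hx : 0 < x) (ξ : H) :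
    Tendsto (fun y => (y - x)⁻¹ • (gramian Θ Ξ x - gramian Θ Ξ (x + 2 * (y - x))) ξ) (𝓝[>] x)
      (𝓝 ((2 : ℝ) • (L.C (L.expNeg x ξ) • L.orbit x))) := by
  have hcont := continuousOn_gramian_integrand L ξ
  have h1 : HasDerivAt (fun y => ∫ t in x..y, L.C (L.expNeg t ξ) • L.orbit t)
      (L.C (L.expNeg x ξ) • L.orbit x) x :=
    intervalIntegral.integral_hasDerivAt_right (by simp)
      ((hcont.mono Ioi_subset_Ici_self).stronglyMeasurableAtFilter isOpen_Ioi x hx)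
      (hcont.continuousAt (Ici_mem_nhds hx))
  have h2 : HasDerivAt (fun y : ℝ => x + 2 * (y - x)) 2 x := by
    simpa using (((hasDerivAt_id x).sub_const x).const_mul 2).const_add x
  have h3 : HasDerivAt (fun y => ∫ t in x..(x + 2 * (y - x)), L.C (L.expNeg t ξ) • L.orbit t)
      ((2 : ℝ) • (L.C (L.expNeg x ξ) • L.orbit x)) x :=
    HasDerivAt.scomp (g₁ := fun y => ∫ t in x..y, L.C (L.expNeg t ξ) • L.orbit t)
      (h := fun y : ℝ => x + 2 * (y - x)) x (by simpa using h1) h2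
  have h4 := (hasDerivWithinAt_iff_tendsto_slope' self_notMem_Ioi).1
    (h3.hasDerivWithinAt (s := Ioi x))
  refine h4.congr' ?_
  filter_upwards [self_mem_nhdsWithin] with y hy
  have hy' : x < y := hy
  rw [gramian_sub_apply hΘ hΞ hx.le (by linarith)]
  simp [slope]

/-- `e^{-hA} (1 + μ R_{x + h})⁻¹ e^{-hA} = (1 + μ e^{-2hA} R_x)⁻¹ e^{-2hA}`. -/
theorem expNeg_gramianInv_expNeg (hΘ : L.IsObservabilityOperator Θ)
    (hΞ : L.IsControllabilityOperator Ξ) {μ : ℂ} {x h : ℝ} (hx : 0 ≤ x) (hh : 0 ≤ h)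
    (h1 : IsUnit (1 + μ • gramian Θ Ξ (x + h)))
    (h2 : IsUnit (1 + L.expNeg (h + h) * (μ • gramian Θ Ξ x))) :
    L.expNeg h * gramianInv Θ Ξ μ (x + h) * L.expNeg h =
      Ring.inverse (1 + L.expNeg (h + h) * (μ • gramian Θ Ξ x)) * L.expNeg (h + h) := by
  have hP : L.expNeg (h + h) = L.expNeg h * L.expNeg h := L.isC0Semigroup.add h h hh hh
  -- One factor `e^{-hA}` is pushed through, using `R_{x+h} = e^{-hA} R_x e^{-hA}`.
  have e1 : (1 + L.expNeg (h + h) * (μ • gramian Θ Ξ x)) * L.expNeg h =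
      L.expNeg h * (1 + μ • gramian Θ Ξ (x + h)) := by
    rw [← expNeg_gramian_expNeg hΘ hΞ hx hh, hP, add_mul, mul_add, one_mul, mul_one]
    simp only [mul_smul_comm, smul_mul_assoc, mul_assoc]
  have e2 : (1 + L.expNeg (h + h) * (μ • gramian Θ Ξ x)) *
      (L.expNeg h * gramianInv Θ Ξ μ (x + h) * L.expNeg h) = L.expNeg (h + h) := by
    rw [← mul_assoc, ← mul_assoc, e1, mul_assoc (L.expNeg h), gramianInv,
      Ring.mul_inverse_cancel _ h1, mul_one, hP]
  refine (?_ : _ = _ * _).trans (congrArg _ e2)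
  rw [← mul_assoc (Ring.inverse _), Ring.inverse_mul_cancel _ h2, one_mul]

/-- The difference of the two Green kernels has right derivative `-μ (k₊ + k₋)²`. -/
theorem hasDerivWithinAt_greenKernel_sub (hΘ : L.IsObservabilityOperator Θ)
    (hΞ : L.IsControllabilityOperator Ξ) (hΘ' : IsHilbertSchmidt Θ) (hΞ' : IsHilbertSchmidt Ξ)
    {μ : ℂ} {x : ℝ} (hx : 0 < x) (h0 : tau (shiftHankel Θ Ξ) μ x ≠ 0)
    (h0' : tau (shiftHankel Θ Ξ) (-μ) x ≠ 0) :
    HasDerivWithinAt (fun y => greenKernel L Θ Ξ (-μ) y y - greenKernel L Θ Ξ μ y y)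
      (-(μ * (greenKernel L Θ Ξ μ x x + greenKernel L Θ Ξ (-μ) x x) ^ 2)) (Ici x) x := by
  obtain ⟨κ, f, g, hfg⟩ := exists_isNuclearRep_gramian hΘ' hΞ' x
  obtain ⟨M, hM0, hM⟩ := L.exists_bound
  set ξ : H := gramianInv Θ Ξ (-μ) x (L.orbit x) + gramianInv Θ Ξ μ x (L.orbit x) with hξ
  set P : ℝ → H →L[ℂ] H := fun y => L.expNeg ((y - x) + (y - x)) with hPdef
  have hlim : Tendsto (fun y : ℝ => y - x) (𝓝[>] x) (𝓝 0) := by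
    have h : Continuous fun y : ℝ => y - x := by fun_prop
    have := h.continuousWithinAt (s := Ioi x) (x := x)
    simpa [ContinuousWithinAt] using this
  have hpos : ∀ᶠ y in 𝓝[>] x, 0 ≤ y - x :=
    eventually_mem_nhdsWithin.mono fun y hy => (sub_pos.2 hy).le
  have hPM : ∀ᶠ y in 𝓝[>] x, ‖P y‖ ≤ M := hpos.mono fun y hy => hM _ (by positivity)
  have hPs : ∀ η, Tendsto (fun y => P y η) (𝓝[>] x) (𝓝 η) := fun η => by
    have := L.tendsto_expNeg (hpos.mono fun y hy => add_nonneg hy hy) (by simp : (0 : ℝ) ≤ 0 + 0)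
      (hlim.add hlim) (tendsto_const_nhds (x := η))
    simpa [L.isC0Semigroup.zero] using this
  have hY : ∀ c : ℂ, tau (shiftHankel Θ Ξ) c x ≠ 0 →
      (∀ᶠ y in 𝓝[>] x, IsUnit (1 + P y * (c • gramian Θ Ξ x))) ∧
      Tendsto (fun y => Ring.inverse (1 + P y * (c • gramian Θ Ξ x))) (𝓝[>] x)
        (𝓝 (gramianInv Θ Ξ c x)) := fun c hc => by
    have h1 : Tendsto (fun y => 1 + P y * (c • gramian Θ Ξ x)) (𝓝[>] x)
        (𝓝 (1 + c • gramian Θ Ξ x)) := ((hfg.smul c).tendsto_mul_left hPM hPs).const_add 1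
    obtain ⟨u, hu⟩ := isUnit_of_tau_ne_zero hΘ' hΞ' hc
    refine ⟨h1.eventually ?_, ?_⟩
    · rw [← hu]; exact Units.isOpen.mem_nhds u.isUnit
    · have h2 : ContinuousAt Ring.inverse (1 + c • gramian Θ Ξ x) := by
        rw [← hu]; exact NormedRing.inverse_continuousAt u
      exact h2.tendsto.comp h1
  have hU : ∀ c : ℂ, tau (shiftHankel Θ Ξ) c x ≠ 0 →
      ∀ᶠ y in 𝓝[>] x, tau (shiftHankel Θ Ξ) c y ≠ 0 := fun c hc =>
    mem_nhdsWithin_of_mem_nhds ((continuous_tau hΘ' hΞ' c).continuousAt.eventually_ne hc)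
  -- At `y = x + h` one factor `e^{-hA}` is moved inwards from each end, so that all dependence on
  -- `y` is in `P y` and the outer vectors stay at `x`.
  have hkey : ∀ c : ℂ, ∀ y, x < y → tau (shiftHankel Θ Ξ) c y ≠ 0 →
      IsUnit (1 + P y * (c • gramian Θ Ξ x)) →
      greenKernel L Θ Ξ c y y = L.C (L.expNeg x
        ((Ring.inverse (1 + P y * (c • gramian Θ Ξ x)) * P y) (L.orbit x))) := by
    intro c y hy hc hc'
    have hh : 0 ≤ y - x := (sub_pos.2 hy).le
    have e : x + (y - x) = y := by ring
    have h1 := expNeg_gramianInv_expNeg hΘ hΞ hx.le hh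
      (by rw [e]; exact isUnit_of_tau_ne_zero hΘ' hΞ' hc) hc'
    rw [← h1, e, mul_apply_eq_comp, mul_apply_eq_comp, ← L.expNeg_add_apply hx.le hh,
      ← L.orbit_add hh hx.le, e, add_comm, e]
    rfl
  have hu1 := isUnit_of_tau_ne_zero hΘ' hΞ' h0
  have hu2 := isUnit_of_tau_ne_zero hΘ' hΞ' h0'
  set Yp := fun y => Ring.inverse (1 + P y * (μ • gramian Θ Ξ x)) with hYp
  set Ym := fun y => Ring.inverse (1 + P y * ((-μ) • gramian Θ Ξ x)) with hYm
  have hdiff : ∀ᶠ y in 𝓝[>] x,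
      slope (fun y => greenKernel L Θ Ξ (-μ) y y - greenKernel L Θ Ξ μ y y) x y =
      -(μ * L.C (L.expNeg x ((Yp y * Ym y) ((y - x)⁻¹ •
        (gramian Θ Ξ x - gramian Θ Ξ (x + 2 * (y - x))) ξ)))) := by
    filter_upwards [self_mem_nhdsWithin, hU _ h0, hU _ h0', (hY _ h0).1, (hY _ h0').1]
      with y hy t1 t2 t3 t4
    have hy' : x < y := hy
    have hN : gramian Θ Ξ x - gramian Θ Ξ (x + 2 * (y - x)) =
        gramian Θ Ξ x - P y * gramian Θ Ξ x * P y := by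
      rw [expNeg_gramian_expNeg hΘ hΞ hx.le (by linarith), two_mul]
    have hid := ring_resolvent_identity (a := μ • gramian Θ Ξ x) (P := P y)
      (Zp := gramianInv Θ Ξ μ x) (Zm := gramianInv Θ Ξ (-μ) x) (Yp := Yp y) (Ym := Ym y)
      (Ring.mul_inverse_cancel _ hu1)
      (by rw [sub_eq_add_neg, ← neg_smul]; exact Ring.mul_inverse_cancel _ hu2)
      (Ring.mul_inverse_cancel _ t3) (Ring.inverse_mul_cancel _ t3)
      (by rw [sub_eq_add_neg, ← mul_neg, ← neg_smul]; exact Ring.mul_inverse_cancel _ t4)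
      (by rw [sub_eq_add_neg, ← mul_neg, ← neg_smul]; exact Ring.inverse_mul_cancel _ t4)
    have hid2 := DFunLike.congr_fun hid (L.orbit x)
    have hN2 : (μ • gramian Θ Ξ x - P y * (μ • gramian Θ Ξ x) * P y) =
        μ • (gramian Θ Ξ x - gramian Θ Ξ (x + 2 * (y - x))) := by
      rw [hN, smul_sub, mul_smul_comm, smul_mul_assoc]
    rw [hN2] at hid2
    have hid3 := congrArg (fun v => L.C (L.expNeg x v)) hid2
    simp only [add_apply, sub_apply, neg_apply, mul_apply_eq_comp, map_add, map_sub, map_neg,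
      smul_apply, map_smul, smul_eq_mul] at hid3
    have hsm : ∀ v : H, L.C (L.expNeg x (Yp y (Ym y ((y - x)⁻¹ • v)))) =
        ((y - x)⁻¹ : ℝ) • L.C (L.expNeg x (Yp y (Ym y v))) := fun v => by
      simp only [ContinuousLinearMap.map_smul_of_tower]
    rw [slope_def_module, hkey _ y hy' t1 t3, hkey _ y hy' t2 t4, mul_apply_eq_comp (Yp y) (Ym y), hsm]
    simp only [mul_apply_eq_comp, greenKernel, hξ, map_add, sub_apply, map_sub, Complex.real_smul]
    simp only [sub_sub_sub_eq] at hid3 ⊢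
    linear_combination ((y - x)⁻¹ : ℝ) * hid3
  have hslope := tendsto_slope_gramian hΘ hΞ hx ξ
  have hYY : Tendsto (fun y => Yp y * Ym y) (𝓝[>] x)
      (𝓝 (gramianInv Θ Ξ μ x * gramianInv Θ Ξ (-μ) x)) := (hY _ h0).2.mul (hY _ h0').2
  rw [← hasDerivWithinAt_Ioi_iff_Ici, hasDerivWithinAt_iff_tendsto_slope' self_notMem_Ioi]
  refine (Tendsto.congr' (hdiff.mono fun _ h => h.symm)) ?_
  have hfin := (isBoundedBilinearMap_apply.continuous.tendsto
    (gramianInv Θ Ξ μ x * gramianInv Θ Ξ (-μ) x, _)).comp (hYY.prodMk_nhds hslope)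
  have hfin2 := (((L.C ∘L L.expNeg x).continuous.tendsto _).comp hfin).const_mul μ |>.neg
  -- The product of the two resolvents becomes half their sum by writing `2 = (1 + μR) + (1 - μR)`
  -- between them. This turns the limit into a perfect square.
  have hZ : (2 : ℂ) • (gramianInv Θ Ξ μ x * gramianInv Θ Ξ (-μ) x) =
      gramianInv Θ Ξ μ x + gramianInv Θ Ξ (-μ) x := by
    have e1 : gramianInv Θ Ξ μ x * (1 + μ • gramian Θ Ξ x) = 1 := Ring.inverse_mul_cancel _ hu1
    have e2 : (1 + (-μ) • gramian Θ Ξ x) * gramianInv Θ Ξ (-μ) x = 1 :=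
      Ring.mul_inverse_cancel _ hu2
    have e3 : (2 : ℂ) • (1 : H →L[ℂ] H) = (1 + μ • gramian Θ Ξ x) + (1 + (-μ) • gramian Θ Ξ x) := by
      module
    calc (2 : ℂ) • (gramianInv Θ Ξ μ x * gramianInv Θ Ξ (-μ) x)
        = gramianInv Θ Ξ μ x * ((2 : ℂ) • 1) * gramianInv Θ Ξ (-μ) x := by simp
      _ = gramianInv Θ Ξ μ x * (1 + μ • gramian Θ Ξ x) * gramianInv Θ Ξ (-μ) x +
          gramianInv Θ Ξ μ x * ((1 + (-μ) • gramian Θ Ξ x) * gramianInv Θ Ξ (-μ) x) := by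
        rw [e3]; noncomm_ring
      _ = gramianInv Θ Ξ μ x + gramianInv Θ Ξ (-μ) x := by rw [e1, e2, one_mul, mul_one, add_comm]
  have hZ' := congrArg (fun v => L.C (L.expNeg x v)) (DFunLike.congr_fun hZ (L.orbit x))
  simp only [smul_apply, add_apply, map_smul, map_add, smul_eq_mul, mul_apply_eq_comp] at hZ'
  have hval : (L.C ∘L L.expNeg x) ((gramianInv Θ Ξ μ x * gramianInv Θ Ξ (-μ) x)
      ((2 : ℝ) • (L.C (L.expNeg x ξ) • L.orbit x))) =
      (greenKernel L Θ Ξ μ x x + greenKernel L Θ Ξ (-μ) x x) ^ 2 := by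
    rw [ContinuousLinearMap.map_smul_of_tower, ContinuousLinearMap.map_smul_of_tower, map_smul,
      map_smul, ContinuousLinearMap.comp_apply, hξ, map_add, map_add, Complex.real_smul, smul_eq_mul]
    simp only [greenKernel, mul_apply_eq_comp]
    push_cast
    linear_combination (L.C (L.expNeg x (gramianInv Θ Ξ (-μ) x (L.orbit x))) +
      L.C (L.expNeg x (gramianInv Θ Ξ μ x (L.orbit x)))) * hZ'
  rw [← hval]
  exact hfin2

theorem hasDerivAt_greenKernel_sub (hΘ : L.IsObservabilityOperator Θ)
    (hΞ : L.IsControllabilityOperator Ξ) (hΘ' : IsHilbertSchmidt Θ) (hΞ' : IsHilbertSchmidt Ξ)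
    {μ : ℂ} {x : ℝ} (hx : 0 < x) (h0 : tau (shiftHankel Θ Ξ) μ x ≠ 0)
    (h0' : tau (shiftHankel Θ Ξ) (-μ) x ≠ 0) :
    HasDerivAt (fun y => greenKernel L Θ Ξ (-μ) y y - greenKernel L Θ Ξ μ y y)
      (-(μ * (greenKernel L Θ Ξ μ x x + greenKernel L Θ Ξ (-μ) x x) ^ 2)) x := by
  have h1 := continuousOn_greenKernel_diag hΘ hΞ hΘ' hΞ' μ
  have h2 := continuousOn_greenKernel_diag hΘ hΞ hΘ' hΞ' (-μ)
  exact hasDerivAt_of_hasDerivWithinAt_Ici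
    (g := fun x => -(μ * (greenKernel L Θ Ξ μ x x + greenKernel L Θ Ξ (-μ) x x) ^ 2))
    ((isOpen_setOf_tau_ne_zero hΘ' hΞ' μ).inter (isOpen_setOf_tau_ne_zero hΘ' hΞ' (-μ)))
    ((h2.mono inter_subset_right).sub (h1.mono inter_subset_left))
    (continuousOn_const.mul
      (((h1.mono inter_subset_left).add (h2.mono inter_subset_right)).pow 2)).neg
    (fun y hy => hasDerivWithinAt_greenKernel_sub hΘ hΞ hΘ' hΞ' hy.1.1 hy.1.2 hy.2.2)
    ⟨⟨hx, h0⟩, hx, h0'⟩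

end GreenKernel


/-! ### Logarithmic derivatives and the Miura transform -/

section Miura

theorem logDeriv_eq_of_hasDerivAt {f : ℝ → ℂ} {c : ℂ} {x : ℝ} (h0 : f x ≠ 0)
    (h : HasDerivAt f (c * f x) x) : logDeriv f x = c := by
  rw [logDeriv_apply, h.deriv, mul_div_assoc, div_self h0, mul_one]

variable {τ₀ τ₁ a b : ℝ → ℂ} {U : Set ℝ}

/-- With `a`, `b` the logarithmic derivatives of `τ₀`, `τ₁`, the bilinear expression is `τ₀ τ₁ ((a +
b)' + (b - a)²)`. Since `a + b` is differentiable, differentiability of `a` at `x` gives that of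
`b`, and only `a` has to be assumed differentiable there. -/
theorem isMiuraTransformAt_of_hasDerivAt (hU : IsOpen U) (h0 : ∀ s ∈ U, τ₀ s ≠ 0)
    (h1 : ∀ s ∈ U, τ₁ s ≠ 0) (ha : ∀ s ∈ U, HasDerivAt τ₀ (a s * τ₀ s) s)
    (hb : ∀ s ∈ U, HasDerivAt τ₁ (b s * τ₁ s) s)
    (hab : ∀ s ∈ U, HasDerivAt (fun s => a s + b s) (-(b s - a s) ^ 2) s) {x : ℝ} (hx : x ∈ U)
    (hd : DifferentiableAt ℝ (logDeriv τ₀) x) :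
    IsMiuraTransformAt τ₀ τ₁ (fun s => b s - a s) (fun s => a s + b s)
        (fun s => -2 * deriv (logDeriv τ₀) s) x ∧
      -2 * deriv (logDeriv τ₀) x = deriv (fun s => b s - a s) x + (b x - a x) ^ 2 := by
  have hUx : U ∈ 𝓝 x := hU.mem_nhds hx
  have hl0 : logDeriv τ₀ =ᶠ[𝓝 x] a := by
    filter_upwards [hUx] with s hs
    exact logDeriv_eq_of_hasDerivAt (h0 s hs) (ha s hs)
  have hda : HasDerivAt a (deriv a x) x := (hl0.differentiableAt_iff.1 hd).hasDerivAt
  have hdb : HasDerivAt b (-(b x - a x) ^ 2 - deriv a x) x :=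
    ((hab x hx).sub hda).congr_of_eventuallyEq (Eventually.of_forall fun s => by simp)
  have hdv : HasDerivAt (fun s => b s - a s) (-(b x - a x) ^ 2 - deriv a x - deriv a x) x :=
    hdb.sub hda
  have hd0 : deriv τ₀ =ᶠ[𝓝 x] fun s => a s * τ₀ s := by
    filter_upwards [hUx] with s hs using (ha s hs).deriv
  have hd1 : deriv τ₁ =ᶠ[𝓝 x] fun s => b s * τ₁ s := by
    filter_upwards [hUx] with s hs using (hb s hs).deriv
  have hdd0 := (hda.mul (ha x hx)).congr_of_eventuallyEq hd0
  have hdd1 := (hdb.mul (hb x hx)).congr_of_eventuallyEq hd1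
  refine ⟨⟨⟨h0 x hx, h1 x hx⟩, ?_, ⟨hdd0.differentiableAt, hdd1.differentiableAt⟩, ?_, ?_, rfl, ?_⟩,
    ?_⟩
  · filter_upwards [hUx] with s hs using ⟨(ha s hs).differentiableAt, (hb s hs).differentiableAt⟩
  · filter_upwards [hUx] with s hs
    rw [logDeriv_div _ (h1 s hs) (h0 s hs) (hb s hs).differentiableAt (ha s hs).differentiableAt,
      logDeriv_eq_of_hasDerivAt (h0 s hs) (ha s hs), logDeriv_eq_of_hasDerivAt (h1 s hs) (hb s hs)]
  · filter_upwards [hUx] with s hs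
    rw [logDeriv_mul _ (h0 s hs) (h1 s hs) (ha s hs).differentiableAt (hb s hs).differentiableAt,
      logDeriv_eq_of_hasDerivAt (h0 s hs) (ha s hs), logDeriv_eq_of_hasDerivAt (h1 s hs) (hb s hs)]
  · rw [hdd0.deriv, hdd1.deriv, (ha x hx).deriv, (hb x hx).deriv]
    ring
  · rw [hl0.deriv_eq, hdv.deriv]
    ring

end Miura

/-! ### Solution of the Gelfand-Levitan equation and its diagonal values -/

section GelfandLevitan

variable {H : Type*} [NormedAddCommGroup H] [InnerProductSpace ℂ H] [CompleteSpace H]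
  {L : LinearSystem H ℂ} {Θ Ξ : L2 ℂ →L[ℂ] H}

/-- The diagonal entry of the solution of the Gelfand-Levitan equation. -/
def glDiag (L : LinearSystem H ℂ) (Θ Ξ : L2 ℂ →L[ℂ] H) (μ : ℂ) (x y : ℝ) : ℂ :=
  (greenKernel L Θ Ξ (-μ) x y - greenKernel L Θ Ξ μ x y) / 2

/-- The off-diagonal entry of the solution of the Gelfand-Levitan equation. -/
def glOffDiag (L : LinearSystem H ℂ) (Θ Ξ : L2 ℂ →L[ℂ] H) (μ : ℂ) (x y : ℝ) : ℂ :=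
  -(greenKernel L Θ Ξ μ x y + greenKernel L Θ Ξ (-μ) x y) / 2

theorem setOf_tauSq_ne_zero (hΘ : IsHilbertSchmidt Θ) (hΞ : IsHilbertSchmidt Ξ) (μ : ℂ) :
    {x : ℝ | 0 < x ∧ tauSq (shiftHankel Θ Ξ) μ x ≠ 0} =
      {x : ℝ | 0 < x ∧ tau (shiftHankel Θ Ξ) μ x ≠ 0} ∩
        {x : ℝ | 0 < x ∧ tau (shiftHankel Θ Ξ) (-μ) x ≠ 0} := by
  ext x
  simp only [mem_inter_iff, mem_ofPred_eq, tauSq_eq_mul hΘ hΞ, mul_ne_zero_iff]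
  tauto

/-- Half-sums and half-differences of the scalar equations for `μ` and `-μ` give the two distinct
entries of the matrix equation. -/
theorem solvesGelfandLevitan (hΘ : L.IsObservabilityOperator Θ)
    (hΞ : L.IsControllabilityOperator Ξ) (hΘ' : IsHilbertSchmidt Θ) (hΞ' : IsHilbertSchmidt Ξ)
    (μ : ℂ) :
    SolvesGelfandLevitan μ (fun s => !![0, L.phi s; L.phi s, 0])
      {x : ℝ | 0 < x ∧ tauSq (shiftHankel Θ Ξ) μ x ≠ 0}
      (fun x y => !![glDiag L Θ Ξ μ x y, glOffDiag L Θ Ξ μ x y;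
        glOffDiag L Θ Ξ μ x y, glDiag L Θ Ξ μ x y]) := by
  rw [setOf_tauSq_ne_zero hΘ' hΞ']
  have hint : ∀ x ∈ {x : ℝ | 0 < x ∧ tau (shiftHankel Θ Ξ) μ x ≠ 0} ∩
      {x : ℝ | 0 < x ∧ tau (shiftHankel Θ Ξ) (-μ) x ≠ 0}, ∀ y, x ≤ y →
      (IntegrableOn (fun z => glDiag L Θ Ξ μ x z * L.phi (z + y)) (Ioi x) ∧
        glOffDiag L Θ Ξ μ x y + L.phi (x + y) +
          μ * ∫ z in Ioi x, glDiag L Θ Ξ μ x z * L.phi (z + y) = 0) ∧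
      IntegrableOn (fun z => glOffDiag L Θ Ξ μ x z * L.phi (z + y)) (Ioi x) ∧
        glDiag L Θ Ξ μ x y + μ * ∫ z in Ioi x, glOffDiag L Θ Ξ μ x z * L.phi (z + y) = 0 := by
    rintro x ⟨⟨hx, h0⟩, -, h0'⟩ y hxy
    obtain ⟨i1, e1⟩ := greenKernel_equation hΘ hΞ hΘ' hΞ' hx h0 hxy
    obtain ⟨i2, e2⟩ := greenKernel_equation hΘ hΞ hΘ' hΞ' hx h0' hxy
    have f1 : ∀ z, glDiag L Θ Ξ μ x z * L.phi (z + y) =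
        (greenKernel L Θ Ξ (-μ) x z * L.phi (z + y) - greenKernel L Θ Ξ μ x z * L.phi (z + y)) / 2 :=
      fun z => by rw [glDiag]; ring
    have f2 : ∀ z, glOffDiag L Θ Ξ μ x z * L.phi (z + y) =
        -(greenKernel L Θ Ξ μ x z * L.phi (z + y) + greenKernel L Θ Ξ (-μ) x z * L.phi (z + y)) / 2 :=
      fun z => by rw [glOffDiag]; ring
    simp only [f1, f2]
    refine ⟨⟨(i2.sub i1).div_const 2, ?_⟩, (i1.add i2).neg.div_const 2, ?_⟩
    · rw [integral_div, integral_sub i2 i1, glOffDiag]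
      linear_combination (-1 / 2 : ℂ) * e1 - (1 / 2 : ℂ) * e2
    · rw [integral_div, integral_neg, integral_add i1 i2, glDiag]
      linear_combination (-1 / 2 : ℂ) * e1 + (1 / 2 : ℂ) * e2
  set S := {p : ℝ × ℝ | p.1 ∈ {x : ℝ | 0 < x ∧ tau (shiftHankel Θ Ξ) μ x ≠ 0} ∩
    {x : ℝ | 0 < x ∧ tau (shiftHankel Θ Ξ) (-μ) x ≠ 0} ∧ p.1 ≤ p.2}
  have hk1 : ContinuousOn (fun p : ℝ × ℝ => greenKernel L Θ Ξ μ p.1 p.2) S :=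
    (continuousOn_greenKernel hΘ hΞ hΘ' hΞ' μ).mono fun p hp => ⟨hp.1.1, hp.2⟩
  have hk2 : ContinuousOn (fun p : ℝ × ℝ => greenKernel L Θ Ξ (-μ) p.1 p.2) S :=
    (continuousOn_greenKernel hΘ hΞ hΘ' hΞ' (-μ)).mono fun p hp => ⟨hp.1.2, hp.2⟩
  have hcd := (hk2.sub hk1).div_const 2
  have hco := (hk1.add hk2).neg.div_const 2
  constructor
  · refine continuousOn_pi.2 fun i => continuousOn_pi.2 fun j => ?_
    fin_cases i <;> fin_cases j <;> first | exact hcd | exact hco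
  · intro x hx y hxy i j
    obtain ⟨⟨i1, -⟩, i2, -⟩ := hint x hx y hxy
    fin_cases i <;> fin_cases j <;> simp [Matrix.mul_apply, Fin.sum_univ_two, i1, i2]
  · intro x hx y hxy i j
    obtain ⟨⟨-, e1⟩, -, e2⟩ := hint x hx y hxy
    fin_cases i <;> fin_cases j <;> simp [Matrix.mul_apply, Fin.sum_univ_two, e1, e2]

theorem hasDerivAt_glDiag (hΘ : L.IsObservabilityOperator Θ)
    (hΞ : L.IsControllabilityOperator Ξ) (hΘ' : IsHilbertSchmidt Θ) (hΞ' : IsHilbertSchmidt Ξ)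
    {μ : ℂ} {x : ℝ} (hx : 0 < x ∧ tauSq (shiftHankel Θ Ξ) μ x ≠ 0) :
    HasDerivAt (fun s => glDiag L Θ Ξ μ s s) (-(2 * μ * glOffDiag L Θ Ξ μ x x ^ 2)) x := by
  obtain ⟨⟨h, h0⟩, -, h0'⟩ := (setOf_tauSq_ne_zero hΘ' hΞ' μ).subset hx
  refine ((hasDerivAt_greenKernel_sub hΘ hΞ hΘ' hΞ' h h0 h0').div_const 2).congr_deriv ?_
  rw [glOffDiag]
  ring

theorem hasDerivAt_tau_pos (hΘ : L.IsObservabilityOperator Θ)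
    (hΞ : L.IsControllabilityOperator Ξ) (hΘ' : IsHilbertSchmidt Θ) (hΞ' : IsHilbertSchmidt Ξ)
    {μ : ℂ} {x : ℝ} (hx : 0 < x ∧ tauSq (shiftHankel Θ Ξ) μ x ≠ 0) :
    tau (shiftHankel Θ Ξ) μ x ≠ 0 ∧ HasDerivAt (tau (shiftHankel Θ Ξ) μ)
      (μ * (glDiag L Θ Ξ μ x x + glOffDiag L Θ Ξ μ x x) * tau (shiftHankel Θ Ξ) μ x) x := by
  obtain ⟨⟨h, h0⟩, -, -⟩ := (setOf_tauSq_ne_zero hΘ' hΞ' μ).subset hx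
  refine ⟨h0, (hasDerivAt_tau hΘ hΞ hΘ' hΞ' h h0).congr_deriv ?_⟩
  rw [glDiag, glOffDiag]
  ring

theorem hasDerivAt_tau_neg (hΘ : L.IsObservabilityOperator Θ)
    (hΞ : L.IsControllabilityOperator Ξ) (hΘ' : IsHilbertSchmidt Θ) (hΞ' : IsHilbertSchmidt Ξ)
    {μ : ℂ} {x : ℝ} (hx : 0 < x ∧ tauSq (shiftHankel Θ Ξ) μ x ≠ 0) :
    tau (shiftHankel Θ Ξ) (-μ) x ≠ 0 ∧ HasDerivAt (tau (shiftHankel Θ Ξ) (-μ))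
      (μ * (glDiag L Θ Ξ μ x x - glOffDiag L Θ Ξ μ x x) * tau (shiftHankel Θ Ξ) (-μ) x) x := by
  obtain ⟨-, h, h0⟩ := (setOf_tauSq_ne_zero hΘ' hΞ' μ).subset hx
  refine ⟨h0, (hasDerivAt_tau hΘ hΞ hΘ' hΞ' h h0).congr_deriv ?_⟩
  rw [glDiag, glOffDiag]
  ring

theorem gelfandLevitan_diagonal (hΘ : L.IsObservabilityOperator Θ)
    (hΞ : L.IsControllabilityOperator Ξ) (hΘ' : IsHilbertSchmidt Θ) (hΞ' : IsHilbertSchmidt Ξ)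
    {μ : ℂ} (hμ : μ ≠ 0) {x : ℝ} (hx : 0 < x ∧ tauSq (shiftHankel Θ Ξ) μ x ≠ 0) :
    (DifferentiableAt ℝ (tauSq (shiftHankel Θ Ξ) μ) x ∧
      glDiag L Θ Ξ μ x x = 1 / (2 * μ) * logDeriv (tauSq (shiftHankel Θ Ξ) μ) x) ∧
    (tau (shiftHankel Θ Ξ) μ x ≠ 0 ∧ tau (shiftHankel Θ Ξ) (-μ) x ≠ 0 ∧
      DifferentiableAt ℝ (tau (shiftHankel Θ Ξ) μ) x ∧
      DifferentiableAt ℝ (tau (shiftHankel Θ Ξ) (-μ)) x ∧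
      glOffDiag L Θ Ξ μ x x = 1 / (2 * μ) *
        logDeriv (fun s => tau (shiftHankel Θ Ξ) μ s / tau (shiftHankel Θ Ξ) (-μ) s) x) ∧
    (DifferentiableAt ℝ (fun s => glDiag L Θ Ξ μ s s) x ∧
      1 / (2 * μ) * deriv (fun s => glDiag L Θ Ξ μ s s) x = -(glOffDiag L Θ Ξ μ x x) ^ 2) := by
  obtain ⟨p0, dp⟩ := hasDerivAt_tau_pos hΘ hΞ hΘ' hΞ' hx
  obtain ⟨m0, dm⟩ := hasDerivAt_tau_neg hΘ hΞ hΘ' hΞ' hx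
  have hsq : tauSq (shiftHankel Θ Ξ) μ =
      fun s => tau (shiftHankel Θ Ξ) μ s * tau (shiftHankel Θ Ξ) (-μ) s :=
    funext fun s => tauSq_eq_mul hΘ' hΞ' μ s
  have dW := hasDerivAt_glDiag hΘ hΞ hΘ' hΞ' hx
  refine ⟨⟨?_, ?_⟩, ⟨p0, m0, dp.differentiableAt, dm.differentiableAt, ?_⟩, dW.differentiableAt, ?_⟩
  · rw [hsq]
    exact dp.differentiableAt.mul dm.differentiableAt
  · rw [hsq, logDeriv_mul _ p0 m0 dp.differentiableAt dm.differentiableAt,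
      logDeriv_eq_of_hasDerivAt p0 dp, logDeriv_eq_of_hasDerivAt m0 dm]
    field_simp
    ring
  · rw [logDeriv_div _ p0 m0 dp.differentiableAt dm.differentiableAt,
      logDeriv_eq_of_hasDerivAt p0 dp, logDeriv_eq_of_hasDerivAt m0 dm]
    field_simp
    ring
  · rw [dW.deriv]
    field_simp

/-- Near `x`, `(log τ₀)' = (W - V)/2`, so `V + 2 (log τ₀)'` is `W`, whose derivative is `-V²`. As
`W` is differentiable, `V` and `(log τ₀)'` are differentiable at the same points. -/
theorem miura_transform (hΘ : L.IsObservabilityOperator Θ)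
    (hΞ : L.IsControllabilityOperator Ξ) (hΘ' : IsHilbertSchmidt Θ) (hΞ' : IsHilbertSchmidt Ξ)
    {x : ℝ} (hx : 0 < x ∧ tauSq (shiftHankel Θ Ξ) (1 / 2) x ≠ 0) :
    HasDerivAt (fun s => glOffDiag L Θ Ξ (1 / 2) s s +
        2 * logDeriv (tau (shiftHankel Θ Ξ) (-(1 / 2))) s) (-(glOffDiag L Θ Ξ (1 / 2) x x) ^ 2) x ∧
    (DifferentiableAt ℝ (logDeriv (tau (shiftHankel Θ Ξ) (-(1 / 2)))) x ↔
      DifferentiableAt ℝ (fun s => glOffDiag L Θ Ξ (1 / 2) s s) x) ∧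
    (DifferentiableAt ℝ (logDeriv (tau (shiftHankel Θ Ξ) (-(1 / 2)))) x →
      IsMiuraTransformAt (tau (shiftHankel Θ Ξ) (-(1 / 2))) (tau (shiftHankel Θ Ξ) (1 / 2))
        (fun s => glOffDiag L Θ Ξ (1 / 2) s s) (fun s => glDiag L Θ Ξ (1 / 2) s s)
        (fun s => -2 * deriv (logDeriv (tau (shiftHankel Θ Ξ) (-(1 / 2)))) s) x ∧
      -2 * deriv (logDeriv (tau (shiftHankel Θ Ξ) (-(1 / 2)))) x =
        deriv (fun s => glOffDiag L Θ Ξ (1 / 2) s s) x + (glOffDiag L Θ Ξ (1 / 2) x x) ^ 2) := by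
  set U := {x : ℝ | 0 < x ∧ tauSq (shiftHankel Θ Ξ) (1 / 2) x ≠ 0} with hUdef
  have hU : IsOpen U := by
    rw [hUdef, setOf_tauSq_ne_zero hΘ' hΞ']
    exact (isOpen_setOf_tau_ne_zero hΘ' hΞ' _).inter (isOpen_setOf_tau_ne_zero hΘ' hΞ' _)
  have hUx : U ∈ 𝓝 x := hU.mem_nhds hx
  have hl : ∀ᶠ s in 𝓝 x, logDeriv (tau (shiftHankel Θ Ξ) (-(1 / 2))) s =
      1 / 2 * (glDiag L Θ Ξ (1 / 2) s s - glOffDiag L Θ Ξ (1 / 2) s s) := by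
    filter_upwards [hUx] with s hs
    obtain ⟨m0, dm⟩ := hasDerivAt_tau_neg hΘ hΞ hΘ' hΞ' hs
    exact logDeriv_eq_of_hasDerivAt m0 dm
  have dW : ∀ s ∈ U, HasDerivAt (fun s => glDiag L Θ Ξ (1 / 2) s s)
      (-(glOffDiag L Θ Ξ (1 / 2) s s) ^ 2) s := fun s hs =>
    (hasDerivAt_glDiag hΘ hΞ hΘ' hΞ' hs).congr_deriv (by ring)
  refine ⟨(dW x hx).congr_of_eventuallyEq ?_, ?_, fun hd => ?_⟩
  · filter_upwards [hl] with s hs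
    rw [hs]
    ring
  · rw [EventuallyEq.differentiableAt_iff (f₁ := fun s => 1 / 2 * (glDiag L Θ Ξ (1 / 2) s s -
      glOffDiag L Θ Ξ (1 / 2) s s)) hl]
    constructor
    · intro h
      refine ((dW x hx).differentiableAt.sub (h.const_mul 2)).congr_of_eventuallyEq
        (Eventually.of_forall fun s => ?_)
      simp
    · exact fun h => ((dW x hx).differentiableAt.sub h).const_mul _
  · have e1 : ∀ s, 1 / 2 * (glDiag L Θ Ξ (1 / 2) s s + glOffDiag L Θ Ξ (1 / 2) s s) -
        1 / 2 * (glDiag L Θ Ξ (1 / 2) s s - glOffDiag L Θ Ξ (1 / 2) s s) =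
        glOffDiag L Θ Ξ (1 / 2) s s := fun s => by ring
    have e2 : ∀ s, 1 / 2 * (glDiag L Θ Ξ (1 / 2) s s - glOffDiag L Θ Ξ (1 / 2) s s) +
        1 / 2 * (glDiag L Θ Ξ (1 / 2) s s + glOffDiag L Θ Ξ (1 / 2) s s) =
        glDiag L Θ Ξ (1 / 2) s s := fun s => by ring
    have := isMiuraTransformAt_of_hasDerivAt hU
      (fun s hs => (hasDerivAt_tau_neg hΘ hΞ hΘ' hΞ' hs).1)
      (fun s hs => (hasDerivAt_tau_pos hΘ hΞ hΘ' hΞ' hs).1)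
      (fun s hs => (hasDerivAt_tau_neg hΘ hΞ hΘ' hΞ' hs).2)
      (fun s hs => (hasDerivAt_tau_pos hΘ hΞ hΘ' hΞ' hs).2)
      (fun s hs => by simpa only [e1, e2] using dW s hs) hx hd
    simpa only [e1, e2] using this

end GelfandLevitan


/-! ### Symmetry of the spectrum of Hankel operators -/

section SpectralSymmetry

open ContinuousLinearMap (adjoint)

variable {E : Type*} [NormedAddCommGroup E] [InnerProductSpace ℂ E] [CompleteSpace E]

/-- A single linear condition costs at most one dimension; this is the source of the `+ 1` in the
comparison of multiplicities. -/
theorem finrank_le_finrank_inf_ker_add_one {K : Type*} [Field K] {M : Type*} [AddCommGroup M]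
    [Module K M] (S : Submodule K M) [FiniteDimensional K S] (φ : M →ₗ[K] K) :
    Module.finrank K S ≤ Module.finrank K (S ⊓ φ.ker : Submodule K M) + 1 := by
  have h1 := LinearMap.finrank_range_add_finrank_ker (φ ∘ₗ S.subtype)
  have h2 : Module.finrank K (φ ∘ₗ S.subtype).range ≤ 1 :=
    (Submodule.finrank_le _).trans (Module.finrank_self K).le
  have h3 : Module.finrank K (φ ∘ₗ S.subtype).ker =
      Module.finrank K (S ⊓ φ.ker : Submodule K M) := by
    rw [← Submodule.map_comap_subtype, Submodule.finrank_map_subtype_eq, LinearMap.ker_comp]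
  omega

variable {Γ V : E →L[ℂ] E} {e : E}

/-- Let `V` be an isometry with one-dimensional cokernel, and let `Γ` be a self-adjoint operator
with `Γ V = V† Γ`. Then the multiplicities of the eigenvalues `l` and `-l` of `Γ` differ at most
by one. -/
theorem finrank_eigenspace_le_finrank_eigenspace_neg_add_one (hΓ : IsSelfAdjoint Γ)
    (hV : adjoint V * V = 1) (hΓV : Γ * V = adjoint V * Γ) (he : adjoint V e = 0)
    (hker : ∀ k, adjoint V k = 0 → ∃ c : ℂ, k = c • e) (hV2 : ∀ g, V (V g) = g → g = 0)
    {l : ℂ}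
    [FiniteDimensional ℂ (Module.End.eigenspace (Γ : Module.End ℂ E) l)]
    [FiniteDimensional ℂ (Module.End.eigenspace (Γ : Module.End ℂ E) (-l))] :
    Module.finrank ℂ (Module.End.eigenspace (Γ : Module.End ℂ E) l) ≤
      Module.finrank ℂ (Module.End.eigenspace (Γ : Module.End ℂ E) (-l)) + 1 := by
  set S := Module.End.eigenspace (Γ : Module.End ℂ E) l with hS
  have hmem : ∀ {z : ℂ} {f : E}, f ∈ Module.End.eigenspace (Γ : Module.End ℂ E) z ↔
      Γ f = z • f := Module.End.mem_eigenspace_iff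
  have hVV : ∀ f, adjoint V (V f) = f := fun f => DFunLike.congr_fun hV f
  have hΓVf : ∀ f, Γ (V f) = adjoint V (Γ f) := fun f => DFunLike.congr_fun hΓV f
  have hsymm : ∀ f g, inner ℂ (Γ f) g = inner ℂ f (Γ g) := fun f g => by
    rw [← ContinuousLinearMap.adjoint_inner_left, hΓ.adjoint_eq]
  -- the defect
  have hdef : ∀ f, adjoint V (f - V (adjoint V f)) = 0 := fun f => by
    rw [map_sub, hVV, sub_self]
  have hdef0 : ∀ f, inner ℂ e f = 0 → f = V (adjoint V f) := fun f hf => by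
    obtain ⟨c, hc⟩ := hker _ (hdef f)
    have h1 : inner ℂ e (f - V (adjoint V f)) = 0 := by
      rw [inner_sub_right, hf, ← ContinuousLinearMap.adjoint_inner_left, he, inner_zero_left,
        sub_zero]
    rw [← sub_eq_zero, ← inner_self_eq_zero (𝕜 := ℂ)]
    nth_rewrite 1 [hc]
    rw [inner_smul_left, h1, mul_zero]
  -- the main step
  have main : ∀ f ∈ S, inner ℂ e f = 0 → inner ℂ e (Γ (adjoint V f)) = 0 →
      V f - adjoint V f ∈ Module.End.eigenspace (Γ : Module.End ℂ E) (-l) := fun f hf h1 h2 => by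
    have h3 := hdef0 _ h1
    -- On vectors orthogonal to `e`, `V V†` is the identity. Hence `V† Γ V† f = Γ f = l f`, then `Γ
    -- V† f = l V f`, while `Γ V f = V† Γ f = l V† f`: so `V f - V† f` is an eigenvector for `-l` or
    -- zero.
    have h4 : adjoint V (Γ (adjoint V f)) = l • f := by
      rw [← hΓVf, ← h3]; exact hmem.1 hf
    have h5 := hdef0 _ h2
    rw [h4, map_smul] at h5
    rw [hmem, map_sub, hΓVf, hmem.1 hf, h5, map_smul]
    module
  have hinj : ∀ f, inner ℂ e f = 0 → V f - adjoint V f = 0 → f = 0 := fun f h1 h2 => by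
    have h3 := hdef0 _ h1
    have h4 : V (V (adjoint V f)) = adjoint V f := by rw [← h3, ← sub_eq_zero, h2]
    rw [h3, hV2 _ h4, map_zero]
  have finish : ∀ φ : E →ₗ[ℂ] ℂ, (∀ f ∈ S, φ f = 0 →
      inner ℂ e f = 0 ∧ inner ℂ e (Γ (adjoint V f)) = 0) →
      Module.finrank ℂ S ≤
        Module.finrank ℂ (Module.End.eigenspace (Γ : Module.End ℂ E) (-l)) + 1 := fun φ hφ => by
    refine (finrank_le_finrank_inf_ker_add_one S φ).trans (Nat.add_le_add_right ?_ 1)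
    let ψ : (S ⊓ φ.ker : Submodule ℂ E) →ₗ[ℂ]
        Module.End.eigenspace (Γ : Module.End ℂ E) (-l) :=
      LinearMap.restrict (V - adjoint V : E →L[ℂ] E).toLinearMap fun f hf =>
        main f hf.1 (hφ f hf.1 hf.2).1 (hφ f hf.1 hf.2).2
    refine LinearMap.finrank_le_finrank_of_injective (f := ψ) ?_
    rw [← LinearMap.ker_eq_bot, LinearMap.ker_eq_bot']
    rintro ⟨f, hf⟩ h0
    have h1 : V f - adjoint V f = 0 := congrArg Subtype.val h0
    exact Subtype.ext (hinj f (hφ f hf.1 hf.2).1 h1)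
  -- Two linear conditions are needed but only one dimension may be lost. Either the first holds on
  -- all of `S`, or an eigenvector `F` with `⟨e, F⟩ ≠ 0` shows that the first implies the second:
  -- the defect `Γ V† f - l V f = c e` is orthogonal to `F`, so `c = 0`.
  by_cases hcase : ∀ F ∈ S, inner ℂ e F = 0
  · exact finish ((innerSL ℂ e ∘L Γ ∘L adjoint V).toLinearMap) fun f hf h => ⟨hcase f hf, h⟩
  · push Not at hcase
    obtain ⟨F, hF, hFe⟩ := hcase
    refine finish (innerSL ℂ e).toLinearMap fun f hf h => ⟨h, ?_⟩
    have h3 := hdef0 _ h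
    have h4 : adjoint V (Γ (adjoint V f)) = l • f := by
      rw [← hΓVf, ← h3]; exact hmem.1 hf
    obtain ⟨c, hc⟩ := hker _ (hdef (Γ (adjoint V f)))
    rw [h4, map_smul] at hc
    have hlre : (starRingEnd ℂ) l = l := by
      have h5 := hsymm F F
      rw [hmem.1 hF, inner_smul_left, inner_smul_right] at h5
      refine mul_right_cancel₀ (fun h6 => hFe ?_) h5
      rw [inner_self_eq_zero.1 h6, inner_zero_right]
    have h6 : inner ℂ F (Γ (adjoint V f) - l • V f) = 0 := by
      have h7 : inner ℂ F (Γ (V f)) = l * inner ℂ F (V f) := by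
        rw [← hsymm, hmem.1 hF, inner_smul_left, hlre]
      have h8 : inner ℂ F (Γ (adjoint V f)) = l * inner ℂ F (adjoint V f) := by
        rw [← hsymm, hmem.1 hF, inner_smul_left, hlre]
      rw [hΓVf, hmem.1 hf, map_smul, inner_smul_right] at h7
      rw [inner_sub_right, inner_smul_right, h8, h7, sub_self]
    rw [hc, inner_smul_right, mul_eq_zero] at h6
    rcases h6 with h6 | h6
    · rw [h6, zero_smul, sub_eq_zero] at hc
      rw [hc, inner_smul_right, ← ContinuousLinearMap.adjoint_inner_left, he, inner_zero_left,
        mul_zero]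
    · exact absurd (inner_eq_zero_symm.1 h6) hFe

end SpectralSymmetry


/-! ### The cogenerator of a contraction semigroup -/

section Semigroup

variable {E : Type*} [NormedAddCommGroup E] [InnerProductSpace ℂ E]

/-- Strongly continuous semigroups of contractions. Only the orbits on `[0, ∞)` are constrained by
the semigroup law, but they are the restrictions of continuous functions on the line. -/
structure IsContractionSemigroup (T : ℝ → E →L[ℂ] E) : Prop where
  continuous : ∀ h, Continuous fun t => T t h
  norm_le : ∀ t h, ‖T t h‖ ≤ ‖h‖
  zero : ∀ h, T 0 h = h
  add : ∀ s t, 0 ≤ s → 0 ≤ t → ∀ h, T s (T t h) = T (s + t) h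

namespace IsContractionSemigroup

variable {T : ℝ → E →L[ℂ] E} (hT : IsContractionSemigroup T)
include hT

theorem continuous_orbit (h : E) : Continuous fun t => Real.exp (-t / 2) • T t h :=
  (by fun_prop : Continuous fun t : ℝ => Real.exp (-t / 2)).smul (hT.continuous h)

theorem integrable_orbit (h : E) : IntegrableOn (fun t => Real.exp (-t / 2) • T t h) (Ioi 0) := by
  have h1 : IntegrableOn (fun t : ℝ => Real.exp (-(1 / 2) * t) * ‖h‖) (Ioi 0) :=
    (exp_neg_integrableOn_Ioi 0 (by norm_num)).mul_const _
  refine h1.mono' (hT.continuous_orbit h).aestronglyMeasurable (Eventually.of_forall fun t => ?_)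
  rw [norm_smul, Real.norm_of_nonneg (Real.exp_pos _).le,
    show -t / 2 = -(1 / 2) * t by ring]
  exact mul_le_mul_of_nonneg_left (hT.norm_le t h) (Real.exp_pos _).le

omit hT in
/-- The operator `∫₀^∞ e^{-t/2} T t dt`. -/
def resolvent (hT : IsContractionSemigroup T) : E →L[ℂ] E :=
  LinearMap.mkContinuous
    { toFun := fun h => ∫ t in Ioi (0 : ℝ), Real.exp (-t / 2) • T t h
      map_add' := fun f g => by
        rw [← integral_add (hT.integrable_orbit f) (hT.integrable_orbit g)]
        simp only [map_add, smul_add]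
      map_smul' := fun c f => by
        rw [RingHom.id_apply, ← integral_smul]
        simp only [map_smul, smul_comm c] }
    2 fun h => by
      have h1 : IntegrableOn (fun t : ℝ => Real.exp (-(1 / 2) * t) * ‖h‖) (Ioi 0) :=
        (exp_neg_integrableOn_Ioi 0 (by norm_num)).mul_const _
      refine (norm_integral_le_of_norm_le h1 (Eventually.of_forall fun t => ?_)).trans_eq ?_
      · rw [norm_smul, Real.norm_of_nonneg (Real.exp_pos _).le,
          show -t / 2 = -(1 / 2) * t by ring]
        exact mul_le_mul_of_nonneg_left (hT.norm_le t h) (Real.exp_pos _).le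
      · rw [integral_mul_const, integral_exp_mul_Ioi (by norm_num)]
        norm_num

theorem resolvent_apply (h : E) :
    hT.resolvent h = ∫ t in Ioi (0 : ℝ), Real.exp (-t / 2) • T t h := rfl

variable [CompleteSpace E]

/-- `e^{-s/2} T_s R h = R h - ∫₀ˢ e^{-t/2} T_t h dt`. -/
theorem smul_apply_resolvent {s : ℝ} (hs : 0 ≤ s) (h : E) :
    Real.exp (-s / 2) • T s (hT.resolvent h) =
      hT.resolvent h - ∫ t in 0..s, Real.exp (-t / 2) • T t h := by
  have hint := hT.integrable_orbit h
  have h1 : Real.exp (-s / 2) • T s (hT.resolvent h) =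
      ∫ t in Ioi s, Real.exp (-t / 2) • T t h := by
    rw [resolvent_apply, ← ContinuousLinearMap.integral_comp_comm _ hint, ← integral_smul,
      ← setIntegral_Ioi_comp_add (fun t => Real.exp (-t / 2) • T t h)]
    refine setIntegral_congr_fun measurableSet_Ioi fun t ht => ?_
    simp only [ContinuousLinearMap.map_smul_of_tower]
    rw [hT.add s t hs (le_of_lt ht), smul_smul, ← Real.exp_add, add_comm s t]
    congr 2
    ring
  rw [h1, eq_sub_iff_add_eq, add_comm, intervalIntegral.integral_of_le hs, resolvent_apply,
    ← setIntegral_union (Ioc_disjoint_Ioi le_rfl) measurableSet_Ioi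
      (hint.mono_set Ioc_subset_Ioi_self) (hint.mono_set (Ioi_subset_Ioi hs)),
    Ioc_union_Ioi_eq_Ioi hs]

theorem hasDerivAt_integral_orbit (h : E) (s : ℝ) :
    HasDerivAt (fun s => ∫ t in 0..s, Real.exp (-t / 2) • T t h) (Real.exp (-s / 2) • T s h) s :=
  (hT.continuous_orbit h).integral_hasStrictDerivAt 0 s |>.hasDerivAt

/-- If `R h = 0`, the integrals of the orbit over `[0, s]` all vanish, and their right derivative at
zero is `h`. -/
theorem eq_zero_of_resolvent_eq_zero {h : E} (h0 : hT.resolvent h = 0) : h = 0 := by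
  have h1 : HasDerivWithinAt (fun s => ∫ t in 0..s, Real.exp (-t / 2) • T t h) h (Ici 0) 0 := by
    simpa [hT.zero] using (hT.hasDerivAt_integral_orbit h 0).hasDerivWithinAt (s := Ici 0)
  have h2 : HasDerivWithinAt (fun s => ∫ t in 0..s, Real.exp (-t / 2) • T t h) 0 (Ici 0) 0 := by
    refine (hasDerivWithinAt_const _ _ (0 : E)).congr_of_mem (fun s hs => ?_) self_mem_Ici
    have h3 := hT.smul_apply_resolvent hs h
    rw [h0, map_zero, smul_zero, zero_sub] at h3
    exact neg_eq_zero.1 h3.symm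
  exact (uniqueDiffWithinAt_Ici 0).eq_deriv _ h1 h2

/-- An eigenvector of the resolvent is one of the semigroup: the relation for `R h` becomes a
first-order linear equation for the integrated orbit, solved with the integrating factor `exp (r /
c)`. -/
theorem apply_eq_of_resolvent_eq {h : E} {c : ℝ} (hc : c ≠ 0) (h0 : hT.resolvent h = c • h) {s : ℝ}
    (hs : 0 ≤ s) : T s h = Real.exp (s / 2 - s / c) • h := by
  set Y : ℝ → E := fun s => ∫ t in 0..s, Real.exp (-t / 2) • T t h with hY
  have hrel : ∀ r, 0 ≤ r → Real.exp (-r / 2) • T r h = h - c⁻¹ • Y r := fun r hr => by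
    have h3 := hT.smul_apply_resolvent hr h
    rw [h0, ContinuousLinearMap.map_smul_of_tower, smul_comm] at h3
    rw [← inv_smul_smul₀ hc (Real.exp (-r / 2) • T r h), h3, smul_sub, inv_smul_smul₀ hc]
  have hder : ∀ r ∈ Ico 0 s, HasDerivWithinAt (fun r => Real.exp (r / c) • (h - c⁻¹ • Y r)) 0
      (Ici r) r := fun r hr => by
    have h1 : HasDerivAt (fun r => Real.exp (r / c)) (Real.exp (r / c) * (1 / c)) r :=
      ((hasDerivAt_id r).div_const c).exp
    have h2 := h1.smul (((hT.hasDerivAt_integral_orbit h r).const_smul c⁻¹).const_sub h)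
    refine HasDerivAt.hasDerivWithinAt (h2.congr_deriv ?_)
    simp only [hrel r hr.1, hY, Pi.smul_apply]
    module
  have hcont : ContinuousOn (fun r => Real.exp (r / c) • (h - c⁻¹ • Y r)) (Icc 0 s) := by
    have hYc : Continuous Y := continuous_iff_continuousAt.2 fun r =>
      (hT.hasDerivAt_integral_orbit h r).continuousAt
    fun_prop
  have h4 := constant_of_has_deriv_right_zero hcont hder s ⟨hs, le_rfl⟩
  have h5 : Y 0 = 0 := intervalIntegral.integral_same
  rw [← hrel s hs, h5, smul_smul, ← Real.exp_add, zero_div, Real.exp_zero, smul_zero, sub_zero,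
    one_smul] at h4
  nth_rewrite 2 [← h4]
  rw [smul_smul, ← Real.exp_add]
  ring_nf
  simp

/-- With weight `e^{-t/2}`, `1 - R` is the Cayley transform `(G + 1/2)(G - 1/2)⁻¹` of the generator
`G`, hence isometric for a semigroup of isometries. -/
theorem norm_sub_resolvent (hiso : ∀ t, 0 ≤ t → ∀ h, ‖T t h‖ = ‖h‖) (h : E) :
    ‖h - hT.resolvent h‖ = ‖h‖ := by
  set u := hT.resolvent h with hu
  set Y : ℝ → E := fun s => ∫ t in 0..s, Real.exp (-t / 2) • T t h with hY
  have hYd : HasDerivAt Y h 0 := by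
    simpa [hT.zero] using hT.hasDerivAt_integral_orbit h 0
  have hY0 : Y 0 = 0 := intervalIntegral.integral_same
  have h1 : HasDerivWithinAt (fun s => (inner ℂ (u - Y s) (u - Y s) : ℂ))
      (-(inner ℂ u h + inner ℂ h u)) (Ici 0) 0 := by
    have h2 := ((hYd.const_sub u).inner ℂ (hYd.const_sub u)).hasDerivWithinAt (s := Ici 0)
    refine h2.congr_deriv ?_
    rw [hY0, sub_zero, inner_neg_left, inner_neg_right]
    ring
  have h3 : HasDerivWithinAt (fun s : ℝ => ((Real.exp (-s) : ℝ) : ℂ) * inner ℂ u u)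
      (-inner ℂ u u) (Ici 0) 0 := by
    have h4 : HasDerivAt (fun s : ℝ => Real.exp (-s)) (-1) 0 := by
      simpa using (hasDerivAt_neg (0 : ℝ)).exp
    simpa using (h4.ofReal_comp.mul_const (inner ℂ u u : ℂ)).hasDerivWithinAt (s := Ici 0)
  -- Both sides are minus the right derivative at zero of `‖u - Y s‖²`, which equals `e^{-s} ‖u‖²`
  -- because the semigroup is isometric.
  have h5 : (inner ℂ u h + inner ℂ h u : ℂ) = inner ℂ u u := by
    refine neg_injective ((uniqueDiffWithinAt_Ici 0).eq_deriv _ h1 (h3.congr_of_mem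
      (fun s hs => ?_) self_mem_Ici))
    have hs' : (0 : ℝ) ≤ s := hs
    have h6 := hT.smul_apply_resolvent hs' h
    have h7 : u - Y s = Real.exp (-s / 2) • T s u := h6.symm
    rw [h7, inner_self_eq_norm_sq_to_K, inner_self_eq_norm_sq_to_K, norm_smul, hiso s hs',
      Real.norm_of_nonneg (Real.exp_pos _).le]
    have h9 : Real.exp (-s) = Real.exp (-s / 2) ^ 2 := by
      rw [← Real.exp_nat_mul]
      congr 1
      push_cast
      ring
    rw [h9]
    push_cast [-Complex.ofReal_exp]
    rw [mul_pow]
    rfl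
  have h8 : (inner ℂ (h - u) (h - u) : ℂ) = inner ℂ h h := by
    rw [inner_sub_left, inner_sub_right, inner_sub_right, ← h5]
    ring
  rw [inner_self_eq_norm_sq_to_K, inner_self_eq_norm_sq_to_K] at h8
  have h9 : ‖h - u‖ ^ 2 = ‖h‖ ^ 2 := by exact_mod_cast h8
  exact (sq_eq_sq₀ (norm_nonneg _) (norm_nonneg _)).1 h9

omit hT in
theorem adjoint_resolvent {T' : ℝ → E →L[ℂ] E} (hT : IsContractionSemigroup T)
    (hT' : IsContractionSemigroup T') (hadj : ∀ t, ContinuousLinearMap.adjoint (T t) = T' t) :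
    ContinuousLinearMap.adjoint hT.resolvent = hT'.resolvent := by
  refine ContinuousLinearMap.ext fun f => ext_inner_left ℂ fun g => ?_
  rw [ContinuousLinearMap.adjoint_inner_right, resolvent_apply, resolvent_apply,
    ← integral_inner (hT'.integrable_orbit f), ← inner_conj_symm,
    ← integral_inner (hT.integrable_orbit g), ← integral_conj]
  refine setIntegral_congr_fun measurableSet_Ioi fun t _ => ?_
  simp only [inner_conj_symm]
  rw [← hadj, inner_smul_left_eq_star_smul, inner_smul_right_eq_smul,
    ContinuousLinearMap.adjoint_inner_right]
  simp

omit hT in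
theorem mul_resolvent {T' : ℝ → E →L[ℂ] E} {Γ : E →L[ℂ] E} (hT : IsContractionSemigroup T)
    (hT' : IsContractionSemigroup T') (h : ∀ t, 0 ≤ t → Γ * T t = T' t * Γ) :
    Γ * hT.resolvent = hT'.resolvent * Γ := by
  refine ContinuousLinearMap.ext fun f => ?_
  rw [mul_apply_eq_comp, mul_apply_eq_comp, resolvent_apply, resolvent_apply,
    ← ContinuousLinearMap.integral_comp_comm _ (hT.integrable_orbit f)]
  refine setIntegral_congr_fun measurableSet_Ioi fun t ht => ?_
  simp only [ContinuousLinearMap.map_smul_of_tower]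
  rw [← mul_apply_eq_comp, h t (le_of_lt ht), mul_apply_eq_comp]

end IsContractionSemigroup

end Semigroup


/-! ### The Laguerre shift on the half-line -/

section LaguerreShift

local notation "ν" => (volume.restrict (Ioi (0 : ℝ)) : Measure ℝ)

theorem ae_comp_add {p : ℝ → Prop} (h : ∀ᵐ r ∂ν, p r) {s : ℝ} (hs : 0 ≤ s) :
    ∀ᵐ r ∂ν, p (r + s) := by
  have h2 := (ae_restrict_iff' measurableSet_Ioi).1 h
  have h3 := (measurePreserving_add_right volume s).quasiMeasurePreserving.ae h2
  refine (ae_restrict_iff' measurableSet_Ioi).2 ?_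
  filter_upwards [h3] with r hr hr0
  exact hr (add_pos_of_pos_of_nonneg hr0 hs)

theorem leftShift_leftShift {s t : ℝ} (hs : 0 ≤ s) (ht : 0 ≤ t) (f : L2 ℂ) :
    leftShift s (leftShift t f) = leftShift (s + t) f := by
  refine Lp.ext ?_
  filter_upwards [leftShift_ae hs (leftShift t f), ae_comp_add (leftShift_ae ht f) hs,
    leftShift_ae (add_nonneg hs ht) f] with r h1 h2 h3
  rw [h1, h2, h3, add_assoc]

theorem leftShift_zero (f : L2 ℂ) : leftShift 0 f = f := by
  refine Lp.ext ?_
  filter_upwards [leftShift_ae le_rfl f] with r h1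
  rw [h1, add_zero]

theorem leftShift_leftShift_neg {t : ℝ} (ht : 0 ≤ t) (f : L2 ℂ) :
    leftShift t (leftShift (-t) f) = f := by
  refine Lp.ext ?_
  filter_upwards [leftShift_ae ht (leftShift (-t) f),
    ae_comp_add (leftShift_neg_ae (t := t) f) ht, ae_restrict_mem measurableSet_Ioi]
    with r h1 h2 h3
  rw [h1, h2, indicator_of_mem (by simpa using h3), add_sub_cancel_right]

theorem isContractionSemigroup_leftShift : IsContractionSemigroup leftShift where
  continuous := continuous_leftShift
  norm_le := norm_leftShift_apply_le
  zero := leftShift_zero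
  add _ _ hs ht := leftShift_leftShift hs ht

theorem isContractionSemigroup_leftShift_neg :
    IsContractionSemigroup fun t => leftShift (-t) where
  continuous f := (continuous_leftShift f).comp continuous_neg
  norm_le t := norm_leftShift_apply_le (-t)
  zero f := by rw [neg_zero, leftShift_zero]
  add s t hs ht f := by
    refine ext_inner_right ℂ fun g => ?_
    simp only [← adjoint_leftShift, ContinuousLinearMap.adjoint_inner_left]
    rw [leftShift_leftShift ht hs, add_comm]

theorem norm_leftShift_neg {t : ℝ} (ht : 0 ≤ t) (f : L2 ℂ) : ‖leftShift (-t) f‖ = ‖f‖ := by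
  refine le_antisymm (norm_leftShift_apply_le _ _) ?_
  nth_rewrite 1 [← leftShift_leftShift_neg ht f]
  exact norm_leftShift_apply_le _ _

/-- The cogenerator of the semigroup of right shifts. -/
def laguerreShift : L2 ℂ →L[ℂ] L2 ℂ := 1 - isContractionSemigroup_leftShift_neg.resolvent

theorem adjoint_laguerreShift :
    ContinuousLinearMap.adjoint laguerreShift = 1 - isContractionSemigroup_leftShift.resolvent := by
  rw [laguerreShift, map_sub, IsContractionSemigroup.adjoint_resolvent _
    isContractionSemigroup_leftShift fun t => by rw [adjoint_leftShift, neg_neg]]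
  congr 1
  exact ContinuousLinearMap.adjoint_id

theorem adjoint_laguerreShift_mul_self :
    ContinuousLinearMap.adjoint laguerreShift * laguerreShift = 1 :=
  (ContinuousLinearMap.norm_map_iff_adjoint_comp_self laguerreShift).1
    (isContractionSemigroup_leftShift_neg.norm_sub_resolvent fun _ ht => norm_leftShift_neg ht)

theorem mul_laguerreShift {Γ : L2 ℂ →L[ℂ] L2 ℂ}
    (h : ∀ t, 0 ≤ t → Γ * leftShift (-t) = leftShift t * Γ) :
    Γ * laguerreShift = ContinuousLinearMap.adjoint laguerreShift * Γ := by
  rw [adjoint_laguerreShift, laguerreShift, mul_sub, sub_mul, mul_one, one_mul,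
    isContractionSemigroup_leftShift_neg.mul_resolvent isContractionSemigroup_leftShift h]

theorem eq_zero_of_laguerreShift_laguerreShift_eq {g : L2 ℂ}
    (hg : laguerreShift (laguerreShift g) = g) : g = 0 := by
  have hR := isContractionSemigroup_leftShift_neg
  have hV : ∀ f, laguerreShift f = f - hR.resolvent f := fun f => rfl
  -- This vector is fixed by the cogenerator, so the resolvent kills it. The difference `g -
  -- laguerreShift g` is reversed in sign, so the resolvent doubles it and every right shift fixes
  -- it; since left shifts tend strongly to zero, it vanishes too.
  have hp : g + laguerreShift g = 0 := by
    refine hR.eq_zero_of_resolvent_eq_zero ?_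
    have h1 := hV (g + laguerreShift g)
    rw [map_add, hg] at h1
    rw [← sub_eq_zero, ← neg_eq_zero]
    calc _ = (g + laguerreShift g - hR.resolvent (g + laguerreShift g)) -
          (laguerreShift g + g) := by abel
      _ = 0 := by rw [← h1, sub_self]
  have hm : g - laguerreShift g = 0 := by
    set n := g - laguerreShift g with hn
    have h1 : hR.resolvent n = (2 : ℝ) • n := by
      have h2 := hV n
      rw [hn, map_sub, hg, ← hn] at h2
      rw [two_smul]
      calc hR.resolvent n = n - (n - hR.resolvent n) := by abel
        _ = n - (laguerreShift g - g) := by rw [← h2]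
        _ = n + n := by rw [hn]; abel
    have h3 : ∀ s, 0 ≤ s → leftShift (-s) n = n := fun s hs => by
      have := hR.apply_eq_of_resolvent_eq two_ne_zero h1 hs
      rw [this, sub_self, Real.exp_zero]
      exact one_smul ℝ n
    have h4 : ∀ s, 0 ≤ s → (inner ℂ n (leftShift s n) : ℂ) = inner ℂ n n := fun s hs => by
      nth_rewrite 3 [← h3 s hs]
      rw [← adjoint_leftShift, ContinuousLinearMap.adjoint_inner_left]
    have h5 : Tendsto (fun s => (inner ℂ n (leftShift s n) : ℂ)) atTop (𝓝 (inner ℂ n 0)) :=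
      tendsto_const_nhds.inner (tendsto_leftShift_atTop n)
    have h6 := tendsto_nhds_unique (h5.congr' ((eventually_ge_atTop 0).mono h4)) tendsto_const_nhds
    rw [inner_zero_right] at h6
    exact inner_self_eq_zero.1 h6.symm
  have h2 : (2 : ℂ) • g = 0 := by
    rw [two_smul]
    calc g + g = (g + laguerreShift g) + (g - laguerreShift g) := by abel
      _ = 0 := by rw [hp, hm, add_zero]
  exact (smul_eq_zero.1 h2).resolve_left two_ne_zero

theorem leftShift_eq_of_adjoint_laguerreShift_eq_zero {k : L2 ℂ}
    (hk : ContinuousLinearMap.adjoint laguerreShift k = 0) {s : ℝ} (hs : 0 ≤ s) :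
    leftShift s k = Real.exp (-s / 2) • k := by
  rw [adjoint_laguerreShift, sub_apply, sub_eq_zero] at hk
  have := isContractionSemigroup_leftShift.apply_eq_of_resolvent_eq one_ne_zero
    (h := k) (hk.symm.trans (one_smul ℝ k).symm) hs
  rw [this]
  congr 2
  ring

/-- The indicator function of `(0, s]`. -/
def unitStep (s : ℝ) : L2 ℂ :=
  indicatorConstLp 2 (measurableSet_Ioc : MeasurableSet (Ioc 0 s))
    (ne_top_of_le_ne_top measure_Ioc_lt_top.ne (Measure.restrict_apply_le _ _)) 1

theorem inner_unitStep {s : ℝ} (hs : 0 ≤ s) (k : L2 ℂ) :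
    inner ℂ (unitStep s) k = ∫ t in 0..s, (Ioi (0 : ℝ)).indicator k t := by
  rw [unitStep, L2.inner_indicatorConstLp_one, intervalIntegral.integral_of_le hs,
    Measure.restrict_restrict measurableSet_Ioc, inter_eq_left.2 Ioc_subset_Ioi_self]
  exact setIntegral_congr_fun measurableSet_Ioc fun t ht => (indicator_of_mem (mem_Ioi.2 ht.1) _).symm

theorem locallyIntegrable_indicator (k : L2 ℂ) :
    LocallyIntegrable ((Ioi (0 : ℝ)).indicator k) volume :=
  ((memLp_indicator_iff_restrict measurableSet_Ioi).2 (Lp.memLp k)).locallyIntegrable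
    (by norm_num)

theorem eq_zero_of_inner_unitStep {k : L2 ℂ} (h : ∀ s, 0 ≤ s → inner ℂ (unitStep s) k = 0) :
    k = 0 := by
  refine Lp.ext ?_
  have h1 := ae_restrict_of_ae (s := Ioi 0) (LocallyIntegrable.ae_hasDerivAt_integral
    (locallyIntegrable_indicator k))
  filter_upwards [h1, ae_restrict_mem measurableSet_Ioi, Lp.coeFn_zero ℂ 2 ν] with r h2 hr h3
  have h4 : (fun x => ∫ t in 0..x, (Ioi (0 : ℝ)).indicator k t) =ᶠ[𝓝 r] fun _ => 0 := by
    filter_upwards [Ioi_mem_nhds hr] with x hx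
    rw [← inner_unitStep (le_of_lt hx), h x (le_of_lt hx)]
  have h5 := (h2 0).unique ((hasDerivAt_const r (0 : ℂ)).congr_of_eventuallyEq h4)
  rw [indicator_of_mem hr] at h5
  rw [h5, h3, Pi.zero_apply]

theorem inner_unitStep_add {k : L2 ℂ} {s y : ℝ} (hs : 0 ≤ s) (hy : 0 ≤ y) :
    inner ℂ (unitStep (s + y)) k = inner ℂ (unitStep s) k + inner ℂ (unitStep y) (leftShift s k) := by
  have hloc := locallyIntegrable_indicator k
  have hint : ∀ a b, IntervalIntegrable ((Ioi (0 : ℝ)).indicator k) volume a b := fun a b =>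
    (hloc.integrableOn_isCompact isCompact_uIcc).intervalIntegrable
  rw [inner_unitStep (add_nonneg hs hy), inner_unitStep hs, inner_unitStep hy,
    ← intervalIntegral.integral_add_adjacent_intervals (hint 0 s) (hint s (s + y))]
  congr 1
  have h1 : ∫ t in 0..y, (Ioi (0 : ℝ)).indicator (leftShift s k) t =
      ∫ t in 0..y, (Ioi (0 : ℝ)).indicator k (t + s) := by
    rw [intervalIntegral.integral_of_le hy, intervalIntegral.integral_of_le hy]
    refine integral_congr_ae ?_
    have h2 := (ae_restrict_iff' measurableSet_Ioi).1 (leftShift_ae hs k)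
    refine (ae_restrict_iff' measurableSet_Ioc).2 ?_
    filter_upwards [h2] with t ht ht0
    rw [indicator_of_mem (mem_Ioi.2 ht0.1), ht ht0.1,
      indicator_of_mem (mem_Ioi.2 (add_pos_of_pos_of_nonneg ht0.1 hs))]
  rw [h1, intervalIntegral.integral_comp_add_right, zero_add, add_comm y s]

/-- The primitive `F(s) = ∫₀ˢ k` satisfies `F(s + y) = F(s) + e^{-s/2} F(y)`. Exchanging `s` and `1`
when `F(1) = 0` gives `F(s) = e^{-1/2} F(s)`. -/
theorem eq_zero_of_leftShift_eq {k : L2 ℂ}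
    (hk : ∀ s, 0 ≤ s → leftShift s k = Real.exp (-s / 2) • k)
    (h1 : inner ℂ (unitStep 1) k = 0) : k = 0 := by
  have hadd : ∀ s y, 0 ≤ s → 0 ≤ y → inner ℂ (unitStep (s + y)) k =
      inner ℂ (unitStep s) k + (Real.exp (-s / 2) : ℂ) * inner ℂ (unitStep y) k :=
    fun s y hs hy => by
      rw [inner_unitStep_add hs hy, hk s hs, inner_smul_right_eq_smul, Complex.real_smul]
  refine eq_zero_of_inner_unitStep fun s hs => ?_
  have e1 := hadd s 1 hs zero_le_one
  have e2 := hadd 1 s zero_le_one hs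
  rw [h1, mul_zero, add_zero] at e1
  rw [h1, zero_add, add_comm, e1] at e2
  have e3 : (1 - (Real.exp (-1 / 2) : ℂ)) * inner ℂ (unitStep s) k = 0 := by
    rw [sub_mul, one_mul, ← e2, sub_self]
  refine (mul_eq_zero.1 e3).resolve_left (sub_ne_zero.2 fun h => ?_)
  have h' : (1 : ℝ) = Real.exp (-1 / 2) := by exact_mod_cast h
  have : Real.exp (-1 / 2) < 1 := Real.exp_lt_one_iff.2 (by norm_num)
  linarith

/-- Kernel vectors are determined by their integral over `(0, 1]`, so any nonzero one spans the
kernel. A trivial kernel is also covered, with `e = 0`, so no explicit kernel vector is needed. -/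
theorem exists_span_ker_adjoint_laguerreShift :
    ∃ e : L2 ℂ, ContinuousLinearMap.adjoint laguerreShift e = 0 ∧
      ∀ k, ContinuousLinearMap.adjoint laguerreShift k = 0 → ∃ c : ℂ, k = c • e := by
  by_cases h : ∃ e : L2 ℂ, ContinuousLinearMap.adjoint laguerreShift e = 0 ∧ e ≠ 0
  · obtain ⟨e, he, he0⟩ := h
    refine ⟨e, he, fun k hk => ?_⟩
    have h1 : inner ℂ (unitStep 1) e ≠ 0 := fun h0 => he0 <|
      eq_zero_of_leftShift_eq (fun s hs => leftShift_eq_of_adjoint_laguerreShift_eq_zero he hs) h0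
    refine ⟨inner ℂ (unitStep 1) k / inner ℂ (unitStep 1) e, sub_eq_zero.1 ?_⟩
    refine eq_zero_of_leftShift_eq
      (fun s hs => leftShift_eq_of_adjoint_laguerreShift_eq_zero ?_ hs) ?_
    · rw [map_sub, map_smul, hk, he, smul_zero, sub_zero]
    · rw [inner_sub_right, inner_smul_right, div_mul_cancel₀ _ h1, sub_self]
  · push Not at h
    exact ⟨0, map_zero _, fun k hk => ⟨0, by rw [h k hk, smul_zero]⟩⟩

end LaguerreShift


/-! ### Product formula -/

/-- `m` is a multiplicity and `q z` the factor of `z`. Unconditional convergence allows grouping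
along the fibres `{z, -z}` of squaring; each group contributes `1`, or one factor `q z` when the
multiplicities differ by one. -/
theorem hasProd_pow_sq_fiber {q : ℂ → ℂ} {m : ℂ → ℕ} {P : ℂ} (hq : q 0 = 1)
    (hP : HasProd (fun z => q z ^ m z) P) (hm : ∀ z, m z ≤ m (-z) + 1)
    (hqm : ∀ z, m z ≠ 0 → m (-z) ≠ 0 → q z * q (-z) = 1) :
    HasProd (fun z : {z | m z = m (-z) + 1} => q z) P := by
  set Z := {z | m z = m (-z) + 1} with hZ
  -- group the factors of `z` and `-z`
  have hfib : ∀ z : ℂ, z ≠ 0 → HasProd (fun y : {y : ℂ // y ^ 2 = z ^ 2} => q y ^ m y)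
      (q z ^ m z * q (-z) ^ m (-z)) := fun z hz => by
    have hne : z ≠ -z := fun h => hz (self_eq_neg.1 h)
    have h1 : {y : ℂ | y ^ 2 = z ^ 2} = (({z, -z} : Finset ℂ) : Set ℂ) := by
      ext y
      simp [sq_eq_sq_iff_eq_or_eq_neg]
    have h2 := Finset.hasProd ({z, -z} : Finset ℂ) fun y => q y ^ m y
    rw [Finset.prod_pair hne] at h2
    have h3 : HasProd ((fun y => q y ^ m y) ∘ ((↑) : {y : ℂ | y ^ 2 = z ^ 2} → ℂ))
      (q z ^ m z * q (-z) ^ m (-z)) := by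
      rw [h1]
      exact h2
    exact h3
  have hfib0 : HasProd (fun y : {y : ℂ // y ^ 2 = 0} => q y ^ m y) 1 := by
    have h1 : ∀ y : {y : ℂ // y ^ 2 = 0}, q y ^ m y = 1 := fun y => by
      rw [pow_eq_zero_iff two_ne_zero |>.1 y.2, hq, one_pow]
    simp only [h1]
    exact hasProd_one
  have hval : ∀ z, z ∈ Z → q z ^ m z * q (-z) ^ m (-z) = q z := fun z hz => by
    have hz' : m z = m (-z) + 1 := hz
    by_cases h0 : m (-z) = 0
    · rw [hz', h0]; simp
    · have h1 := hqm z (by omega) h0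
      rw [hz', pow_succ, mul_right_comm, ← mul_pow, h1, one_pow, one_mul]
  have hval1 : ∀ z, m z = m (-z) → q z ^ m z * q (-z) ^ m (-z) = 1 := fun z hz => by
    by_cases h0 : m (-z) = 0
    · rw [hz, h0]; simp
    · rw [← hz, ← mul_pow, hqm z (by omega) h0, one_pow]
  have hZ0 : ∀ z ∈ Z, z ≠ 0 := fun z hz h0 => by
    have hz' : m z = m (-z) + 1 := hz
    rw [h0, neg_zero] at hz'
    omega
  set g : ℂ → ℂ := fun c => ∏' y : {y : ℂ // y ^ 2 = c}, q y ^ m y with hg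
  have hgz : ∀ z, z ≠ 0 → g (z ^ 2) = q z ^ m z * q (-z) ^ m (-z) := fun z hz =>
    (hfib z hz).tprod_eq
  have hsig : HasProd g P := by
    refine HasProd.sigma (γ := fun c => {y : ℂ // y ^ 2 = c})
      (f := fun a : Σ c, {y : ℂ // y ^ 2 = c} => q a.2 ^ m a.2) ?_ fun c => ?_
    · exact (Equiv.sigmaFiberEquiv fun y : ℂ => y ^ 2).hasProd_iff.2 hP
    · obtain ⟨z, rfl⟩ : ∃ z : ℂ, z ^ 2 = c := IsAlgClosed.exists_pow_nat_eq c two_pos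
      by_cases hz : z = 0
      · subst hz
        rw [zero_pow two_ne_zero]
        exact hfib0.multipliable.hasProd
      · exact (hfib z hz).multipliable.hasProd
  have hinj : Function.Injective fun z : Z => (z : ℂ) ^ 2 := by
    rintro ⟨z, hz⟩ ⟨y, hy⟩ h
    have hz' : m z = m (-z) + 1 := hz
    have hy' : m y = m (-y) + 1 := hy
    rcases sq_eq_sq_iff_eq_or_eq_neg.1 h with h1 | h1
    · exact Subtype.ext h1
    · have h2 : z = -y := h1
      rw [h2, neg_neg] at hz'
      omega
  refine (((hinj.hasProd_iff fun c hc => ?_).2 hsig).congr_fun ?_)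
  · obtain ⟨z, rfl⟩ : ∃ z : ℂ, z ^ 2 = c := IsAlgClosed.exists_pow_nat_eq c two_pos
    by_cases hz : z = 0
    · subst hz
      rw [hg, zero_pow two_ne_zero]
      exact hfib0.tprod_eq
    · rw [hgz z hz]
      have hzZ : z ∉ Z := fun h => hc ⟨⟨z, h⟩, rfl⟩
      have hzZ' : -z ∉ Z := fun h => hc ⟨⟨-z, h⟩, by simp⟩
      have h1 : ¬ m z = m (-z) + 1 := hzZ
      have h2 : ¬ m (-z) = m (- -z) + 1 := hzZ'
      have h3 := hm z
      have h4 := hm (-z)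
      rw [neg_neg] at h2 h4
      exact hval1 z (by omega)
  · intro z
    rw [Function.comp_apply, hgz _ (hZ0 _ z.2), hval _ z.2]

/-! ### Eigenvalue products for compact self-adjoint operators -/

section Eigenbasis

universe u

variable {E : Type u} [NormedAddCommGroup E] [InnerProductSpace ℂ E] {Γ : E →L[ℂ] E}

/-- In a basis of eigenvectors the finite sections are diagonal, so convergence of their
determinants is exactly unconditional convergence of the product. -/
theorem hasProd_one_add_of_hasFredholmDet {ι : Type u} {B : HilbertBasis ι ℂ E} {l : ι → ℂ}
    (hB : ∀ i, Γ (B i) = l i • B i) {μ d : ℂ} (h : HasFredholmDet (μ • Γ) d) :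
    HasProd (fun i => 1 + μ * l i) d := by
  classical
  have h1 := h ι B
  refine h1.congr fun s => ?_
  have h2 : (1 : Matrix s s ℂ) + Matrix.of (fun i j : s => inner ℂ (B i) ((μ • Γ) (B j))) =
      Matrix.diagonal fun i : s => 1 + μ * l i := by
    ext i j
    rw [Matrix.add_apply, Matrix.of_apply, smul_apply, hB, smul_smul, inner_smul_right,
      orthonormal_iff_ite.1 B.orthonormal]
    by_cases hij : i = j
    · subst hij; simp
    · simp [hij, Subtype.coe_injective.ne hij]
  rw [← Finset.prod_coe_sort s, ← Matrix.det_diagonal, ← h2]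

variable [CompleteSpace E]

/-- A compact self-adjoint operator has an orthonormal basis of eigenvectors, indexed along the
eigenvalues. -/
theorem exists_eigenbasis (hc : IsCompactOperator Γ) (hs : IsSelfAdjoint Γ) :
    ∃ (w : ℂ → Type u) (B : HilbertBasis (Σ z, w z) ℂ E), (∀ a, Γ (B a) = a.1 • B a) ∧
      ∀ z, z ≠ 0 → Finite (w z) ∧
        Nat.card (w z) = Module.finrank ℂ (Module.End.eigenspace (Γ : Module.End ℂ E) z) := by
  have hsymm : (Γ : E →ₗ[ℂ] E).IsSymmetric := hs.isSymmetric
  have hcompl : ∀ z, CompleteSpace (Module.End.eigenspace (Γ : Module.End ℂ E) z) := fun z => by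
    have h1 : IsClosed (Module.End.eigenspace (Γ : Module.End ℂ E) z : Set E) := by
      have h2 : (Module.End.eigenspace (Γ : Module.End ℂ E) z : Set E) = {f | Γ f = z • f} := by
        ext f
        exact Module.End.mem_eigenspace_iff
      rw [h2]
      exact isClosed_eq Γ.continuous (continuous_const_smul z)
    exact h1.completeSpace_coe
  choose w b hb using fun z =>
    exists_hilbertBasis ℂ (Module.End.eigenspace (Γ : Module.End ℂ E) z)
  have hon : Orthonormal ℂ fun a : Σ z, w z => ((b a.1 a.2 : Module.End.eigenspace
      (Γ : Module.End ℂ E) a.1) : E) :=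
    hsymm.orthogonalFamily_eigenspaces.orthonormal_sigma_orthonormal fun z => (b z).orthonormal
  -- A vector orthogonal to all chosen basis vectors is orthogonal to every eigenspace, by expansion
  -- there; the spectral theorem leaves only zero.
  have htot : (Submodule.span ℂ (range fun a : Σ z, w z => ((b a.1 a.2 : Module.End.eigenspace
      (Γ : Module.End ℂ E) a.1) : E)))ᗮ = ⊥ := by
    rw [eq_bot_iff, ← ContinuousLinearMap.orthogonalComplement_iSup_eigenspaces_eq_bot hc hsymm]
    intro u hu
    have hu' : (⨆ z, Module.End.eigenspace (Γ : Module.End ℂ E) z) ≤ (ℂ ∙ u)ᗮ := by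
      refine iSup_le fun z f hf => Submodule.mem_orthogonal_singleton_iff_inner_right.2 ?_
      have h1 := ((b z).hasSum_repr ⟨f, hf⟩).mapL
        (innerSL ℂ u ∘L (Module.End.eigenspace (Γ : Module.End ℂ E) z).subtypeL)
      have h2 : ∀ i : w z, (innerSL ℂ u ∘L (Module.End.eigenspace (Γ : Module.End ℂ E) z).subtypeL)
          ((b z).repr ⟨f, hf⟩ i • b z i) = 0 := fun i => by
        have h3 : inner ℂ u ((b z i : Module.End.eigenspace (Γ : Module.End ℂ E) z) : E) = 0 :=
          inner_eq_zero_symm.1 (hu _ (Submodule.subset_span ⟨⟨z, i⟩, rfl⟩))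
        rw [map_smul, ContinuousLinearMap.comp_apply, innerSL_apply_apply, Submodule.subtypeL_apply, h3,
          smul_zero]
      simp only [h2] at h1
      exact h1.unique hasSum_zero
    rw [Submodule.mem_orthogonal]
    exact fun f hf => Submodule.mem_orthogonal_singleton_iff_inner_left.1 (hu' hf)
  refine ⟨fun z => w z, HilbertBasis.mkOfOrthogonalEqBot hon htot, fun a => ?_, fun z hz => ?_⟩
  · rw [HilbertBasis.coe_mkOfOrthogonalEqBot]
    exact Module.End.mem_eigenspace_iff.1 (b a.1 a.2).2
  · have := ContinuousLinearMap.finite_dimensional_eigenspace hc z hz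
    have hfin : Finite (w z) := (b z).orthonormal.linearIndependent.finite
    have := Fintype.ofFinite (w z)
    exact ⟨hfin, by rw [Nat.card_eq_fintype_card,
      Module.finrank_eq_card_basis (b z).toOrthonormalBasis.toBasis]⟩

theorem exists_hasProd_div_of_eigenspaces (hc : IsCompactOperator Γ) (hs : IsSelfAdjoint Γ)
    (hsum : ∀ {ι : Type u} (B : HilbertBasis ι ℂ E), Summable fun i => ‖inner ℂ (B i) (Γ (B i))‖)
    (hm : ∀ z, z ≠ 0 → Module.finrank ℂ (Module.End.eigenspace (Γ : Module.End ℂ E) z) ≤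
      Module.finrank ℂ (Module.End.eigenspace (Γ : Module.End ℂ E) (-z)) + 1)
    {τ : ℂ → ℂ} (hτ : ∀ μ, HasFredholmDet (μ • Γ) (τ μ)) :
    ∃ Z : Set ℂ, Z.Countable ∧ (∀ z ∈ Z, -z ∉ Z) ∧ ∀ μ : ℂ, τ (-μ) ≠ 0 →
      (∀ z ∈ Z, 1 - μ * z ≠ 0) ∧
      HasProd (fun z : Z => (1 + μ * (z : ℂ)) / (1 - μ * (z : ℂ))) (τ μ / τ (-μ)) := by
  obtain ⟨w, B, hB, hw⟩ := exists_eigenbasis hc hs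
  set m : ℂ → ℕ := fun z => Module.finrank ℂ (Module.End.eigenspace (Γ : Module.End ℂ E) z) with hmd
  have hne : ∀ z, z ≠ 0 → m z ≠ 0 → Nonempty (w z) := fun z hz h0 => by
    have h1 := (hw z hz).2
    by_contra h2
    rw [not_nonempty_iff] at h2
    rw [Nat.card_of_isEmpty] at h1
    exact h0 h1.symm
  have hZ0 : ∀ z, m z = m (-z) + 1 → z ≠ 0 := fun z hz h0 => by
    rw [h0, neg_zero] at hz
    omega
  have hm' : ∀ z, m z ≤ m (-z) + 1 := fun z => by
    by_cases hz : z = 0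
    · rw [hz, neg_zero]; omega
    · exact hm z hz
  refine ⟨{z | m z = m (-z) + 1}, ?_, fun z hz hz' => ?_, fun μ hμ => ?_⟩
  · have h1 := (hsum B).countable_support
    refine (h1.image Sigma.fst).mono fun z hz => ?_
    have hz' : m z = m (-z) + 1 := hz
    obtain ⟨i⟩ := hne z (hZ0 z hz) (by omega)
    refine ⟨⟨z, i⟩, ?_, rfl⟩
    rw [Function.mem_support, hB, inner_smul_right, inner_self_eq_norm_sq_to_K, B.orthonormal.1]
    simpa using hZ0 z hz
  · have h1 : m z = m (-z) + 1 := hz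
    have h2 : m (-z) = m (- -z) + 1 := hz'
    rw [neg_neg] at h2
    omega
  · have hp := hasProd_one_add_of_hasFredholmDet hB (hτ μ)
    have hn := hasProd_one_add_of_hasFredholmDet hB (hτ (-μ))
    have hn0 : ∀ a : Σ z, w z, 1 - μ * a.1 ≠ 0 := fun a h0 => hμ <| by
      refine hn.unique (hasProd_zero_of_exists_eq_zero ⟨a, ?_⟩)
      rw [← h0]
      ring
    have hn1 : ∀ z, z ≠ 0 → m z ≠ 0 → 1 - μ * z ≠ 0 := fun z hz h0 => by
      obtain ⟨i⟩ := hne z hz h0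
      exact hn0 ⟨z, i⟩
    refine ⟨fun z hz => ?_, ?_⟩
    · have hz' : m z = m (-z) + 1 := hz
      exact hn1 z (hZ0 z hz) (by omega)
    · set q : ℂ → ℂ := fun z => (1 + μ * z) / (1 - μ * z) with hq
      have hdiv : HasProd (fun a : Σ z, w z => q a.1) (τ μ / τ (-μ)) := by
        refine (Tendsto.div hp hn hμ).congr fun s => ?_
        rw [Pi.div_apply, ← Finset.prod_div_distrib]
        refine Finset.prod_congr rfl fun a _ => ?_
        rw [hq, neg_mul, ← sub_eq_add_neg]
      have hq0 : q 0 = 1 := by simp [hq]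
      refine hasProd_pow_sq_fiber hq0 (hdiv.sigma fun z => ?_) hm' fun z h1 h2 => ?_
      · by_cases hz : z = 0
        · subst hz
          simp only [hq0, one_pow]
          exact hasProd_one
        · obtain ⟨hfin, hcard⟩ := hw z hz
          have := Fintype.ofFinite (w z)
          have h3 := hasProd_fintype fun _ : w z => q z
          rwa [Finset.prod_const, Finset.card_univ, ← Nat.card_eq_fintype_card, hcard] at h3
      · by_cases hz : z = 0
        · rw [hz, neg_zero, hq0, one_mul]
        · have h3 := hn1 z hz h1
          have h4 := hn1 (-z) (neg_ne_zero.2 hz) h2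
          rw [mul_neg, sub_neg_eq_add] at h4
          simp only [hq, mul_neg, sub_neg_eq_add, ← sub_eq_add_neg]
          field_simp

end Eigenbasis

/-! ### Shift relation, self-adjointness and product formula for the Hankel operators -/

section Hankel

variable {H : Type*} [NormedAddCommGroup H] [InnerProductSpace ℂ H] [CompleteSpace H]
  {L : LinearSystem H ℂ} {Θ Ξ : L2 ℂ →L[ℂ] H}

theorem adjoint_comp_eq_of_kernel_eq {β γ β' γ' : ℝ → H} {Θ' Ξ' : L2 ℂ →L[ℂ] H}
    (hΞ : IsIntegralOperator β Ξ) (hΘ : IsIntegralOperator γ Θ)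
    (hΞ' : IsIntegralOperator β' Ξ') (hΘ' : IsIntegralOperator γ' Θ')
    (h : ∀ s t, 0 < s → 0 < t → inner ℂ (γ s) (β t) = inner ℂ (γ' s) (β' t)) :
    ContinuousLinearMap.adjoint Θ ∘L Ξ = ContinuousLinearMap.adjoint Θ' ∘L Ξ' := by
  refine ContinuousLinearMap.ext fun f => Lp.ext ?_
  filter_upwards [adjoint_comp_ae hΞ hΘ f, adjoint_comp_ae hΞ' hΘ' f,
    ae_restrict_mem measurableSet_Ioi] with s h1 h2 hs
  rw [h1.2, h2.2]
  refine setIntegral_congr_fun measurableSet_Ioi fun t ht => ?_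
  simp only [h s t hs ht]

/-- Both sides are integral operators with kernel `φ(2x + s + r + t)`: shifting either variable of a
Hankel kernel has the same effect. -/
theorem shiftHankel_mul_leftShift_neg (hΘ : L.IsObservabilityOperator Θ)
    (hΞ : L.IsControllabilityOperator Ξ) {x t : ℝ} (hx : 0 ≤ x) (ht : 0 ≤ t) :
    shiftHankel Θ Ξ x * leftShift (-t) = leftShift t * shiftHankel Θ Ξ x := by
  have hΞx := hΞ.isIntegralOperator.comp_adjoint_leftShift hx
  have hΘx := hΘ.isIntegralOperator.comp_adjoint_leftShift hx
  have h := adjoint_comp_eq_of_kernel_eq (hΞx.comp_adjoint_leftShift ht) hΘx hΞx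
    (hΘx.comp_adjoint_leftShift ht) fun s r hs hr => by
      rw [← L.phi_add (by positivity) (by positivity), ← L.phi_add (by positivity) (by positivity)]
      congr 1
      ring
  rw [ContinuousLinearMap.adjoint_comp _ (ContinuousLinearMap.adjoint (leftShift t)),
    ContinuousLinearMap.adjoint_adjoint] at h
  rw [← adjoint_leftShift]
  exact h

theorem isSelfAdjoint_shiftHankel (hΘ : L.IsObservabilityOperator Θ)
    (hΞ : L.IsControllabilityOperator Ξ) (hreal : ∀ t : ℝ, 0 < t → (L.phi t).im = 0) {x : ℝ}
    (hx : 0 ≤ x) : IsSelfAdjoint (shiftHankel Θ Ξ x) := by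
  have hΞx := hΞ.isIntegralOperator.comp_adjoint_leftShift hx
  have hΘx := hΘ.isIntegralOperator.comp_adjoint_leftShift hx
  rw [ContinuousLinearMap.isSelfAdjoint_iff', shiftHankel, ContinuousLinearMap.adjoint_comp,
    ContinuousLinearMap.adjoint_adjoint]
  refine adjoint_comp_eq_of_kernel_eq hΘx hΞx hΞx hΘx fun s t hs ht => ?_
  rw [← inner_conj_symm, ← L.phi_add (by positivity) (by positivity),
    ← L.phi_add (by positivity) (by positivity), Complex.conj_eq_iff_im.2 (hreal _ (by positivity))]
  congr 1
  ring

theorem exists_hasProd_tau (hΘ : L.IsObservabilityOperator Θ)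
    (hΞ : L.IsControllabilityOperator Ξ) (hΘ' : IsHilbertSchmidt Θ) (hΞ' : IsHilbertSchmidt Ξ)
    (hreal : ∀ t : ℝ, 0 < t → (L.phi t).im = 0) {x : ℝ} (hx : 0 < x) :
    ∃ Z : Set ℂ, Z.Countable ∧ (∀ z ∈ Z, -z ∉ Z) ∧
      ∀ μ : ℂ, tau (shiftHankel Θ Ξ) (-μ) x ≠ 0 →
        (∀ z ∈ Z, 1 - μ * z ≠ 0) ∧
        HasProd (fun z : Z => (1 + μ * (z : ℂ)) / (1 - μ * (z : ℂ)))
          (tau (shiftHankel Θ Ξ) μ x / tau (shiftHankel Θ Ξ) (-μ) x) := by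
  obtain ⟨v, h, -⟩ := exists_hilbertBasis ℂ H
  have hrep := isNuclearRep_shiftHankel h hΘ' hΞ' x
  have hc : IsCompactOperator (shiftHankel Θ Ξ x) := hrep.isCompactOperator
  have hs := isSelfAdjoint_shiftHankel hΘ hΞ hreal hx.le
  obtain ⟨e, he, hker⟩ := exists_span_ker_adjoint_laguerreShift
  refine exists_hasProd_div_of_eigenspaces (τ := fun μ => tau (shiftHankel Θ Ξ) μ x) hc hs
    (fun B => ?_) (fun z hz => ?_) fun μ => (hrep.smul μ).hasFredholmDet_fredholmDet
  · have h1 := (hΘ'.comp_right (ContinuousLinearMap.adjoint (leftShift x))).summable B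
    have h2 := (hΞ'.comp_right (ContinuousLinearMap.adjoint (leftShift x))).summable B
    refine Summable.of_nonneg_of_le (fun _ => norm_nonneg _) (fun i => ?_)
      (summable_mul_of_summable_sq h1 h2 (fun _ => norm_nonneg _) fun _ => norm_nonneg _)
    rw [shiftHankel, ContinuousLinearMap.comp_apply, ContinuousLinearMap.adjoint_inner_right]
    exact norm_inner_le_norm _ _
  · have := ContinuousLinearMap.finite_dimensional_eigenspace hc z hz
    have := ContinuousLinearMap.finite_dimensional_eigenspace hc (-z) (neg_ne_zero.2 hz)
    exact finrank_eigenspace_le_finrank_eigenspace_neg_add_one hs adjoint_laguerreShift_mul_self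
      (mul_laguerreShift fun t ht => shiftHankel_mul_leftShift_neg hΘ hΞ hx.le ht) he hker
      (fun g => eq_zero_of_laguerreShift_laguerreShift_eq)

end Hankel

end TauLinearSystem
end

open TauLinearSystem in
theorem theorem2p6 {H : Type*} [NormedAddCommGroup H] [InnerProductSpace ℂ H] [CompleteSpace H]
    (L : LinearSystem H ℂ) (hL : L.IsTwoTwoAdmissible) :
    -- `Γ x` is the Hankel operator with symbol `φ_(x)(y) = φ(2x + y)`; the determinants exist
    ∃ Γ : ℝ → (L2 ℂ →L[ℂ] L2 ℂ),
      (∀ x : ℝ, 0 < x →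
        IsHankelOperator (fun y => L.phi (2 * x + y)) (Γ x) ∧ IsTraceClass (Γ x) ∧
        ∀ μ : ℂ, HasFredholmDet (μ • Γ x) (tau Γ μ x) ∧
          HasFredholmDet ((-μ ^ 2) • (Γ x ∘L Γ x)) (tauSq Γ μ x)) ∧
      -- `det (I - μ² Γ²)` has no zeros on `(0, ∞)` for small `μ`, and none at large `x` for any `μ`
      (∃ δ : ℝ, 0 < δ ∧ ∀ μ : ℂ, ‖μ‖ < δ → ∀ x : ℝ, 0 < x → tauSq Γ μ x ≠ 0) ∧
      (∀ μ : ℂ, ∃ x₀ : ℝ, 0 < x₀ ∧ ∀ x : ℝ, x₀ < x → tauSq Γ μ x ≠ 0) ∧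
      -- the Gelfand-Levitan equation wherever `det (I - μ² Γ²)` does not vanish
      (∀ (μ : ℂ) (X : Set ℝ), X = {x : ℝ | 0 < x ∧ tauSq Γ μ x ≠ 0} →
        ∃ W V : ℝ → ℝ → ℂ,
          SolvesGelfandLevitan μ (fun s => !![0, L.phi s; L.phi s, 0]) X
            (fun x y => !![W x y, V x y; V x y, W x y]) ∧
          (μ ≠ 0 → ∀ x ∈ X,
            (DifferentiableAt ℝ (tauSq Γ μ) x ∧
              W x x = 1 / (2 * μ) * logDeriv (tauSq Γ μ) x) ∧
            (tau Γ μ x ≠ 0 ∧ tau Γ (-μ) x ≠ 0 ∧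
              DifferentiableAt ℝ (tau Γ μ) x ∧ DifferentiableAt ℝ (tau Γ (-μ)) x ∧
              V x x = 1 / (2 * μ) * logDeriv (fun s => tau Γ μ s / tau Γ (-μ) s) x) ∧
            (DifferentiableAt ℝ (fun s => W s s) x ∧
              1 / (2 * μ) * deriv (fun s => W s s) x = -(V x x) ^ 2)) ∧
          -- the Miura transform: first in integrated form, then wherever `u` exists
          (μ = 1 / 2 → ∀ x ∈ X,
            HasDerivAt (fun s => V s s + 2 * logDeriv (tau Γ (-(1 / 2))) s) (-(V x x) ^ 2) x ∧
            (DifferentiableAt ℝ (logDeriv (tau Γ (-(1 / 2)))) x ↔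
              DifferentiableAt ℝ (fun s => V s s) x) ∧
            (DifferentiableAt ℝ (logDeriv (tau Γ (-(1 / 2)))) x →
              IsMiuraTransformAt (tau Γ (-(1 / 2))) (tau Γ (1 / 2))
                (fun s => V s s) (fun s => W s s)
                (fun s => -2 * deriv (logDeriv (tau Γ (-(1 / 2)))) s) x ∧
              -2 * deriv (logDeriv (tau Γ (-(1 / 2)))) x =
                deriv (fun s => V s s) x + (V x x) ^ 2))) ∧
      -- the product formula for real `φ`; `Z` is the set of the numbers `z_j(x)`
      ((∀ t : ℝ, 0 < t → (L.phi t).im = 0) → ∀ x : ℝ, 0 < x →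
        ∃ Z : Set ℂ, Z.Countable ∧ (∀ z ∈ Z, -z ∉ Z) ∧
          ∀ μ : ℂ, tau Γ (-μ) x ≠ 0 →
            (∀ z ∈ Z, 1 - μ * z ≠ 0) ∧
            HasProd (fun z : Z => (1 + μ * (z : ℂ)) / (1 - μ * (z : ℂ)))
              (tau Γ μ x / tau Γ (-μ) x)) := by
  obtain ⟨⟨Θ, hΘ, hΘ'⟩, Ξ, hΞ, hΞ'⟩ := hL
  obtain ⟨v, h, -⟩ := exists_hilbertBasis ℂ H
  refine ⟨shiftHankel Θ Ξ, fun x hx => ?_, ?_, fun μ => ?_, ?_, fun hreal x hx => ?_⟩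
  · have hrep := isNuclearRep_shiftHankel h hΘ' hΞ' x
    exact ⟨isHankelOperator_shiftHankel hΘ hΞ hx.le, hrep.isTraceClass, fun μ =>
      ⟨(hrep.smul μ).hasFredholmDet_fredholmDet,
        ((hrep.comp_left (shiftHankel Θ Ξ x)).smul (-μ ^ 2)).hasFredholmDet_fredholmDet⟩⟩
  · obtain ⟨δ, hδ, hδ'⟩ := exists_forall_tau_ne_zero hΘ' hΞ'
    refine ⟨δ, hδ, fun μ hμ x _ => ?_⟩
    rw [tauSq_eq_mul hΘ' hΞ']
    exact mul_ne_zero (hδ' μ hμ x) (hδ' (-μ) (by rwa [norm_neg]) x)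
  · have h1 := (tendsto_tau_atTop hΘ' hΞ' μ).mul (tendsto_tau_atTop hΘ' hΞ' (-μ))
    have h2 : ∀ᶠ x in atTop, tauSq (shiftHankel Θ Ξ) μ x ≠ 0 := by
      filter_upwards [h1.eventually_ne (by norm_num : (1 : ℂ) * 1 ≠ 0)] with x hx
      rwa [tauSq_eq_mul hΘ' hΞ']
    obtain ⟨x₀, hx₀⟩ := eventually_atTop.1 h2
    exact ⟨max x₀ 1, by positivity, fun x hx => hx₀ x ((le_max_left _ _).trans hx.le)⟩
  · rintro μ X rfl
    refine ⟨glDiag L Θ Ξ μ, glOffDiag L Θ Ξ μ, solvesGelfandLevitan hΘ hΞ hΘ' hΞ' μ,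
      fun hμ x hx => gelfandLevitan_diagonal hΘ hΞ hΘ' hΞ' hμ hx, fun hμ x hx => ?_⟩
    subst hμ
    exact miura_transform hΘ hΞ hΘ' hΞ' hx
  · exact exists_hasProd_tau hΘ hΞ hΘ' hΞ' hreal hx
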